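/- **Setting.** Let $X$ be a finite alphabet with $|X|\ge 2$. A (transducer) automaton over $X$ is a set of states $S$ together with a transition map $S\times X\to S$, $(s,x)\mapsto s|_x$, and an output map $S\times X\to X$, $(s,x)\mapsto s(x)$; it has an arrow $s\to s|_x$ labeled $x|s(x)$ for all $s,x$. Every state $s$ defines a transformation of finite words and of right-infinite sequences by $s(xw)=s(x)\,s|_x(w)$, and $s|_{x_1\dots x_n}=s|_{x_1}|\cdots|_{x_n}$. We write $1$ for the state that defines the identity. Let $S$ be a finite automaton over $X$ such that: (0) $S$ is invertible (each $s$ permutes $X$) and minimal (different states define different transformations); (1) $S$ is bounded, i.e. the number of directed paths of length $n$ in $S\setminus\{1\}$ is bounded independently of $n$; (2) for every $n\ge 0$ the tile graph $T_n$ is connected, where $T_n$ has vertex set $X^n$ and $v,u$ are adjacent if $s(v)=u$ and $s|_v=1$ for some $s\in S$; (3) every state of $S$ has an incoming arrow, and $S=S^{-1}$ as a set of transformations. Let $G$ be the group generated by $S$. For $w\in X^\omega$, the Schreier graph $\Gamma_w$ is the simple graph on the $G$-orbit of $w$ in which two different points $v,u$ are adjacent iff $s(v)=u$ or $s(u)=v$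 for some $s\in S$. The tile graph $T_w$ is the connected component of $w$ in the graph in which $v\ne u$ are adjacent iff there is $s\in S$ with $s(v)=u$ (or vice versa) and $s|_{v'}=1$ for some finite prefix $v'$ of $v$ (respectively, of $u$). An end of a graph is an equivalence class of rays (injective infinite paths), two rays being equivalent if for every finite vertex set $F$ infinitely many vertices of both lie in one connected component of the complement of $F$. "Almost all" refers to the uniform Bernoulli measure on $X^\omega$. **Basic form.** A state $s$ is finitary if for some $n$ all $s|_v$, $v\in X^n$, are trivial; it is circuit if $s|_v=s$ for some nonempty word $v$. For $m\ge 1$ let $S^{(m)}$ be the automaton over the alphabet $X^m$ with the same states, reading and writing blocks of $m$ letters. An automaton is in basic form if: $s|_x=1$ for every finitary state $s$ and every letter $x$; every circuit state $s$ has a letter $x$ with $s|_x=s$, and $s|_y$ is finitary for all letters $y\neq x$; and every $s|_x$ is finitary or circuit. **Types of states** (over an alphabet $Y$). Type I (for letters $x\ne y$): the arrow at $x$ is a loop at $s$ labeled $x|y$, and $s|_z=1$ for all $z\neq x$. Type II: $s\ne 1$, the arrow at $x$ is a loop at $s$ labeled $x|x$, and $s|_z=1$ for all $z\ne x$. Type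 II$'$: the same with $y$ in place of $x$. Type III$'$: $s\neq 1$ and $s|_z=1$ for all $z\in Y$. Type III: the arrow at $x$ is a loop at $s$ labeled $x|x$, the arrow at $y$ is labeled $y|y$ and goes to a state of type III$'$, and $s|_z=1$ for all $z\neq x,y$. **Theorem.** There is $m\ge 1$ such that $S^{(m)}$ is in basic form. Almost all Schreier graphs $\Gamma_w$ have two ends if and only if almost all tile graphs $T_w$ have two ends. Moreover, for every $m\ge1$ such that $S^{(m)}$ is in basic form, this happens if and only if $S^{(m)}$ (with alphabet $Y=X^m$) is one of the following. 1. $S^{(m)}$ consists of an adding machine, its inverse and the trivial state, where the adding machine is a state of type I (for some letters $x\neq y$) acting transitively on $Y$. 2. There is an enumeration $Y=\{x=x_1,x_2,\dots,x_k=y\}$ of the alphabet, without repetitions, such that one of the following holds. (a) $k$ is odd; every nontrivial state is of type II or II$'$; every pair $\{x_{2i},x_{2i+1}\}$ is an orbit on $Y$ of some state of type II, and all nontrivial orbits on $Y$ of states of type II are of this form; every pair $\{x_{2i-1},x_{2i}\}$ is an orbit on $Y$ of some state of type II$'$, and all nontrivial orbits on $Y$ of states of type II$'$ are of this form. (b)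 $k$ is even; every nontrivial state is of type II, III or III$'$; every pair $\{x_{2i},x_{2i+1}\}$ is an orbit on $Y$ of some state of type II or III, and all nontrivial orbits on $Y$ of states of type II or III are of this form; every pair $\{x_{2i-1},x_{2i}\}$ is an orbit on $Y$ of some state of type III$'$, and all nontrivial orbits on $Y$ of states of type III$'$ are of this form. Here all pairs of consecutive letters of the enumeration are meant. Furthermore, in Case 1 all Schreier graphs $\Gamma_w$, $w\in X^\omega$, are lines (isomorphic to the bi-infinite path). In Case 2(a), the sequences $x^\omega$ and $y^\omega$ (periodic sequences in $X^\omega$, as $x,y\in X^m$) lie in different $G$-orbits, $\Gamma_{x^\omega}$ and $\Gamma_{y^\omega}$ are rays (one-sided infinite paths), and $\Gamma_w$ is a line for every $w$ outside these two orbits. In Case 2(b), $\Gamma_{x^\omega}$ is a ray, and $\Gamma_w$ is a line for every $w$ outside the orbit of $x^\omega$. -/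

import Mathlib

open MeasureTheory Set

/-! ### Ends of a graph, via rays -/

/-- A ray in a graph: an infinite sequence of pairwise distinct, consecutively adjacent vertices. -/
structure GraphRay {V : Type*} (G : SimpleGraph V) where
  toFun : ℕ → V
  injective : Function.Injective toFun
  adj : ∀ n, G.Adj (toFun n) (toFun (n + 1))

namespace GraphRay

variable {V : Type*} {G : SimpleGraph V}

/-- Infinitely many vertices of the ray `r` belong to the connected component `C` of the graph
obtained from `G` by deleting the finite set `F`. -/
def VisitsInfinitely (r : GraphRay G) (F : Finset V)
    (C : (G.induce ((F : Set V)ᶜ)).ConnectedComponent) : Prop :=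
  {n : ℕ | ∃ h : r.toFun n ∈ ((F : Set V)ᶜ),
    (G.induce ((F : Set V)ᶜ)).connectedComponentMk ⟨r.toFun n, h⟩ = C}.Infinite

/-- Two rays are equivalent if for every finite set `F` of vertices infinitely many vertices of
both rays belong to one and the same connected component of `G` with `F` deleted. -/
def Equivalent (r r' : GraphRay G) : Prop :=
  ∀ F : Finset V, ∃ C : (G.induce ((F : Set V)ᶜ)).ConnectedComponent,
    r.VisitsInfinitely F C ∧ r'.VisitsInfinitely F C

theorem exists_tail (r : GraphRay G) (F : Finset V) :
    ∃ (C : (G.induce ((F : Set V)ᶜ)).ConnectedComponent) (N : ℕ), ∀ n, N ≤ n →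
      ∃ h : r.toFun n ∈ ((F : Set V)ᶜ),
        (G.induce ((F : Set V)ᶜ)).connectedComponentMk ⟨r.toFun n, h⟩ = C := by
  have hfin : {n : ℕ | r.toFun n ∈ (F : Set V)}.Finite :=
    F.finite_toSet.preimage r.injective.injOn
  obtain ⟨N, hN⟩ := hfin.bddAbove
  have hout : ∀ n, N + 1 ≤ n → r.toFun n ∈ ((F : Set V)ᶜ) := by
    intro n hn hmem
    have := hN hmem
    omega
  refine ⟨(G.induce ((F : Set V)ᶜ)).connectedComponentMk
    ⟨r.toFun (N + 1), hout _ le_rfl⟩, N + 1, ?_⟩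
  intro n hn
  induction n, hn using Nat.le_induction with
  | base => exact ⟨hout _ le_rfl, rfl⟩
  | succ n hn ih =>
    obtain ⟨h, hC⟩ := ih
    refine ⟨hout _ (by omega), ?_⟩
    rw [← hC]
    apply SimpleGraph.ConnectedComponent.sound
    apply SimpleGraph.Adj.reachable
    exact (r.adj n).symm

theorem exists_visitsInfinitely (r : GraphRay G) (F : Finset V) :
    ∃ C, r.VisitsInfinitely F C := by
  obtain ⟨C, N, h⟩ := r.exists_tail F
  exact ⟨C, (Set.Ici_infinite N).mono fun n hn => h n hn⟩

theorem visitsInfinitely_unique (r : GraphRay G) (F : Finset V)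
    {C D : (G.induce ((F : Set V)ᶜ)).ConnectedComponent}
    (hC : r.VisitsInfinitely F C) (hD : r.VisitsInfinitely F D) : C = D := by
  obtain ⟨E, N, h⟩ := r.exists_tail F
  have key : ∀ B, r.VisitsInfinitely F B → B = E := by
    intro B hB
    obtain ⟨n, ⟨hn, hnB⟩, hlt⟩ := hB.exists_gt N
    obtain ⟨_, h2⟩ := h n hlt.le
    exact hnB.symm.trans h2
  rw [key C hC, key D hD]

/-- Equivalence of rays, as a setoid. -/
def setoid (G : SimpleGraph V) : Setoid (GraphRay G) where
  r := Equivalent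
  iseqv := by
    refine ⟨?_, ?_, ?_⟩
    · intro r F
      obtain ⟨C, hC⟩ := r.exists_visitsInfinitely F
      exact ⟨C, hC, hC⟩
    · intro r r' h F
      obtain ⟨C, h1, h2⟩ := h F
      exact ⟨C, h2, h1⟩
    · intro r r' r'' h h' F
      obtain ⟨C, h1, h2⟩ := h F
      obtain ⟨D, h3, h4⟩ := h' F
      obtain rfl := r'.visitsInfinitely_unique F h2 h3
      exact ⟨C, h1, h4⟩

end GraphRay

/-- An end of a graph is an equivalence class of rays. -/
def GraphEnd {V : Type*} (G : SimpleGraph V) : Type _ := Quotient (GraphRay.setoid G)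

/-- The graph `G` has exactly two ends. -/
def HasTwoEnds {V : Type*} (G : SimpleGraph V) : Prop := Nat.card (GraphEnd G) = 2

/-- The graph `G` is a line (bi-infinite path). -/
def IsLineGraph {V : Type*} (G : SimpleGraph V) : Prop := Nonempty (G ≃g SimpleGraph.hasse ℤ)

/-- The graph `G` is a ray (one-sided infinite path). -/
def IsRayGraph {V : Type*} (G : SimpleGraph V) : Prop := Nonempty (G ≃g SimpleGraph.hasse ℕ)

/-! ### Transducer automata -/

/-- A transducer automaton with set of states `S` over the alphabet `X`. -/
structure Transducer (S X : Type*) where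
  /-- the transition map -/
  next : S → X → S
  /-- the output map -/
  out : S → X → X

namespace Transducer

variable {S X : Type*} (A : Transducer S X)

/-- The state `s|_v` reached from `s` after reading the finite word `v`. -/
def run (s : S) (v : List X) : S := v.foldl A.next s

/-- The action of a state on finite words. -/
def actWord : S → List X → List X
  | _, [] => []
  | s, x :: v => A.out s x :: actWord (A.next s x) v

theorem length_actWord (s : S) (v : List X) : (A.actWord s v).length = v.length := by
  induction v generalizing s with
  | nil => rfl
  | cons x v ih => simp [actWord, ih]

/-- The state `s|_{w_n}` reached from `s` after reading the first `n` letters of the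
right-infinite sequence `w`. -/
def stateAt (s : S) (w : ℕ → X) : ℕ → S
  | 0 => s
  | n + 1 => A.next (stateAt s w n) (w n)

/-- The action of a state on right-infinite sequences. -/
def act (s : S) (w : ℕ → X) : ℕ → X := fun n => A.out (A.stateAt s w n) (w n)

/-- The state `s` defines the identity transformation. -/
def IsTrivial (s : S) : Prop := ∀ w : ℕ → X, A.act s w = w

/-- The states `s` and `t` define mutually inverse transformations. -/
def AreInverse (s t : S) : Prop :=
  ∀ w : ℕ → X, A.act s (A.act t w) = w ∧ A.act t (A.act s w) = w

/-- Every state acts on the alphabet by a permutation. -/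
def IsInvertible : Prop := ∀ s, Function.Bijective (A.out s)

/-- Different states define different transformations. -/
def IsMinimal : Prop := ∀ s t, A.act s = A.act t → s = t

/-- The set of states is symmetric: `S⁻¹ = S`. -/
def IsSymmetric : Prop := ∀ s, ∃ t, A.AreInverse s t

/-- Every state has an incoming arrow. -/
def HasIncomingArrows : Prop := ∀ s, ∃ t x, A.next t x = s

/-- The directed paths of length `n` in the automaton with the trivial state removed. Such a path
is given by its first state and the word of length `n` that is read along it. -/
def nontrivialPaths (n : ℕ) : Set (S × List.Vector X n) :=
  {p | ∀ u : List X, u <+: p.2.toList → ¬ A.IsTrivial (A.run p.1 u)}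

/-- Bounded automata: the number of paths of length `n` avoiding the trivial state is bounded
independently of `n` (used for finite invertible automata only). -/
def IsBounded : Prop := ∃ C : ℕ, ∀ n : ℕ, (A.nontrivialPaths n).ncard ≤ C

/-- A state `s` is finitary if for some `n` all restrictions `s|_v`, `|v| = n`, are trivial. -/
def IsFinitary (s : S) : Prop := ∃ n : ℕ, ∀ v : List X, v.length = n → A.IsTrivial (A.run s v)

/-- A state `s` is circuit if `s|_v = s` for some nonempty word `v`. -/
def IsCircuit (s : S) : Prop := ∃ v : List X, v ≠ [] ∧ A.run s v = s

/-- The automaton is in basic form: `s|_x` is trivial for every finitary state `s` and every letter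
`x`; every circuit state `s` has a loop `s|_x = s`, all other `s|_y` being finitary; and every
`s|_x` is finitary or circuit. -/
def IsBasic : Prop :=
  (∀ s, A.IsFinitary s → ∀ x, A.IsTrivial (A.next s x)) ∧
  (∀ s, A.IsCircuit s → ∃ x, A.next s x = s ∧ ∀ y, y ≠ x → A.IsFinitary (A.next s y)) ∧
  (∀ s x, A.IsFinitary (A.next s x) ∨ A.IsCircuit (A.next s x))

/-- Passing to the power `X ^ m` of the alphabet: the same states, reading and writing blocks of
`m` letters. -/
def power (m : ℕ) : Transducer S (List.Vector X m) where
  next s v := A.run s v.toList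
  out s v := ⟨A.actWord s v.toList, by rw [A.length_actWord, v.toList_length]⟩

/-! ### Groups, Schreier graphs and tile graphs -/

/-- The automaton group: the group of transformations of the space of right-infinite sequences
generated by the transformations defined by the states. -/
def group : Subgroup (Equiv.Perm (ℕ → X)) :=
  Subgroup.closure {g | ∃ s, ∀ w, g w = A.act s w}

/-- The simplicial orbital Schreier graph of the sequence `w`. -/
def schreierGraph (w : ℕ → X) : SimpleGraph (MulAction.orbit A.group w) :=
  SimpleGraph.fromRel fun v u => ∃ s, A.act s v.1 = u.1

/-- The graph on all right-infinite sequences, in which `v` and `u` are joined by an edge if some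
state `s` maps `v` to `u` and has a trivial restriction at some finite beginning of `v`. Its edges
do not leave the orbits of the group. -/
def tileEdges : SimpleGraph (ℕ → X) :=
  SimpleGraph.fromRel fun v u => ∃ s, A.act s v = u ∧ ∃ n, A.IsTrivial (A.stateAt s v n)

/-- The orbital tile graph of `w`: the connected component of `w` in the graph above. -/
def tileGraph (w : ℕ → X) : SimpleGraph (A.tileEdges.connectedComponentMk w) :=
  (A.tileEdges.connectedComponentMk w).toSimpleGraph

/-- The finite tile graph on the words of length `n`. -/
def finiteTileGraph (n : ℕ) : SimpleGraph (List.Vector X n) :=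
  SimpleGraph.fromRel fun v u =>
    ∃ s, A.actWord s v.toList = u.toList ∧ A.IsTrivial (A.run s v.toList)

/-! ### Types of states and the two kinds of automata -/

/-- The orbit of the letter `z` under the permutation of a finite alphabet induced by `s`. -/
def letterOrbit (s : S) (z : X) : Set X := {z' | ∃ k : ℕ, (A.out s)^[k] z = z'}

/-- Type I: a loop at `s` labeled `x|y`, all other arrows from `s` go to the trivial state. -/
def IsTypeI (x y : X) (s : S) : Prop :=
  A.out s x = y ∧ A.next s x = s ∧ ∀ z, z ≠ x → A.IsTrivial (A.next s z)

/-- Type II with respect to `x`: a nontrivial state with a loop labeled `x|x`, all other arrows go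
to the trivial state. (Type II′ is the same with the letter `y` in place of `x`.) -/
def IsTypeII (x : X) (s : S) : Prop :=
  ¬ A.IsTrivial s ∧ A.out s x = x ∧ A.next s x = s ∧ ∀ z, z ≠ x → A.IsTrivial (A.next s z)

/-- Type III′: a nontrivial state, all arrows from which go to the trivial state. -/
def IsTypeIII' (s : S) : Prop :=
  ¬ A.IsTrivial s ∧ ∀ z, A.IsTrivial (A.next s z)

/-- Type III: a loop labeled `x|x`, an arrow labeled `y|y` to a state of type III′, and all other
arrows go to the trivial state. -/
def IsTypeIII (x y : X) (s : S) : Prop :=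
  A.out s x = x ∧ A.next s x = s ∧ A.out s y = y ∧ A.IsTypeIII' (A.next s y) ∧
    ∀ z, z ≠ x → z ≠ y → A.IsTrivial (A.next s z)

/-- The automaton consists of the adding machine, its inverse and the trivial state, where the
adding machine is a state of type I (for two different letters) acting transitively on letters. -/
def IsAddingMachine : Prop :=
  ∃ (x y : X) (a b : S), x ≠ y ∧ A.IsTypeI x y a ∧ (∀ z, A.letterOrbit a z = Set.univ) ∧
    A.AreInverse a b ∧ ∀ s, s = a ∨ s = b ∨ A.IsTrivial s

/-- For the family of states `T` and the enumeration `e 0, e 1, …, e n` of the alphabet: every pair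
`{e i, e (i + 1)}` with `i` satisfying `p` is an orbit on letters of some state in `T`, and every
nontrivial orbit on letters of a state in `T` is one of these pairs. -/
def OrbitsArePairs {n : ℕ} (e : Fin (n + 1) ≃ X) (p : ℕ → Prop) (T : S → Prop) : Prop :=
  (∀ i : Fin n, p i → ∃ s, T s ∧ A.letterOrbit s (e i.castSucc) = {e i.castSucc, e i.succ}) ∧
  (∀ s, T s → ∀ z, A.out s z ≠ z →
    ∃ i : Fin n, p i ∧ A.letterOrbit s z = {e i.castSucc, e i.succ})

/-- The automaton with states of types II and II′ for the enumeration `x = e 0, …, e n = y`. The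
letter `e i` is the `(i+1)`-st one, so odd `i` gives the pairs `{x₂ⱼ, x₂ⱼ₊₁}` and even `i` gives the
pairs `{x₂ⱼ₋₁, x₂ⱼ}`. -/
def IsPairedII {n : ℕ} (e : Fin (n + 1) ≃ X) : Prop :=
  Odd (n + 1) ∧
  (∀ s, A.IsTrivial s ∨ A.IsTypeII (e 0) s ∨ A.IsTypeII (e (Fin.last n)) s) ∧
  A.OrbitsArePairs e (fun i => Odd i) (A.IsTypeII (e 0)) ∧
  A.OrbitsArePairs e (fun i => Even i) (A.IsTypeII (e (Fin.last n)))

/-- The automaton with states of types II, III and III′ for the enumeration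
`x = e 0, …, e n = y`. -/
def IsPairedIII {n : ℕ} (e : Fin (n + 1) ≃ X) : Prop :=
  Even (n + 1) ∧
  (∀ s, A.IsTrivial s ∨ A.IsTypeII (e 0) s ∨ A.IsTypeIII (e 0) (e (Fin.last n)) s ∨
    A.IsTypeIII' s) ∧
  A.OrbitsArePairs e (fun i => Odd i)
    (fun s => A.IsTypeII (e 0) s ∨ A.IsTypeIII (e 0) (e (Fin.last n)) s) ∧
  A.OrbitsArePairs e (fun i => Even i) A.IsTypeIII'

end Transducer

/-- The uniform Bernoulli measure on right-infinite sequences over a finite alphabet. -/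
noncomputable def bernoulliMeasure (X : Type*) [Fintype X] [Nonempty X] [MeasurableSpace X] :
    Measure (ℕ → X) :=
  Measure.infinitePi fun _ : ℕ => (PMF.uniformOfFintype X).toMeasure

/-- The periodic right-infinite sequence `v v v …` for a word `v` of positive length `m`. -/
def periodicSeq {X : Type*} {m : ℕ} (hm : 0 < m) (v : List.Vector X m) : ℕ → X :=
  fun n => v.get ⟨n % m, Nat.mod_lt n hm⟩

/-! The hard direction turns a statement about almost every sequence into one about finite graphs.
Call a word noncritical if all states restrict to the identity along it. Suppose that deleting a
noncritical word `u` does not disconnect its tile graph. Then every `w` that contains `u` infinitely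
often has a Schreier graph with at most one end (`IsTame.equivalent_of_frequent`): the finite set of
sequences agreeing with `w` from an occurrence of `u` on can be left only towards sequences with
another word in place of `u` and the same tail after it, and these are joined to each other outside
that set. Such `w` do not form a null set. So if almost all Schreier graphs have two ends, every
noncritical word cuts its tile graph.

Now let `v` be a non-cut vertex of level `n` and `u` a noncritical word. The tile graph of level `n
+ |u|` is made of copies `X^n q` of level `n`. The noncritical word `vu` must cut, although the copy
`X^n u` stays connected without it; hence some copy is attached to `X^n u` through `vu` only. Moving
along a spanning tree of level `|u|` towards `u`, one finds such a copy whose index is a tree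
neighbour of `u`, and different `v` need different neighbours. So the tree degree of `u` bounds the
number of non-cut vertices of level `n`. A tree has average degree below 2, and in basic form the
number of critical words of a given positive length is bounded; hence there are at most two non-cut
vertices (`ncard_isNonCut_le_two`), and the tile graphs are paths
(`Connected.degrees_of_ncard_isNonCut_le_two`).

In such a path an edge between two copies starts at an end of the previous path. Applied to a state
with a loop at `a`, this shows that words like `a^n` or `a^n z` are ends, and each level has only
two of them. If some loop changes its letter, the automaton is an adding machine. If all loops fix
their letters, the edges of the first level split into two matchings, which must alternate along the
path; this gives the enumeration of the letters and its parity, with case (a) or (b) according to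
whether all restrictions off the loops are trivial (`TilesArePaths.classification`).

Conversely, in each case the edges between sequences are explicit: steps of the adding machine and
its inverse, or two partial matchings that miss only constant sequences. As orbits are infinite, no
degenerate coincidences occur, and counting neighbours shows that the graphs are lines or rays. The
exceptional orbits are countable, hence null; so are the orbits of the finitely many critical
sequences, outside of which tile graphs and Schreier graphs coincide. Passing to blocks of letters
does not change the Schreier graphs. -/

/-! ### Walks avoiding a set of vertices -/

namespace SimpleGraph

variable {V W : Type*}

/-- An edge of `G` whose ends lie outside `F`. -/
def AvoidStep (G : SimpleGraph V) (F : Set V) (a b : V) : Prop := G.Adj a b ∧ a ∉ F ∧ b ∉ F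

/-- The vertices `a` and `b` are joined by a path of `G` outside `F`. -/
def AvoidReach (G : SimpleGraph V) (F : Set V) : V → V → Prop :=
  Relation.ReflTransGen (G.AvoidStep F)

theorem AvoidReach.symm {G : SimpleGraph V} {F : Set V} {a b : V} (h : G.AvoidReach F a b) :
    G.AvoidReach F b a := by
  unfold AvoidReach at *
  induction h with
  | refl => exact .refl
  | tail _ h ih => exact .head ⟨h.1.symm, h.2.2, h.2.1⟩ ih

theorem AvoidReach.trans {G : SimpleGraph V} {F : Set V} {a b c : V} (h : G.AvoidReach F a b)
    (h' : G.AvoidReach F b c) : G.AvoidReach F a c := Relation.ReflTransGen.trans h h'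

theorem AvoidReach.refl {G : SimpleGraph V} {F : Set V} (a : V) : G.AvoidReach F a a :=
  Relation.ReflTransGen.refl

theorem AvoidReach.of_adj {G : SimpleGraph V} {F : Set V} {a b : V} (h : G.Adj a b) (ha : a ∉ F)
    (hb : b ∉ F) : G.AvoidReach F a b := Relation.ReflTransGen.single ⟨h, ha, hb⟩

theorem AvoidReach.mono {G H : SimpleGraph V} {F F' : Set V} (hGH : G ≤ H) (hF : F' ⊆ F) {a b : V}
    (h : G.AvoidReach F a b) : H.AvoidReach F' a b :=
  Relation.ReflTransGen.mono (fun _ _ h => ⟨hGH h.1, fun h' => h.2.1 (hF h'), fun h' =>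
    h.2.2 (hF h')⟩) _ _ h

theorem AvoidReach.map {G : SimpleGraph V} {H : SimpleGraph W} (f : V → W) {F : Set V} {F' : Set W}
    (hadj : ∀ a b, G.Adj a b → H.Adj (f a) (f b)) (hF : ∀ a, a ∉ F → f a ∉ F') {a b : V}
    (h : G.AvoidReach F a b) : H.AvoidReach F' (f a) (f b) :=
  Relation.ReflTransGen.lift f (fun _ _ h => ⟨hadj _ _ h.1, hF _ h.2.1, hF _ h.2.2⟩) _ _ h

theorem avoidReach_iff_reachable {G : SimpleGraph V} {F : Set V} {a b : V} (ha : a ∈ Fᶜ)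
    (hb : b ∈ Fᶜ) : G.AvoidReach F a b ↔ (G.induce Fᶜ).Reachable ⟨a, ha⟩ ⟨b, hb⟩ := by
  constructor
  · intro h
    unfold AvoidReach at h
    induction h with
    | refl => exact .refl _
    | tail _ h ih =>
      exact (ih h.2.1).trans (Adj.reachable (show (G.induce Fᶜ).Adj ⟨_, h.2.1⟩ ⟨_, hb⟩ from h.1))
  · intro h
    rw [reachable_iff_reflTransGen] at h
    exact Relation.ReflTransGen.lift (p := G.AvoidStep F) Subtype.val
      (fun x y h => ⟨h, x.2, y.2⟩) _ _ h

theorem Reachable.avoidReach_empty {G : SimpleGraph V} {a b : V} (h : G.Reachable a b) :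
    G.AvoidReach ∅ a b := by
  rw [reachable_iff_reflTransGen] at h
  exact Relation.ReflTransGen.mono (fun _ _ h => ⟨h, by simp, by simp⟩) _ _ h

/-- Removing the vertex `c` does not disconnect the graph. -/
def IsNonCut (G : SimpleGraph V) (c : V) : Prop := ∀ a b, a ≠ c → b ≠ c → G.AvoidReach {c} a b

end SimpleGraph

/-! ### Ends -/

namespace GraphRay

variable {V W : Type*} {G : SimpleGraph V} {H : SimpleGraph W}

/-- A ray eventually stays in one component of the complement of `F`, so a component visited
infinitely often is the one containing a tail. In this form equivalence can be checked with walks of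
the ambient graph. -/
theorem equivalent_iff (r r' : GraphRay G) : r.Equivalent r' ↔
    ∀ F : Finset V, ∃ N, ∀ n, N ≤ n → ∀ k, N ≤ k → G.AvoidReach F (r.toFun n) (r'.toFun k) := by
  constructor
  · intro h F
    obtain ⟨C, h1, h2⟩ := h F
    obtain ⟨D, N, hD⟩ := r.exists_tail F
    obtain ⟨D', N', hD'⟩ := r'.exists_tail F
    obtain rfl := r.visitsInfinitely_unique F h1 ((Set.Ici_infinite N).mono fun n hn => hD n hn)
    obtain rfl := r'.visitsInfinitely_unique F h2 ((Set.Ici_infinite N').mono fun n hn => hD' n hn)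
    refine ⟨max N N', fun n hn k hk => ?_⟩
    obtain ⟨h3, h4⟩ := hD n ((le_max_left _ _).trans hn)
    obtain ⟨h5, h6⟩ := hD' k ((le_max_right _ _).trans hk)
    rw [SimpleGraph.avoidReach_iff_reachable h3 h5]
    exact SimpleGraph.ConnectedComponent.exact (h4.trans h6.symm)
  · intro h F
    obtain ⟨D, N, hD⟩ := r.exists_tail F
    obtain ⟨D', N', hD'⟩ := r'.exists_tail F
    obtain ⟨M, hM⟩ := h F
    obtain ⟨h3, h4⟩ := hD (max N M) (le_max_left _ _)
    obtain ⟨h5, h6⟩ := hD' (max N' M) (le_max_left _ _)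
    have := hM (max N M) (le_max_right _ _) (max N' M) (le_max_right _ _)
    rw [SimpleGraph.avoidReach_iff_reachable h3 h5] at this
    have hDD : D = D' := by
      rw [← h4, ← h6]; exact SimpleGraph.ConnectedComponent.sound this
    subst hDD
    exact ⟨D, (Set.Ici_infinite N).mono fun n hn => hD n hn,
      (Set.Ici_infinite N').mono fun n hn => hD' n hn⟩

/-- The image of a ray under an isomorphism. -/
def map (φ : G ≃g H) (r : GraphRay G) : GraphRay H where
  toFun n := φ (r.toFun n)
  injective := φ.injective.comp r.injective
  adj n := φ.map_rel_iff.2 (r.adj n)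

theorem Equivalent.map (φ : G ≃g H) {r r' : GraphRay G} (h : r.Equivalent r') :
    (r.map φ).Equivalent (r'.map φ) := by
  rw [equivalent_iff] at *
  intro F
  obtain ⟨N, hN⟩ := h (F.map φ.symm.toEquiv.toEmbedding)
  refine ⟨N, fun n hn k hk => (hN n hn k hk).map φ (fun a b h => φ.map_rel_iff.2 h) ?_⟩
  intro a ha ha'
  apply ha
  simp only [Finset.coe_map, Set.mem_image, SetLike.mem_coe]
  exact ⟨φ a, by simpa using ha', by simp⟩

/-- An isomorphism of graphs induces a bijection between the rays. -/
def equivOfIso (φ : G ≃g H) : GraphRay G ≃ GraphRay H where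
  toFun := map φ
  invFun := map φ.symm
  left_inv r := by simp [map]
  right_inv r := by simp [map]

end GraphRay

theorem HasTwoEnds.of_iso {V W : Type*} {G : SimpleGraph V} {H : SimpleGraph W} (φ : G ≃g H)
    (h : HasTwoEnds G) : HasTwoEnds H := by
  unfold HasTwoEnds GraphEnd at *
  rw [← h]
  refine (Nat.card_congr (Quotient.congr (GraphRay.equivOfIso φ) fun r r' => ?_)).symm
  refine ⟨fun h => GraphRay.Equivalent.map φ h, fun h => ?_⟩
  have := GraphRay.Equivalent.map φ.symm h
  rw [show r = ((GraphRay.equivOfIso φ r).map φ.symm) from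
      ((GraphRay.equivOfIso φ).symm_apply_apply r).symm,
    show r' = ((GraphRay.equivOfIso φ r').map φ.symm) from
      ((GraphRay.equivOfIso φ).symm_apply_apply r').symm]
  exact this

theorem hasTwoEnds_congr {V W : Type*} {G : SimpleGraph V} {H : SimpleGraph W} (φ : G ≃g H) :
    HasTwoEnds G ↔ HasTwoEnds H := ⟨.of_iso φ, .of_iso φ.symm⟩

theorem HasTwoEnds.exists_not_equivalent {V : Type*} {G : SimpleGraph V} (h : HasTwoEnds G) :
    ∃ r r' : GraphRay G, ¬ r.Equivalent r' := by
  obtain ⟨x, y, hxy, -⟩ := Nat.card_eq_two_iff.1 h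
  induction x using Quotient.inductionOn with | _ r
  induction y using Quotient.inductionOn with | _ r'
  exact ⟨r, r', fun h => hxy (Quotient.sound h)⟩

theorem SimpleGraph.hasse_int_adj {a b : ℤ} :
    (SimpleGraph.hasse ℤ).Adj a b ↔ b = a + 1 ∨ b = a - 1 := by
  rw [SimpleGraph.hasse_adj, Order.covBy_iff_add_one_eq, Order.covBy_iff_add_one_eq]
  omega

theorem SimpleGraph.hasse_nat_adj {a b : ℕ} :
    (SimpleGraph.hasse ℕ).Adj a b ↔ b = a + 1 ∨ a = b + 1 := by
  rw [SimpleGraph.hasse_adj, Nat.covBy_iff_add_one_eq, Nat.covBy_iff_add_one_eq]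
  omega

theorem hasTwoEnds_hasse_int : HasTwoEnds (SimpleGraph.hasse ℤ) := by
  -- Injectivity forbids turning back, so a ray is monotone.
  have hr : ∀ r : GraphRay (SimpleGraph.hasse ℤ),
      (∀ n : ℕ, r.toFun n = r.toFun 0 + n) ∨ (∀ n : ℕ, r.toFun n = r.toFun 0 - n) := by
    intro r
    have hstep : ∀ n, r.toFun (n + 1) = r.toFun n + 1 ∨ r.toFun (n + 1) = r.toFun n - 1 :=
      fun n => SimpleGraph.hasse_int_adj.1 (r.adj n)
    have hne : ∀ n, r.toFun (n + 2) ≠ r.toFun n := fun n h => by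
      have := r.injective h; omega
    rcases hstep 0 with h0 | h0
    · left
      have : ∀ n, r.toFun (n + 1) = r.toFun n + 1 := by
        intro n
        induction n with
        | zero => exact h0
        | succ n ih => have := hstep (n + 1); have := hne n; grind
      intro n
      induction n with
      | zero => simp
      | succ n ih => rw [this, ih]; push_cast; ring
    · right
      have : ∀ n, r.toFun (n + 1) = r.toFun n - 1 := by
        intro n
        induction n with
        | zero => exact h0
        | succ n ih => have := hstep (n + 1); have := hne n; grind
      intro n
      induction n with
      | zero => simp
      | succ n ih => rw [this, ih]; push_cast; ring
  have key : ∀ (r r' : GraphRay (SimpleGraph.hasse ℤ)) (i j : ℕ),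
      (∀ n, r.toFun (n + i) = r'.toFun (n + j)) → r.Equivalent r' := by
    intro r r' i j h F
    obtain ⟨C, N, hC⟩ := r.exists_tail F
    refine ⟨C, (Set.Ici_infinite N).mono fun n hn => hC n hn,
      (Set.Ici_infinite (N + j)).mono fun n hn => ?_⟩
    have hn : N + j ≤ n := hn
    have h1 := hC (n - j + i) (by omega)
    have h2 : r.toFun (n - j + i) = r'.toFun n := by rw [h, Nat.sub_add_cancel (by omega)]
    rw [Set.mem_ofPred_eq]
    simp only [h2] at h1
    exact h1
  let rp : GraphRay (SimpleGraph.hasse ℤ) :=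
    ⟨fun n => n, fun a b h => by simpa using h, fun n => SimpleGraph.hasse_int_adj.2 (by simp)⟩
  let rm : GraphRay (SimpleGraph.hasse ℤ) :=
    ⟨fun n => -n, fun a b h => by simpa using h,
      fun n => SimpleGraph.hasse_int_adj.2 (by right; push_cast; ring)⟩
  refine Nat.card_eq_two_iff.2 ⟨Quotient.mk _ rp, Quotient.mk _ rm, fun h => ?_, ?_⟩
  · have h : rp.Equivalent rm := Quotient.exact h
    rw [GraphRay.equivalent_iff] at h
    obtain ⟨N, hN⟩ := h {0}
    have h1 := hN (N + 1) (by omega) (N + 1) (by omega)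
    have h2 : ∀ a b, (SimpleGraph.hasse ℤ).AvoidReach ({0} : Finset ℤ) a b → 0 < a → 0 < b := by
      intro a b h ha
      unfold SimpleGraph.AvoidReach at h
      induction h with
      | refl => exact ha
      | tail _ h ih =>
        have h3 := SimpleGraph.hasse_int_adj.1 h.1
        have h4 := h.2.2
        simp only [Finset.coe_singleton, Set.mem_singleton_iff] at h4
        omega
    have := h2 _ _ h1 (by simp only [rp]; omega)
    simp only [rm] at this
    omega
  · refine Set.eq_univ_of_forall fun x => ?_
    induction x using Quotient.inductionOn with | _ r
    change Quotient.mk _ r = Quotient.mk _ rp ∨ Quotient.mk _ r = Quotient.mk _ rm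
    rcases hr r with h | h
    · left
      refine Quotient.sound (key r rp (-(r.toFun 0)).toNat (r.toFun 0).toNat fun n => ?_)
      rw [h]
      simp only [rp]; push_cast; omega
    · right
      refine Quotient.sound (key r rm (r.toFun 0).toNat (-(r.toFun 0)).toNat fun n => ?_)
      rw [h]
      simp only [rm]; push_cast; omega

theorem IsLineGraph.hasTwoEnds {V : Type*} {G : SimpleGraph V} (h : IsLineGraph G) :
    HasTwoEnds G := by
  obtain ⟨φ⟩ := h
  exact .of_iso φ.symm hasTwoEnds_hasse_int

/-! ### Graphs whose vertices have at most two neighbours -/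

namespace SimpleGraph

variable {V : Type*} {G : SimpleGraph V}

theorem Reachable.closed {a b : V} (h : G.Reachable a b) {s : Set V}
    (hs : ∀ x ∈ s, ∀ y, G.Adj x y → y ∈ s) (ha : a ∈ s) : b ∈ s := by
  rw [reachable_iff_reflTransGen] at h
  induction h with
  | refl => exact ha
  | tail _ h ih => exact hs _ ih _ h

theorem dist_le_succ_of_adj {v a b : V} (hG : G.Connected) (h : G.Adj a b) :
    G.dist v b ≤ G.dist v a + 1 := by
  have := hG.dist_triangle (u := v) (v := a) (w := b)
  rwa [dist_eq_one_iff_adj.2 h] at this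

theorem exists_adj_dist {v b : V} {n : ℕ} (hG : G.Connected) (h : G.dist v b = n + 1) :
    ∃ a, G.Adj a b ∧ G.dist v a = n := by
  obtain ⟨p, hp⟩ := hG.exists_walk_length_eq_dist v b
  have hl : p.length = n + 1 := hp.trans h
  have hadj : G.Adj (p.getVert n) b := by
    have := p.adj_getVert_succ (i := n) (by omega)
    rwa [show p.getVert (n + 1) = b by rw [← hl, Walk.getVert_length]] at this
  refine ⟨_, hadj, ?_⟩
  have h1 : G.dist v (p.getVert n) ≤ n := by
    have := dist_le (p.take n)
    rw [Walk.take_length] at this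
    omega
  have := dist_le_succ_of_adj (v := v) hG hadj
  omega

/-- A connected graph in which one vertex has one neighbour and all others have two is a ray. -/
theorem isRayGraph_of_degrees (hG : G.Connected) (v₀ : V) (h₀ : ∃ u, ∀ z, G.Adj v₀ z ↔ z = u)
    (h : ∀ v, v ≠ v₀ → ∃ a b, a ≠ b ∧ ∀ z, G.Adj v z ↔ z = a ∨ z = b) : IsRayGraph G := by
  have h0 : ∀ v, G.dist v₀ v = 0 ↔ v = v₀ := fun v => by
    rw [(hG v₀ v).dist_eq_zero_iff, eq_comm]
  -- Every distance from `v₀` is attained exactly once: one neighbour of the vertex at distance `n +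
  -- 1` is the vertex at distance `n`, so its other neighbour is the only candidate for distance `n
  -- + 2`.
  have main : ∀ n, (∃ v, G.dist v₀ v = n) ∧ ∀ v w, G.dist v₀ v = n → G.dist v₀ w = n → v = w := by
    intro n
    induction n using Nat.strong_induction_on with
    | _ n ih =>
      match n with
      | 0 => exact ⟨⟨v₀, (h0 _).2 rfl⟩, fun v w hv hw => ((h0 v).1 hv).trans ((h0 w).1 hw).symm⟩
      | 1 =>
        obtain ⟨u, hu⟩ := h₀
        refine ⟨⟨u, dist_eq_one_iff_adj.2 ((hu u).2 rfl)⟩, fun v w hv hw => ?_⟩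
        rw [dist_eq_one_iff_adj, hu] at hv hw
        rw [hv, hw]
      | n + 2 =>
        obtain ⟨⟨p, hp⟩, hup⟩ := ih n (by omega)
        obtain ⟨⟨q, hq⟩, huq⟩ := ih (n + 1) (by omega)
        have hqv : q ≠ v₀ := fun h => by rw [(h0 q).2 h] at hq; omega
        have hpq : G.Adj q p := by
          obtain ⟨a, ha, ha'⟩ := exists_adj_dist hG hq
          rw [hup p a hp ha']; exact ha.symm
        obtain ⟨c, hcp, hc⟩ : ∃ c, c ≠ p ∧ ∀ z, G.Adj q z ↔ z = p ∨ z = c := by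
          obtain ⟨a, b, hab, h⟩ := h q hqv
          rcases (h p).1 hpq with rfl | rfl
          · exact ⟨b, hab.symm, h⟩
          · exact ⟨a, hab, fun z => (h z).trans or_comm⟩
        have hqc := (hc c).2 (.inr rfl)
        have h1 := dist_le_succ_of_adj (v := v₀) hG hqc
        have h2 := dist_le_succ_of_adj (v := v₀) hG hqc.symm
        refine ⟨⟨c, ?_⟩, fun v w hv hw => ?_⟩
        · rcases (by omega : G.dist v₀ c = n ∨ G.dist v₀ c = n + 1 ∨ G.dist v₀ c = n + 2) with
            h | h | h
          · exact absurd (hup _ _ h hp) hcp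
          · rw [huq c q h hq] at hqc; exact absurd hqc (G.loopless.irrefl _)
          · exact h
        · have key : ∀ v, G.dist v₀ v = n + 2 → v = c := by
            intro v hv
            obtain ⟨a, ha, ha'⟩ := exists_adj_dist hG hv
            rw [huq a q ha' hq, hc] at ha
            rcases ha with rfl | rfl
            · omega
            · rfl
          rw [key v hv, key w hw]
  have hbij : Function.Bijective (G.dist v₀) :=
    ⟨fun v w hvw => (main _).2 v w hvw rfl, fun n => (main n).1⟩
  refine ⟨⟨Equiv.ofBijective _ hbij, fun {a b} => ?_⟩⟩
  rw [hasse_nat_adj]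
  simp only [Equiv.ofBijective_apply]
  constructor
  · rintro (h | h)
    · obtain ⟨c, hc, hc'⟩ := exists_adj_dist hG h
      rwa [hbij.1 hc'] at hc
    · obtain ⟨c, hc, hc'⟩ := exists_adj_dist hG h
      rw [hbij.1 hc'] at hc; exact hc.symm
  · intro hab
    have h1 := dist_le_succ_of_adj (v := v₀) hG hab
    have h2 := dist_le_succ_of_adj (v := v₀) hG hab.symm
    have h3 : G.dist v₀ a ≠ G.dist v₀ b := fun h => hab.ne (hbij.1 h)
    omega

theorem finite_range_zpow_apply {α : Type*} (σ : Equiv.Perm α) {m : ℤ} (hm : 0 < m) {x : α}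
    (h : (σ ^ m) x = x) : (Set.range fun n : ℤ => (σ ^ n) x).Finite := by
  refine ((Set.finite_Ico 0 m).image fun n : ℤ => (σ ^ n) x).subset ?_
  rintro _ ⟨n, rfl⟩
  refine ⟨n % m, ⟨Int.emod_nonneg _ hm.ne', Int.emod_lt_of_pos _ hm⟩, ?_⟩
  conv_rhs => rw [← Int.emod_add_mul_ediv n m]
  change _ = (σ ^ (n % m + m * (n / m))) x
  rw [zpow_add, zpow_mul, Equiv.Perm.mul_apply, Equiv.Perm.zpow_apply_eq_self_of_apply_eq_self h]

/-- A connected infinite graph in which every vertex has two neighbours is a line. -/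
theorem isLineGraph_of_degrees [Infinite V] (hG : G.Connected)
    (h : ∀ v, ∃ a b, a ≠ b ∧ ∀ z, G.Adj v z ↔ z = a ∨ z = b) : IsLineGraph G := by
  classical
  have hother : ∀ v u, G.Adj v u → ∃ z, z ≠ u ∧ ∀ y, G.Adj v y ↔ y = u ∨ y = z := by
    intro v u hvu
    obtain ⟨a, b, hab, h⟩ := h v
    rcases (h u).1 hvu with rfl | rfl
    · exact ⟨b, hab.symm, h⟩
    · exact ⟨a, hab, fun z => (h z).trans or_comm⟩
  choose! o ho1 ho2 using hother
  have hoadj : ∀ v u, G.Adj v u → G.Adj v (o v u) := fun v u h => (ho2 v u h _).2 (.inr rfl)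
  have hoo : ∀ v u, G.Adj v u → o v (o v u) = u := by
    intro v u hvu
    rcases (ho2 v _ (hoadj v u hvu) u).1 hvu with h | h
    · exact absurd h.symm (ho1 v u hvu)
    · exact h.symm
  -- Moving a directed edge one step forward without backtracking is a permutation of the directed
  -- edges, so its integer powers give a bi-infinite walk through any edge.
  let D := {p : V × V // G.Adj p.1 p.2}
  let σ : Equiv.Perm D :=
    { toFun := fun p => ⟨(p.1.2, o p.1.2 p.1.1), hoadj _ _ p.2.symm⟩
      invFun := fun p => ⟨(o p.1.1 p.1.2, p.1.1), (hoadj _ _ p.2).symm⟩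
      left_inv := fun p => Subtype.ext (Prod.ext (hoo _ _ p.2.symm) rfl)
      right_inv := fun p => Subtype.ext (Prod.ext rfl (hoo _ _ p.2)) }
  obtain ⟨v₀⟩ := hG.nonempty
  obtain ⟨u₀, _, -, hu₀⟩ := h v₀
  have hu₀ := (hu₀ u₀).2 (.inl rfl)
  let d : ℤ → D := fun n => (σ ^ n) ⟨(v₀, u₀), hu₀⟩
  let f : ℤ → V := fun n => (d n).1.1
  have hd : ∀ n, d (n + 1) = σ (d n) := fun n => by
    simp only [d]; rw [add_comm, zpow_add, zpow_one]; rfl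
  have hd2 : ∀ n, (d n).1.2 = f (n + 1) := fun n => by simp only [f]; rw [hd]; rfl
  have hadj : ∀ n, G.Adj (f n) (f (n + 1)) := fun n => by rw [← hd2]; exact (d n).2
  have hnb : ∀ n y, G.Adj (f (n + 1)) y ↔ y = f n ∨ y = f (n + 2) := by
    intro n y
    have : f (n + 2) = o (f (n + 1)) (f n) := by
      rw [← hd2 n, show n + 2 = (n + 1) + 1 by ring, ← hd2, hd]; rfl
    rw [this]
    exact ho2 _ _ (hadj n).symm y
  have hne2 : ∀ n, f (n + 2) ≠ f n := by
    intro n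
    have : f (n + 2) = o (f (n + 1)) (f n) := by
      rw [← hd2 n, show n + 2 = (n + 1) + 1 by ring, ← hd2, hd]; rfl
    rw [this]
    exact ho1 _ _ (hadj n).symm
  have hsurj : Function.Surjective f := by
    intro v
    refine (hG (f 0) v).closed (s := Set.range f) ?_ ⟨0, rfl⟩
    rintro _ ⟨n, rfl⟩ y hy
    rw [show n = (n - 1) + 1 by ring, hnb] at hy
    rcases hy with rfl | rfl <;> exact ⟨_, rfl⟩
  -- If `f i = f (i + k)`, then `f (i + 1)` is one of the two neighbours of `f (i + k)` on the walk.
  -- The previous one gives a shorter gap; the next one repeats a directed edge, so the walk is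
  -- periodic and its range, which is all of `V`, is finite.
  have hgap : ∀ k : ℕ, 0 < k → ∀ i : ℤ, f i ≠ f (i + k) := by
    intro k
    induction k using Nat.strong_induction_on with
    | _ k ih =>
      intro hk i hi
      rcases k with _ | _ | _ | k
      · omega
      · exact (hadj i).ne (by simpa using hi)
      · exact hne2 i (by simpa using hi.symm)
      · replace hi : f i = f (i + (k + 3)) := by rw [hi]; congr 1
        have h1 : f (i + 1) = f (i + (k + 2) ) ∨ f (i + 1) = f (i + (k + 4)) := by
          have := hnb (i + (k + 2)) (f (i + 1))
          rw [show i + (k + 2 : ℤ) + 1 = i + (k + 3) by ring, ← hi,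
            show i + (k + 2 : ℤ) + 2 = i + (k + 4) by ring] at this
          exact this.1 (hadj i)
        rcases h1 with h1 | h1
        · refine ih (k + 1) (by omega) (by omega) (i + 1) (h1.trans ?_)
          congr 1; push_cast; ring
        · have h2 : d (i + (k + 3)) = d i := by
            refine Subtype.ext (Prod.ext ?_ ?_)
            · exact hi.symm
            · rw [hd2, hd2, h1]; congr 1; ring
          have h3 : (σ ^ ((k : ℤ) + 3)) (d i) = d i := by
            refine Eq.trans ?_ h2
            simp only [d]
            rw [← Equiv.Perm.mul_apply, ← zpow_add, add_comm]
          have hfin : (Set.range f).Finite := by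
            refine ((finite_range_zpow_apply σ (by omega) h3).image fun p => p.1.1).subset ?_
            rintro _ ⟨n, rfl⟩
            refine ⟨d n, ⟨n - i, ?_⟩, rfl⟩
            simp only [d]
            rw [← Equiv.Perm.mul_apply, ← zpow_add, sub_add_cancel]
          rw [hsurj.range_eq] at hfin
          exact Set.infinite_univ hfin
  have hinj : Function.Injective f := by
    intro i j hij
    rcases lt_trichotomy i j with hlt | rfl | hlt
    · exact absurd (hij.trans (by congr 1; omega)) (hgap (j - i).toNat (by omega) i)
    · rfl
    · exact absurd (hij.symm.trans (by congr 1; omega)) (hgap (i - j).toNat (by omega) j)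
  refine ⟨Iso.symm ⟨Equiv.ofBijective f ⟨hinj, hsurj⟩, fun {a b} => ?_⟩⟩
  rw [hasse_int_adj]
  change G.Adj (f a) (f b) ↔ _
  have := hnb (a - 1) (f b)
  rw [show a - 1 + 1 = a by ring, show a - 1 + 2 = a + 1 by ring] at this
  rw [this, hinj.eq_iff, hinj.eq_iff, or_comm]

/-- In a graph whose vertices have at most two neighbours, a path between two different vertices
with at most one neighbour contains all its neighbours. -/
theorem Walk.IsPath.adj_getVert_iff {x y : V} {p : G.Walk x y} (hp : p.IsPath) (hxy : x ≠ y)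
    (h2 : ∀ v a b c, G.Adj v a → G.Adj v b → G.Adj v c → a = b ∨ a = c ∨ b = c)
    (hx : ∀ a b, G.Adj x a → G.Adj x b → a = b) (hy : ∀ a b, G.Adj y a → G.Adj y b → a = b)
    {i : ℕ} (hi : i ≤ p.length) (z : V) :
    G.Adj (p.getVert i) z ↔
      (i < p.length ∧ z = p.getVert (i + 1)) ∨ (0 < i ∧ z = p.getVert (i - 1)) := by
  have hnext : i < p.length → G.Adj (p.getVert i) (p.getVert (i + 1)) := p.adj_getVert_succ
  have hprev : 0 < i → G.Adj (p.getVert i) (p.getVert (i - 1)) := fun h => by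
    have := p.adj_getVert_succ (i := i - 1) (by omega)
    rw [Nat.sub_add_cancel h] at this
    exact this.symm
  have hlen : 0 < p.length := by
    rcases Nat.eq_zero_or_pos p.length with h | h
    · exact absurd (Walk.eq_of_length_eq_zero h) hxy
    · exact h
  constructor
  · intro hz
    rcases Nat.eq_zero_or_pos i with rfl | h0
    · left
      have := hnext hlen
      rw [Walk.getVert_zero] at hz this
      exact ⟨hlen, hx _ _ hz this⟩
    rcases hi.eq_or_lt with rfl | hl
    · right
      have := hprev h0
      rw [Walk.getVert_length] at hz this
      exact ⟨h0, hy _ _ hz this⟩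
    have hne : p.getVert (i + 1) ≠ p.getVert (i - 1) := fun h => by
      have := hp.getVert_injOn (show i + 1 ≤ p.length by omega)
        (show i - 1 ≤ p.length by omega) h
      omega
    rcases h2 _ _ _ _ hz (hnext hl) (hprev h0) with h | h | h
    · exact .inl ⟨hl, h⟩
    · exact .inr ⟨h0, h⟩
    · exact absurd h hne
  · rintro (⟨h, rfl⟩ | ⟨h, rfl⟩)
    · exact hnext h
    · exact hprev h

theorem Walk.IsPath.exists_getVert_eq {x y : V} {p : G.Walk x y} (hp : p.IsPath) (hxy : x ≠ y)
    (hG : G.Connected)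
    (h2 : ∀ v a b c, G.Adj v a → G.Adj v b → G.Adj v c → a = b ∨ a = c ∨ b = c)
    (hx : ∀ a b, G.Adj x a → G.Adj x b → a = b) (hy : ∀ a b, G.Adj y a → G.Adj y b → a = b)
    (v : V) : ∃ i ≤ p.length, p.getVert i = v := by
  refine (hG x v).closed (s := {v | ∃ i ≤ p.length, p.getVert i = v}) ?_ ⟨0, by simp, by simp⟩
  rintro _ ⟨i, hi, rfl⟩ z hz
  rcases (hp.adj_getVert_iff hxy h2 hx hy hi z).1 hz with ⟨h, rfl⟩ | ⟨h, rfl⟩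
  · exact ⟨i + 1, h, rfl⟩
  · exact ⟨i - 1, by omega, rfl⟩

/-- A connected graph with at most two neighbours at every vertex and two vertices with at most
one neighbour is finite. -/
theorem finite_of_two_ends (hG : G.Connected) {x y : V} (hxy : x ≠ y)
    (h2 : ∀ v a b c, G.Adj v a → G.Adj v b → G.Adj v c → a = b ∨ a = c ∨ b = c)
    (hx : ∀ a b, G.Adj x a → G.Adj x b → a = b) (hy : ∀ a b, G.Adj y a → G.Adj y b → a = b) :
    Finite V := by
  classical
  obtain ⟨p, hp⟩ := (hG x y).exists_isPath
  refine Finite.of_surjective (fun i : Fin (p.length + 1) => p.getVert i) fun v => ?_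
  obtain ⟨i, hi, rfl⟩ := hp.exists_getVert_eq hxy hG h2 hx hy v
  exact ⟨⟨i, by omega⟩, rfl⟩

/-- A connected graph with at most two neighbours at every vertex and two vertices with at most
one neighbour is a finite path. -/
theorem exists_path_enumeration (hG : G.Connected) {x y : V} (hxy : x ≠ y)
    (h2 : ∀ v a b c, G.Adj v a → G.Adj v b → G.Adj v c → a = b ∨ a = c ∨ b = c)
    (hx : ∀ a b, G.Adj x a → G.Adj x b → a = b) (hy : ∀ a b, G.Adj y a → G.Adj y b → a = b) :
    ∃ (n : ℕ) (e : Fin (n + 1) ≃ V), e 0 = x ∧ e (Fin.last n) = y ∧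
      ∀ i j, G.Adj (e i) (e j) ↔ (j : ℕ) = i + 1 ∨ (i : ℕ) = j + 1 := by
  classical
  obtain ⟨p, hp⟩ := (hG x y).exists_isPath
  have hinj : Function.Injective (fun i : Fin (p.length + 1) => p.getVert i) := fun i j hij =>
    Fin.ext (hp.getVert_injOn (show (i : ℕ) ≤ p.length by omega)
      (show (j : ℕ) ≤ p.length by omega) hij)
  have hbij : Function.Bijective (fun i : Fin (p.length + 1) => p.getVert i) := by
    refine ⟨hinj, fun v => ?_⟩
    obtain ⟨i, hi, rfl⟩ := hp.exists_getVert_eq hxy hG h2 hx hy v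
    exact ⟨⟨i, by omega⟩, rfl⟩
  refine ⟨p.length, Equiv.ofBijective _ hbij, by simp, by simp, fun i j => ?_⟩
  simp only [Equiv.ofBijective_apply]
  rw [hp.adj_getVert_iff hxy h2 hx hy (by omega)]
  have hval : ∀ k : ℕ, k ≤ p.length → (p.getVert j = p.getVert k ↔ (j : ℕ) = k) := fun k hk =>
    ⟨fun h => hp.getVert_injOn (show (j : ℕ) ≤ p.length by omega) (show k ≤ p.length from hk) h,
      fun h => by rw [h]⟩
  constructor
  · rintro (⟨h, h'⟩ | ⟨h, h'⟩)
    · exact .inl ((hval _ h).1 h')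
    · have := (hval _ (by omega)).1 h'; omega
  · rintro (h | h)
    · exact .inl ⟨by omega, by rw [h]⟩
    · exact .inr ⟨by omega, by rw [h]; simp⟩

end SimpleGraph

/-! ### Finite graphs with at most two non-cut vertices. -/

namespace SimpleGraph

variable {V : Type*} {G : SimpleGraph V}

theorem Connected.isNonCut_of_degree_eq_one [Fintype V] (hG : G.Connected) {v : V}
    [Fintype (G.neighborSet v)] (hv : G.degree v = 1) : G.IsNonCut v := by
  intro a b ha hb
  rw [avoidReach_iff_reachable (F := {v}) (by simpa using ha) (by simpa using hb)]
  exact (hG.induce_compl_singleton_of_degree_eq_one hv) _ _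

theorem Walk.avoidReach_of_notMem_support {a b : V} (p : G.Walk a b) {F : Set V}
    (h : ∀ v ∈ p.support, v ∉ F) : G.AvoidReach F a b := by
  induction p with
  | nil => exact .refl _
  | cons hadj p ih =>
    refine (AvoidReach.of_adj hadj (h _ (by simp)) (h _ (by simp))).trans (ih fun v hv => ?_)
    exact h v (by simp [hv])

/-- A finite connected graph with at most two vertices whose removal does not disconnect it:
every vertex has at most two neighbours, and exactly two vertices have at most one neighbour. -/
theorem Connected.degrees_of_ncard_isNonCut_le_two [Finite V] [Nontrivial V] (hG : G.Connected)
    (hcard : {c | G.IsNonCut c}.ncard ≤ 2) :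
    (∀ v a b c, G.Adj v a → G.Adj v b → G.Adj v c → a = b ∨ a = c ∨ b = c) ∧
    ∃ p q, p ≠ q ∧ ∀ v, (∀ a b, G.Adj v a → G.Adj v b → a = b) ↔ v = p ∨ v = q := by
  classical
  have := Fintype.ofFinite V
  -- The leaves of a spanning tree are non-cut vertices of `G`, so there are at most two. The degree
  -- sum `2|V| - 2` then forces exactly two leaves and degree 2 elsewhere, and the non-cut vertices
  -- of `G` are precisely these leaves.
  obtain ⟨T, hTG, hT⟩ := hG.exists_isTree_le
  let L : Finset V := {v | T.degree v = 1}
  have hLnon : ∀ v ∈ L, G.IsNonCut v := fun v hv a b ha hb =>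
    (hT.connected.isNonCut_of_degree_eq_one (Finset.mem_filter.1 hv).2 a b ha hb).mono hTG
      subset_rfl
  have hfin : {c | G.IsNonCut c}.Finite := Set.toFinite _
  have hsub : (L : Set V) ⊆ {c | G.IsNonCut c} := fun v hv => hLnon v hv
  have hL2 : L.card ≤ 2 := by
    rw [← Set.ncard_coe_finset]
    exact (Set.ncard_le_ncard hsub hfin).trans hcard
  have hsum : ∑ v, T.degree v = 2 * Fintype.card V - 2 := by
    rw [sum_degrees_eq_twice_card_edges]
    have := hT.card_edgeFinset
    omega
  have hV : 2 ≤ Fintype.card V := Fintype.one_lt_card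
  have hpos : ∀ v, 1 ≤ T.degree v := fun v => hT.connected.preconnected.degree_pos_of_nontrivial v
  have hle : ∀ v ∈ Finset.univ, 2 ≤ T.degree v + if v ∈ L then 1 else 0 := by
    intro v _
    have := hpos v
    split_ifs with h
    · omega
    · have : T.degree v ≠ 1 := fun h' => h (by simp [L, h'])
      omega
  have hsum2 : ∑ v, (T.degree v + if v ∈ L then 1 else 0) = 2 * Fintype.card V - 2 + L.card := by
    rw [Finset.sum_add_distrib, hsum]; simp
  have hge := Finset.sum_le_sum hle
  rw [hsum2, Finset.sum_const, Finset.card_univ, smul_eq_mul] at hge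
  have hLc : L.card = 2 := by omega
  have heq : ∀ v, 2 = T.degree v + if v ∈ L then 1 else 0 := by
    have := (Finset.sum_eq_sum_iff_of_le hle).1 (by
      rw [hsum2, Finset.sum_const, Finset.card_univ, smul_eq_mul]; omega)
    exact fun v => this v (Finset.mem_univ v)
  have hset : {c | G.IsNonCut c} = L := by
    symm
    refine Set.eq_of_subset_of_ncard_le hsub ?_ hfin
    rwa [Set.ncard_coe_finset, hLc]
  have hT2 : ∀ v a b c, T.Adj v a → T.Adj v b → T.Adj v c → a = b ∨ a = c ∨ b = c := by
    intro v a b c ha hb hc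
    by_contra hne
    push Not at hne
    have h3 : ({a, b, c} : Finset V) ⊆ T.neighborFinset v := by
      intro z hz
      simp only [Finset.mem_insert, Finset.mem_singleton] at hz
      rw [mem_neighborFinset]
      rcases hz with rfl | rfl | rfl <;> assumption
    have := Finset.card_le_card h3
    rw [Finset.card_eq_three.2 ⟨a, b, c, hne.1, hne.2.1, hne.2.2, rfl⟩,
      card_neighborFinset_eq_degree] at this
    have := heq v
    omega
  -- An additional edge `u v` closes the tree path `u, c, w, …, v` to a cycle. Then `c` does not cut
  -- `G`, hence is a leaf, although it has the two tree neighbours `u` and `w`.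
  have hGT : G = T := by
    refine le_antisymm ?_ hTG
    intro u v huv
    by_contra hnot
    obtain ⟨p, hp⟩ := (hT.connected u v).exists_isPath
    cases p with
    | nil => exact huv.ne rfl
    | cons h1 q =>
      rename_i c
      cases q with
      | nil => exact hnot h1
      | cons h2 r =>
        rename_i w
        rw [Walk.cons_isPath_iff, Walk.cons_isPath_iff] at hp
        obtain ⟨⟨-, hcr⟩, hu⟩ := hp
        have huw : u ≠ w := fun h => hu (by simp [h])
        have huc : u ≠ c := h1.ne
        have hwc : w ≠ c := h2.ne'
        -- In `T` the vertex `c` has no neighbours besides `u` and `w`, so a walk to `c` comes in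
        -- through one of them.
        have hstep : ∀ z (s : T.Walk z c), z ≠ c →
            T.AvoidReach {c} z u ∨ T.AvoidReach {c} z w := by
          intro z s
          induction s with
          | nil => exact fun h => absurd rfl h
          | cons h s ih =>
            rename_i z z' c
            intro hz
            by_cases hz' : z' = c
            · subst hz'
              rcases hT2 _ _ _ _ h.symm h1.symm h2 with h' | h' | h'
              · exact .inl (h' ▸ .refl _)
              · exact .inr (h' ▸ .refl _)
              · exact absurd h' huw
            · have := AvoidReach.of_adj (F := {c}) h (by simpa using hz) (by simpa using hz')
              rcases ih h1 h2 hu hcr huc hwc hz' with h | h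
              · exact .inl (this.trans h)
              · exact .inr (this.trans h)
        have hwv : G.AvoidReach {c} w u :=
          ((r.avoidReach_of_notMem_support (F := {c}) (fun z hz hzc => by
            rw [Set.mem_singleton_iff] at hzc; exact hcr (hzc ▸ hz))).mono hTG subset_rfl).trans
            (AvoidReach.of_adj huv.symm (fun h => by
              rw [Set.mem_singleton_iff] at h; exact hcr (h ▸ r.end_mem_support)) (by simpa using huc))
        have hall : ∀ z, z ≠ c → G.AvoidReach {c} z u := by
          intro z hz
          rcases hstep z (hT.connected z c).some hz with h | h
          · exact h.mono hTG subset_rfl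
          · exact (h.mono hTG subset_rfl).trans hwv
        have hc : c ∈ L := by
          have : c ∈ {c | G.IsNonCut c} := fun a b ha hb => (hall a ha).trans (hall b hb).symm
          rwa [hset] at this
        have hdeg : T.degree c = 1 := (Finset.mem_filter.1 hc).2
        rw [degree_eq_one_iff_existsUnique_adj] at hdeg
        exact huw (hdeg.unique h1.symm h2)
  subst hGT
  refine ⟨hT2, ?_⟩
  obtain ⟨p, q, hpq, hLpq⟩ := Finset.card_eq_two.1 hLc
  refine ⟨p, q, hpq, fun v => ?_⟩
  have h1 : v = p ∨ v = q ↔ v ∈ L := by rw [hLpq]; simp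
  have h2 : v ∈ L ↔ G.degree v = 1 := by simp [L]
  rw [h1, h2, degree_eq_one_iff_existsUnique_adj]
  constructor
  · intro h
    obtain ⟨a, ha⟩ := hG.preconnected.exists_adj_of_nontrivial v
    exact ⟨a, ha, fun b hb => h b a hb ha⟩
  · intro h a b ha hb
    exact h.unique ha hb

end SimpleGraph

/-! ### Words and sequences -/

/-- The sequence `v w` for a finite word `v` and a right-infinite sequence `w`. -/
def prepend {X : Type*} : List X → (ℕ → X) → ℕ → X
  | [], w => w
  | x :: v, w => fun n => Nat.casesOn n x (prepend v w)

/-- The prefix of length `n`. -/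
def seqPrefix {X : Type*} (w : ℕ → X) (n : ℕ) : List X := (List.range n).map w

/-- The sequence without its first `n` letters. -/
def seqShift {X : Type*} (w : ℕ → X) (n : ℕ) : ℕ → X := fun i => w (n + i)

section Words

variable {X : Type*}

@[simp] theorem prepend_nil (w : ℕ → X) : prepend [] w = w := rfl

@[simp] theorem prepend_cons_zero (x : X) (v : List X) (w : ℕ → X) : prepend (x :: v) w 0 = x := rfl

@[simp] theorem prepend_cons_succ (x : X) (v : List X) (w : ℕ → X) (n : ℕ) :
    prepend (x :: v) w (n + 1) = prepend v w n := rfl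

theorem prepend_append (u v : List X) (w : ℕ → X) :
    prepend (u ++ v) w = prepend u (prepend v w) := by
  induction u with
  | nil => rfl
  | cons x u ih =>
    funext n
    cases n with
    | zero => rfl
    | succ n => simp [ih]

theorem prepend_length_add (v : List X) (w : ℕ → X) (n : ℕ) : prepend v w (v.length + n) = w n := by
  induction v with
  | nil => simp
  | cons x v ih => rw [List.length_cons, Nat.add_right_comm, prepend_cons_succ, ih]

theorem prepend_apply_lt (v : List X) (w : ℕ → X) (n : ℕ) (hn : n < v.length) :
    prepend v w n = v[n] := by
  induction v generalizing n with
  | nil => simp at hn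
  | cons x v ih =>
    cases n with
    | zero => rfl
    | succ n => simp only [prepend_cons_succ, List.getElem_cons_succ]; exact ih n _

@[simp] theorem length_seqPrefix (w : ℕ → X) (n : ℕ) : (seqPrefix w n).length = n := by
  simp [seqPrefix]

theorem seqPrefix_succ (w : ℕ → X) (n : ℕ) : seqPrefix w (n + 1) = seqPrefix w n ++ [w n] := by
  simp [seqPrefix, List.range_succ]

theorem seqPrefix_add (w : ℕ → X) (n k : ℕ) :
    seqPrefix w (n + k) = seqPrefix w n ++ seqPrefix (seqShift w n) k := by
  induction k with
  | zero => simp [seqPrefix]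
  | succ k ih => rw [← add_assoc, seqPrefix_succ, ih, seqPrefix_succ, List.append_assoc]; rfl

@[simp] theorem prepend_seqPrefix (w : ℕ → X) (n : ℕ) :
    prepend (seqPrefix w n) (seqShift w n) = w := by
  funext i
  rcases lt_or_ge i n with h | h
  · rw [prepend_apply_lt _ _ _ (by simpa using h)]; simp [seqPrefix]
  · obtain ⟨j, rfl⟩ := Nat.exists_eq_add_of_le h
    have := prepend_length_add (seqPrefix w n) (seqShift w n) j
    rw [length_seqPrefix] at this
    rw [this]; rfl

theorem prepend_injective_right (v : List X) : Function.Injective (prepend v) := by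
  intro w w' h
  funext n
  rw [← prepend_length_add v w n, h, prepend_length_add]

theorem prepend_inj_of_length_eq {v v' : List X} {w w' : ℕ → X} (hl : v.length = v'.length)
    (h : prepend v w = prepend v' w') : v = v' ∧ w = w' := by
  have hv : v = v' := by
    refine List.ext_getElem hl fun n h1 h2 => ?_
    rw [← prepend_apply_lt v w n h1, h, prepend_apply_lt]
  subst hv
  exact ⟨rfl, prepend_injective_right _ h⟩

@[simp] theorem seqPrefix_prepend (v : List X) (w : ℕ → X) :
    seqPrefix (prepend v w) v.length = v ∧ seqShift (prepend v w) v.length = w :=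
  prepend_inj_of_length_eq (by simp) (by simp)

end Words

/-! ### The action of states on prefixes and tails. -/

namespace Transducer

variable {S X : Type*} {A : Transducer S X}

@[simp] theorem run_nil (s : S) : A.run s [] = s := rfl
@[simp] theorem run_cons (s : S) (x : X) (v : List X) : A.run s (x :: v) = A.run (A.next s x) v :=
  rfl
theorem run_append (s : S) (u v : List X) : A.run s (u ++ v) = A.run (A.run s u) v := by
  simp [run]
@[simp] theorem actWord_nil (s : S) : A.actWord s [] = [] := rfl
@[simp] theorem actWord_cons (s : S) (x : X) (v : List X) :
    A.actWord s (x :: v) = A.out s x :: A.actWord (A.next s x) v := rfl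
theorem actWord_append (s : S) (u v : List X) :
    A.actWord s (u ++ v) = A.actWord s u ++ A.actWord (A.run s u) v := by
  induction u generalizing s with
  | nil => rfl
  | cons x u ih => simp [ih]

theorem stateAt_eq_run (s : S) (w : ℕ → X) (n : ℕ) : A.stateAt s w n = A.run s (seqPrefix w n) := by
  induction n with
  | zero => rfl
  | succ n ih => rw [seqPrefix_succ, run_append, ← ih]; rfl

theorem stateAt_add (s : S) (w : ℕ → X) (n k : ℕ) :
    A.stateAt s w (n + k) = A.stateAt (A.stateAt s w n) (seqShift w n) k := by
  rw [stateAt_eq_run, seqPrefix_add, run_append, stateAt_eq_run, stateAt_eq_run]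

theorem act_prepend (s : S) (v : List X) (w : ℕ → X) :
    A.act s (prepend v w) = prepend (A.actWord s v) (A.act (A.run s v) w) := by
  induction v generalizing s with
  | nil => rfl
  | cons x v ih =>
    funext n
    cases n with
    | zero => rfl
    | succ n =>
      rw [actWord_cons, prepend_cons_succ, run_cons, ← ih]
      simp only [act, prepend_cons_succ]
      congr 1
      have h : seqShift (prepend (x :: v) w) 1 = prepend v w := by
        funext i; simp only [seqShift]; rw [add_comm, prepend_cons_succ]
      rw [add_comm, stateAt_add, h]
      rfl

theorem act_eq_prepend (s : S) (w : ℕ → X) (n : ℕ) :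
    A.act s w = prepend (A.actWord s (seqPrefix w n)) (A.act (A.stateAt s w n) (seqShift w n)) := by
  conv_lhs => rw [← prepend_seqPrefix w n]
  rw [act_prepend, stateAt_eq_run]

/-! ### Trivial states -/

theorem IsTrivial.out {s : S} [Nonempty X] (h : A.IsTrivial s) (x : X) : A.out s x = x :=
  congrFun (h fun _ => x) 0

theorem IsTrivial.run {s : S} (h : A.IsTrivial s) (v : List X) : A.IsTrivial (A.run s v) := by
  intro w
  have := h (prepend v w)
  rw [act_prepend] at this
  exact (prepend_inj_of_length_eq (A.length_actWord s v) this).2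

theorem IsTrivial.next {s : S} (h : A.IsTrivial s) (x : X) : A.IsTrivial (A.next s x) := h.run [x]

theorem IsTrivial.actWord {s : S} [Nonempty X] (h : A.IsTrivial s) (v : List X) :
    A.actWord s v = v := by
  have := h (prepend v fun _ => Classical.arbitrary X)
  rw [act_prepend] at this
  exact (prepend_inj_of_length_eq (A.length_actWord s v) this).1

theorem isTrivial_of_next {s : S} (h : ∀ x, A.out s x = x ∧ A.IsTrivial (A.next s x)) :
    A.IsTrivial s := by
  intro w
  rw [← prepend_seqPrefix w 1, act_prepend]
  have : seqPrefix w 1 = [w 0] := rfl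
  rw [this, actWord_cons, actWord_nil, (h _).1, run_cons, run_nil, (h _).2]

/-- A state with a trivial-looking loop: it fixes all letters, and its sections are trivial or
the state itself. -/
theorem isTrivial_of_loop {s : S}
    (h : ∀ x, A.out s x = x ∧ (A.next s x = s ∨ A.IsTrivial (A.next s x))) : A.IsTrivial s := by
  intro w
  have hst : ∀ n, A.stateAt s w n = s ∨ A.IsTrivial (A.stateAt s w n) := by
    intro n
    induction n with
    | zero => exact .inl rfl
    | succ n ih =>
      rcases ih with ih | ih
      · rcases (h (w n)).2 with h' | h'
        · left; change A.next (A.stateAt s w n) (w n) = s; rw [ih, h']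
        · right; change A.IsTrivial (A.next (A.stateAt s w n) (w n)); rwa [ih]
      · exact .inr (ih.next _)
  funext n
  change A.out (A.stateAt s w n) (w n) = w n
  rcases hst n with ih | ih
  · rw [ih, (h _).1]
  · have : Nonempty X := ⟨w 0⟩
    exact ih.out _

/-! ### Inverse states -/

theorem AreInverse.symm {s t : S} (h : A.AreInverse s t) : A.AreInverse t s :=
  fun w => ⟨(h w).2, (h w).1⟩

/-- Comparing prefixes and tails in `t (s (v w)) = v w` shows that restrictions of inverse states,
taken along corresponding words, are again inverse. -/
theorem AreInverse.word {s t : S} [Nonempty X] (h : A.AreInverse s t) (v : List X) :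
    A.actWord t (A.actWord s v) = v ∧ A.AreInverse (A.run s v) (A.run t (A.actWord s v)) := by
  have h1 : ∀ (s t : S), A.AreInverse s t → ∀ v w, A.actWord t (A.actWord s v) = v ∧
      A.act (A.run t (A.actWord s v)) (A.act (A.run s v) w) = w := by
    intro s t h v w
    have := (h (prepend v w)).2
    rw [act_prepend, act_prepend] at this
    exact prepend_inj_of_length_eq (by simp [length_actWord]) this
  refine ⟨(h1 s t h v fun _ => Classical.arbitrary X).1, fun w => ⟨?_, (h1 s t h v w).2⟩⟩
  have h2 := h1 t s h.symm (A.actWord s v) w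
  rw [(h1 s t h v w).1] at h2
  exact h2.2

theorem AreInverse.out {s t : S} (h : A.AreInverse s t) (x : X) : A.out t (A.out s x) = x := by
  have : Nonempty X := ⟨x⟩
  simpa using (h.word [x]).1

theorem AreInverse.next {s t : S} (h : A.AreInverse s t) (x : X) :
    A.AreInverse (A.next s x) (A.next t (A.out s x)) := by
  have : Nonempty X := ⟨x⟩
  simpa using (h.word [x]).2

theorem AreInverse.isTrivial {s t : S} (h : A.AreInverse s t) (hs : A.IsTrivial s) :
    A.IsTrivial t := fun w => by
  have := (h w).2
  rwa [hs w] at this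

theorem AreInverse.eq (hA : A.IsMinimal) {s t t' : S} (h : A.AreInverse s t)
    (h' : A.AreInverse s t') : t = t' := by
  refine hA _ _ (funext fun w => ?_)
  rw [← (h' (A.act t w)).2, (h w).1]

/-! ### Standing assumptions -/

/-- An invertible minimal symmetric automaton with connected tile graphs and incoming arrows. -/
structure IsTame (A : Transducer S X) : Prop where
  invertible : A.IsInvertible
  minimal : A.IsMinimal
  connected : ∀ n, (A.finiteTileGraph n).Connected
  incoming : A.HasIncomingArrows
  symmetric : A.IsSymmetric

/-- Incoming arrows can be followed backwards any number of times. This is what allows an edge of a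
tile graph to be lifted to longer words by adding a prefix. -/
theorem exists_run_eq (h : A.HasIncomingArrows) (s : S) (n : ℕ) :
    ∃ t v, v.length = n ∧ A.run t v = s := by
  induction n generalizing s with
  | zero => exact ⟨s, [], rfl, rfl⟩
  | succ n ih =>
    obtain ⟨t, x, rfl⟩ := h s
    obtain ⟨t', v, hv, rfl⟩ := ih t
    exact ⟨t', v ++ [x], by simp [hv], by simp [run_append]⟩

/-! ### The tile graphs, on words -/

/-- The union of the finite tile graphs, as a graph on the set of all words. -/
def wordGraph (A : Transducer S X) : SimpleGraph (List X) :=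
  SimpleGraph.fromRel fun v u => ∃ s, A.actWord s v = u ∧ A.IsTrivial (A.run s v)

theorem exists_inverse_edge [Nonempty X] (hA : A.IsSymmetric) {v u : List X}
    (h : ∃ s, A.actWord s v = u ∧ A.IsTrivial (A.run s v)) :
    ∃ s, A.actWord s u = v ∧ A.IsTrivial (A.run s u) := by
  obtain ⟨s, rfl, hs⟩ := h
  obtain ⟨t, ht⟩ := hA s
  exact ⟨t, (ht.word v).1, (ht.word v).2.isTrivial hs⟩

theorem wordGraph_adj [Nonempty X] (hA : A.IsSymmetric) {v u : List X} :
    A.wordGraph.Adj v u ↔ v ≠ u ∧ ∃ s, A.actWord s v = u ∧ A.IsTrivial (A.run s v) := by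
  rw [wordGraph, SimpleGraph.fromRel_adj]
  refine and_congr_right fun _ => ⟨?_, .inl⟩
  rintro (h | h)
  · exact h
  · exact exists_inverse_edge hA h

theorem finiteTileGraph_adj {n : ℕ} {v u : List.Vector X n} :
    (A.finiteTileGraph n).Adj v u ↔ A.wordGraph.Adj v.toList u.toList := by
  rw [wordGraph, finiteTileGraph, SimpleGraph.fromRel_adj, SimpleGraph.fromRel_adj]
  refine and_congr (not_congr ⟨fun h => h ▸ rfl, fun h => Subtype.ext h⟩) Iff.rfl

theorem length_eq_of_wordGraph_adj {v u : List X} (h : A.wordGraph.Adj v u) :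
    v.length = u.length := by
  rw [wordGraph, SimpleGraph.fromRel_adj] at h
  rcases h.2 with ⟨s, rfl, -⟩ | ⟨s, rfl, -⟩ <;> simp [length_actWord]

theorem IsTame.wordGraph_reachable (hA : A.IsTame) {v u : List X} (h : v.length = u.length) :
    A.wordGraph.Reachable v u := by
  have := (hA.connected v.length).preconnected ⟨v, rfl⟩ ⟨u, h.symm⟩
  rw [SimpleGraph.reachable_iff_reflTransGen]
  exact Relation.ReflTransGen.lift (p := A.wordGraph.Adj) List.Vector.toList
    (fun a b h => finiteTileGraph_adj.1 h) _ _ ((SimpleGraph.reachable_iff_reflTransGen _ _).1 this)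

/-- Words of the same length are joined by a path in the copy of the tile graph with the
ending `u`. -/
theorem wordGraph_adj_append {v v' : List X} (u : List X) [Nonempty X]
    (h : A.wordGraph.Adj v v') : A.wordGraph.Adj (v ++ u) (v' ++ u) := by
  rw [wordGraph, SimpleGraph.fromRel_adj] at h ⊢
  refine ⟨fun h' => h.1 (List.append_cancel_right h'), ?_⟩
  have key : ∀ v v', (∃ s, A.actWord s v = v' ∧ A.IsTrivial (A.run s v)) →
      ∃ s, A.actWord s (v ++ u) = v' ++ u ∧ A.IsTrivial (A.run s (v ++ u)) := by
    rintro v _ ⟨s, rfl, hs⟩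
    exact ⟨s, by rw [actWord_append, hs.actWord], by rw [run_append]; exact hs.run u⟩
  exact h.2.imp (key _ _) (key _ _)

/-! ### The Schreier graphs, on all sequences -/

/-- The union of all Schreier graphs. -/
def seqGraph (A : Transducer S X) : SimpleGraph (ℕ → X) :=
  SimpleGraph.fromRel fun v u => ∃ s, A.act s v = u

theorem seqGraph_adj (hA : A.IsSymmetric) {v u : ℕ → X} :
    A.seqGraph.Adj v u ↔ v ≠ u ∧ ∃ s, A.act s v = u := by
  rw [seqGraph, SimpleGraph.fromRel_adj]
  refine and_congr_right fun _ => ⟨?_, .inl⟩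
  rintro (h | ⟨s, rfl⟩)
  · exact h
  · obtain ⟨t, ht⟩ := hA s
    exact ⟨t, (ht u).2⟩

theorem schreierGraph_adj {w : ℕ → X} {v u : MulAction.orbit A.group w} :
    (A.schreierGraph w).Adj v u ↔ A.seqGraph.Adj v.1 u.1 := by
  rw [schreierGraph, seqGraph, SimpleGraph.fromRel_adj, SimpleGraph.fromRel_adj]
  exact and_congr (not_congr Subtype.ext_iff) Iff.rfl

/-- The permutation of sequences defined by a state, as an element of the group. -/
theorem exists_group_eq_act (hA : A.IsSymmetric) (s : S) : ∃ g ∈ A.group, ∀ w, g w = A.act s w := by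
  obtain ⟨t, ht⟩ := hA s
  exact ⟨⟨A.act s, A.act t, fun w => (ht w).2, fun w => (ht w).1⟩,
    Subgroup.subset_closure ⟨s, fun w => rfl⟩, fun w => rfl⟩

/-- The states generate the group, so orbits are the components of the union of all Schreier graphs;
paths can replace group elements in all arguments. -/
theorem mem_orbit_iff (hA : A.IsSymmetric) {w u : ℕ → X} :
    u ∈ MulAction.orbit A.group w ↔ A.seqGraph.Reachable w u := by
  have hstep : ∀ (w : ℕ → X) s, A.seqGraph.Reachable w (A.act s w) := by
    intro w s
    by_cases h : w = A.act s w
    · rw [← h]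
    · exact SimpleGraph.Adj.reachable ((seqGraph_adj hA).2 ⟨h, s, rfl⟩)
  constructor
  · rintro ⟨⟨g, hg⟩, rfl⟩
    change A.seqGraph.Reachable w (g w)
    induction hg using Subgroup.closure_induction generalizing w with
    | mem g hg => obtain ⟨s, hs⟩ := hg; rw [hs]; exact hstep w s
    | one => exact .refl _
    | mul g h _ _ ihg ihh => exact ihh.trans ihg
    | inv g _ ih =>
      have := @ih (g⁻¹ w)
      rw [show g (g⁻¹ w) = w by simp] at this
      exact this.symm
  · intro h
    refine h.closed (s := MulAction.orbit A.group w) ?_ (MulAction.mem_orbit_self w)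
    intro v hv y hvy
    obtain ⟨-, s, rfl⟩ := (seqGraph_adj hA).1 hvy
    obtain ⟨g, hg, hgs⟩ := exists_group_eq_act hA s
    rw [← hgs v]
    exact (MulAction.mem_orbit_of_mem_orbit (M := A.group) ⟨g, hg⟩ hv)

theorem schreierGraph_connected (hA : A.IsSymmetric) (w : ℕ → X) :
    (A.schreierGraph w).Connected := by
  have key : ∀ u (hu : u ∈ MulAction.orbit A.group w),
      (A.schreierGraph w).Reachable ⟨w, MulAction.mem_orbit_self w⟩ ⟨u, hu⟩ := by
    intro u hu
    have h := (mem_orbit_iff hA).1 hu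
    rw [SimpleGraph.reachable_iff_reflTransGen] at h
    induction h with
    | refl => exact .refl _
    | @tail b c hb h ih =>
      have hb' : b ∈ MulAction.orbit A.group w := by
        rwa [mem_orbit_iff hA, SimpleGraph.reachable_iff_reflTransGen]
      exact (ih hb').trans (SimpleGraph.Adj.reachable (schreierGraph_adj.2 h))
  have : Nonempty (MulAction.orbit A.group w) := ⟨⟨w, MulAction.mem_orbit_self w⟩⟩
  exact ⟨fun u v => (key u.1 u.2).symm.trans (key v.1 v.2)⟩

/-- Each edge on a tile graph path from `v` to `v'` comes from a state with trivial restriction,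
which leaves the tail `w` unchanged. -/
theorem IsTame.prepend_mem_orbit [Nonempty X] (hA : A.IsTame) {v v' : List X}
    (h : v.length = v'.length) (w : ℕ → X) :
    prepend v' w ∈ MulAction.orbit A.group (prepend v w) := by
  rw [mem_orbit_iff hA.symmetric]
  have hr := hA.wordGraph_reachable h
  clear h
  rw [SimpleGraph.reachable_iff_reflTransGen] at hr
  induction hr with
  | refl => exact .refl _
  | @tail b c _ h ih =>
    refine ih.trans (SimpleGraph.Adj.reachable ?_)
    obtain ⟨hne, s, rfl, hs⟩ := (wordGraph_adj hA.symmetric).1 h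
    refine (seqGraph_adj hA.symmetric).2 ⟨fun h => hne ?_, s, by rw [act_prepend, hs]⟩
    exact (prepend_inj_of_length_eq (length_actWord _ _ _).symm h).1

/-- A prefix of length `N` can be replaced by any word of length `N`, so the orbit has at least `2 ^
N` points. This excludes fixed points and short cycles when neighbours are counted later. -/
theorem IsTame.infinite_orbit [Nontrivial X] (hA : A.IsTame) (w : ℕ → X) :
    (MulAction.orbit A.group w).Infinite := by
  intro hfin
  obtain ⟨x, y, hxy⟩ := exists_pair_ne X
  -- the words `x … x y` and the tail of `w` give infinitely many points
  have hmem : ∀ u : List X, prepend u (seqShift w u.length) ∈ MulAction.orbit A.group w := by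
    intro u
    have := hA.prepend_mem_orbit (v := seqPrefix w u.length) (v' := u) (by simp)
      (seqShift w u.length)
    rwa [prepend_seqPrefix] at this
  have hN : ∀ N : ℕ, 2 ^ N ≤ (MulAction.orbit A.group w).ncard := by
    intro N
    have h1 : Function.Injective fun f : Fin N → Bool =>
        (prepend (List.ofFn fun i => if f i then x else y) (seqShift w N)) := by
      intro f g hfg
      have := (prepend_inj_of_length_eq (by simp) hfg).1
      have := List.ofFn_injective this
      funext i
      have h2 := congrFun this i
      cases hf : f i <;> cases hg : g i <;> simp_all [hxy.symm]
    have h2 := Set.ncard_le_ncard (s := Set.range fun f : Fin N → Bool =>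
        (prepend (List.ofFn fun i => if f i then x else y) (seqShift w N))) (by
      rintro _ ⟨f, rfl⟩
      have := hmem (List.ofFn fun i => if f i then x else y)
      rwa [List.length_ofFn] at this) hfin
    rw [Set.ncard_range_of_injective h1] at h2
    simpa using h2
  have := hN (MulAction.orbit A.group w).ncard
  exact absurd this (not_le.2 Nat.lt_two_pow_self)

end Transducer

namespace Transducer

variable {S X : Type*} {A : Transducer S X}

/-! ### Powers of words -/

/-- The word `v v … v`. -/
def wordPow (v : List X) (i : ℕ) : List X := (List.replicate i v).flatten

theorem wordPow_succ (v : List X) (i : ℕ) : wordPow v (i + 1) = v ++ wordPow v i := by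
  simp [wordPow, List.replicate_succ]

theorem wordPow_add (v : List X) (i j : ℕ) : wordPow v (i + j) = wordPow v i ++ wordPow v j := by
  simp only [wordPow, List.replicate_add, List.flatten_append]

@[simp] theorem length_wordPow (v : List X) (i : ℕ) : (wordPow v i).length = i * v.length := by
  simp [wordPow]

theorem run_wordPow {s : S} {v : List X} (h : A.run s v = s) (i : ℕ) :
    A.run s (wordPow v i) = s := by
  induction i with
  | zero => rfl
  | succ i ih => rw [wordPow_succ, run_append, h, ih]

/-! ### Finitary and circuit states of bounded automata -/

theorem isTrivial_run_of_prefix {s : S} {u v : List X} (h : u <+: v)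
    (hu : A.IsTrivial (A.run s u)) :
    A.IsTrivial (A.run s v) := by
  obtain ⟨r, rfl⟩ := h
  rw [run_append]
  exact hu.run r

/-- Restrictions of a trivial state are trivial, so only the last state of the path has to be
tested. -/
theorem mem_nontrivialPaths {n : ℕ} {p : S × List.Vector X n} :
    p ∈ A.nontrivialPaths n ↔ ¬ A.IsTrivial (A.run p.1 p.2.toList) :=
  ⟨fun h => h _ (List.prefix_refl _), fun h _ hu hu' => h (isTrivial_run_of_prefix hu hu')⟩

/-- Otherwise the words `v^i u z`, turning once around the loop `i` times and then leaving it along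
`u` with a nontrivial continuation `z`, give `C + 1` different nontrivial paths of the same length.
-/
theorem IsBounded.finitary_of_loop [Finite X] [Finite S] (hA : A.IsBounded) {s : S}
    {u v : List X} (hv : A.run s v = s) (huv : u.length = v.length) (hne : u ≠ v) :
    A.IsFinitary (A.run s u) := by
  by_contra hfin
  unfold IsFinitary at hfin
  push Not at hfin
  choose z hz hznt using hfin
  obtain ⟨C, hC⟩ := hA
  have hlen : ∀ i : Fin (C + 1), (wordPow v i ++ (u ++ z ((C - i) * v.length))).length
      = (C + 1) * v.length := by
    intro i
    rw [List.length_append, List.length_append, length_wordPow, hz, huv]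
    obtain ⟨k, hk⟩ := Nat.exists_eq_add_of_le (Nat.le_of_lt_succ i.2)
    rw [show C - (i : ℕ) = k by omega]
    calc (i : ℕ) * v.length + (v.length + k * v.length) = (i + k + 1) * v.length := by ring
      _ = (C + 1) * v.length := by rw [← hk]
  let f : Fin (C + 1) → S × List.Vector X ((C + 1) * v.length) := fun i =>
    (s, ⟨_, hlen i⟩)
  have hlt : ∀ i j : Fin (C + 1), i < j → f i ≠ f j := by
    intro i j hij h
    have h1 : wordPow v i ++ (u ++ z ((C - i) * v.length)) =
        wordPow v j ++ (u ++ z ((C - j) * v.length)) :=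
      congrArg List.Vector.toList (Prod.ext_iff.1 h).2
    obtain ⟨k, hk⟩ := Nat.exists_eq_add_of_lt (show (i : ℕ) < j from hij)
    rw [hk, add_assoc, wordPow_add, List.append_assoc, List.append_cancel_left_eq, wordPow_succ,
      List.append_assoc] at h1
    exact hne (List.append_inj h1 huv).1
  have hinj : Function.Injective f := by
    intro i j hij
    rcases lt_trichotomy i j with h | h | h
    · exact absurd hij (hlt _ _ h)
    · exact h
    · exact absurd hij.symm (hlt _ _ h)
  have hsub : Set.range f ⊆ A.nontrivialPaths ((C + 1) * v.length) := by
    rintro _ ⟨i, rfl⟩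
    rw [mem_nontrivialPaths]
    change ¬ A.IsTrivial (A.run s (wordPow v i ++ (u ++ z _)))
    rw [run_append, run_append, run_wordPow hv]
    exact hznt _
  have : Finite (List.Vector X ((C + 1) * v.length)) := by
    have := Fintype.ofFinite X; infer_instance
  have h1 := Set.ncard_le_ncard hsub (Set.toFinite _)
  rw [Set.ncard_range_of_injective hinj, Nat.card_fin] at h1
  have := hC ((C + 1) * v.length)
  omega

theorem exists_finitary_bound [Finite S] (A : Transducer S X) :
    ∃ N, ∀ s, A.IsFinitary s → ∀ v : List X, N ≤ v.length → A.IsTrivial (A.run s v) := by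
  classical
  have := Fintype.ofFinite S
  have h : ∀ s, ∃ n, A.IsFinitary s → ∀ v : List X, v.length = n → A.IsTrivial (A.run s v) := by
    intro s
    by_cases hs : A.IsFinitary s
    · obtain ⟨n, hn⟩ := hs
      exact ⟨n, fun _ => hn⟩
    · exact ⟨0, fun h => absurd h hs⟩
  choose n hn using h
  refine ⟨Finset.univ.sup n, fun s hs v hv => ?_⟩
  have h1 : n s ≤ v.length := (Finset.le_sup (Finset.mem_univ s)).trans hv
  exact isTrivial_run_of_prefix (List.take_prefix (n s) v) (hn s hs _ (by simp [h1]))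

theorem isFinitary_of_run [Finite S] {s : S} (k : ℕ)
    (h : ∀ v : List X, v.length = k → A.IsFinitary (A.run s v)) : A.IsFinitary s := by
  obtain ⟨N, hN⟩ := exists_finitary_bound A
  refine ⟨k + N, fun v hv => ?_⟩
  rw [← List.take_append_drop k v, run_append]
  exact hN _ (h _ (by simp; omega)) _ (by simp; omega)

/-- After sufficiently many letters every state becomes finitary or circuit. -/
theorem IsBounded.finitary_or_circuit [Finite X] [Nonempty X] [Finite S] (hA : A.IsBounded) (s : S)
    (y : List X) (hy : Nat.card S ≤ y.length) :
    A.IsFinitary (A.run s y) ∨ A.IsCircuit (A.run s y) := by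
  classical
  have := Fintype.ofFinite S
  -- Pigeonhole: `y` has more prefixes than there are states, so some state `t` is repeated and
  -- carries a loop `v`.
  obtain ⟨i, j, hij, heq⟩ : ∃ i j : Fin (y.length + 1), i < j ∧
      A.run s (y.take i) = A.run s (y.take j) := by
    obtain ⟨i, j, hne, h⟩ := Fintype.exists_ne_map_eq_of_card_lt
      (fun i : Fin (y.length + 1) => A.run s (y.take i)) (by
        rw [Fintype.card_fin, ← Nat.card_eq_fintype_card]; omega)
    rcases lt_or_gt_of_ne hne with h' | h'
    · exact ⟨i, j, h', h⟩
    · exact ⟨j, i, h', h.symm⟩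
  have hij' : (i : ℕ) < j := hij
  set t := A.run s (y.take i) with ht
  obtain ⟨v, hv⟩ : y.take i <+: y.take j := List.take_prefix_take_left (by omega)
  have hvl : 0 < v.length := by
    have := congrArg List.length hv
    simp at this
    omega
  have hloop : A.run t v = t := by
    rw [ht, ← run_append, hv, ← heq]
  have hyd : A.run s y = A.run t (y.drop j) := by
    conv_lhs => rw [← List.take_append_drop j y, run_append]
    rw [← heq]
  rw [hyd]
  set z := y.drop j
  set L := z.length + 1 with hL
  have hzL : z.length ≤ L * v.length := by nlinarith
  -- Either the rest `z` of `y` follows the loop, and then the final state lies on a cycle; or it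
  -- leaves the loop, and then every extension of `z` to the length of `v^L` differs from `v^L`, so
  -- it leads to a finitary state. The exponent `L` makes `v^L` at least as long as `z`.
  by_cases hpre : z <+: wordPow v L
  · right
    obtain ⟨z', hz'⟩ := hpre
    refine ⟨z' ++ z, ?_, ?_⟩
    · intro h
      rw [List.append_eq_nil_iff] at h
      have := congrArg List.length hz'
      rw [h.1, h.2, length_wordPow, List.append_nil, List.length_nil] at this
      have := Nat.mul_pos (show 0 < L by omega) hvl
      omega
    · rw [run_append, ← run_append (u := z), hz', run_wordPow hloop]
  · left
    refine isFinitary_of_run (L * v.length - z.length) fun z₀ hz₀ => ?_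
    rw [← run_append]
    refine hA.finitary_of_loop (v := wordPow v L) (run_wordPow hloop L) ?_ ?_
    · simp [hz₀]; omega
    · intro h
      exact hpre ⟨z₀, h⟩

/-! ### Powers of the alphabet -/

/-- The word over `X` written in a word over `X ^ m`. -/
def flat {m : ℕ} (L : List (List.Vector X m)) : List X := (L.map List.Vector.toList).flatten

@[simp] theorem flat_nil {m : ℕ} : flat ([] : List (List.Vector X m)) = [] := rfl

@[simp] theorem flat_cons {m : ℕ} (v : List.Vector X m) (L : List (List.Vector X m)) :
    flat (v :: L) = v.toList ++ flat L := by simp [flat]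

@[simp] theorem length_flat {m : ℕ} (L : List (List.Vector X m)) :
    (flat L).length = L.length * m := by
  induction L with
  | nil => simp
  | cons v L ih => rw [flat_cons, List.length_append, ih, v.toList_length]; simp; ring

theorem flat_injective_of_length {m : ℕ} {L L' : List (List.Vector X m)}
    (hl : L.length = L'.length) (h : flat L = flat L') : L = L' := by
  induction L generalizing L' with
  | nil => exact (List.length_eq_zero_iff.1 hl.symm).symm
  | cons v L ih =>
    cases L' with
    | nil => simp at hl
    | cons v' L' =>
      rw [flat_cons, flat_cons] at h
      obtain ⟨h1, h2⟩ := List.append_inj h (by simp)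
      rw [Subtype.ext h1, ih (by simpa using hl) h2]

theorem run_power {m : ℕ} (s : S) (L : List (List.Vector X m)) :
    (A.power m).run s L = A.run s (flat L) := by
  induction L generalizing s with
  | nil => rfl
  | cons v L ih => rw [flat_cons, run_append, run_cons, ih]; rfl

theorem flat_actWord_power {m : ℕ} (s : S) (L : List (List.Vector X m)) :
    flat ((A.power m).actWord s L) = A.actWord s (flat L) := by
  induction L generalizing s with
  | nil => rfl
  | cons v L ih => rw [flat_cons, actWord_append, actWord_cons, flat_cons, ih]; rfl

/-- A list of length `m` as a vector. -/
def toVec {m : ℕ} (v : List X) (h : v.length = m) : List.Vector X m := ⟨v, h⟩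

@[simp] theorem toList_toVec {m : ℕ} (v : List X) (h : v.length = m) : (toVec v h).toList = v := rfl

theorem get_eq_toList_getElem {m : ℕ} (v : List.Vector X m) (i : Fin m) :
    v.get i = v.toList[(i : ℕ)]'(by simp) := rfl

/-- Cutting a sequence into blocks of length `m`. -/
def blocks {m : ℕ} (hm : 0 < m) : (ℕ → X) ≃ (ℕ → List.Vector X m) where
  toFun w n := toVec (seqPrefix (seqShift w (n * m)) m) (by simp)
  invFun u n := (u (n / m)).get ⟨n % m, Nat.mod_lt n hm⟩
  left_inv w := by
    funext n
    simp only [get_eq_toList_getElem, toList_toVec, seqPrefix, List.getElem_map,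
      List.getElem_range, seqShift]
    rw [Nat.div_add_mod']
  right_inv u := by
    funext n
    refine Subtype.ext (List.ext_getElem (by simp) fun i h1 h2 => ?_)
    have hi : i < m := by simpa using h2
    change (seqPrefix _ m)[i]'_ = (u n).toList[i]'_
    have e1 : (n * m + i) / m = n := by
      rw [mul_comm, Nat.mul_add_div hm, Nat.div_eq_of_lt hi, add_zero]
    have e2 : (n * m + i) % m = i := by
      rw [mul_comm, Nat.mul_add_mod, Nat.mod_eq_of_lt hi]
    simp only [seqPrefix, seqShift, List.getElem_map, List.getElem_range, get_eq_toList_getElem,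
      e1, e2]
    rfl

theorem blocks_apply {m : ℕ} (hm : 0 < m) (w : ℕ → X) (n : ℕ) :
    (blocks hm w n).toList = seqPrefix (seqShift w (n * m)) m := rfl

theorem flat_seqPrefix_blocks {m : ℕ} (hm : 0 < m) (w : ℕ → X) (n : ℕ) :
    flat (seqPrefix (blocks hm w) n) = seqPrefix w (n * m) := by
  induction n with
  | zero => simp [seqPrefix]
  | succ n ih =>
    rw [seqPrefix_succ, add_mul, one_mul, seqPrefix_add, ← ih]
    simp [flat, blocks_apply]

theorem stateAt_power {m : ℕ} (hm : 0 < m) (s : S) (w : ℕ → X) (n : ℕ) :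
    (A.power m).stateAt s (blocks hm w) n = A.stateAt s w (n * m) := by
  rw [stateAt_eq_run, run_power, flat_seqPrefix_blocks, stateAt_eq_run]

theorem seqPrefix_act (s : S) (w : ℕ → X) (n : ℕ) :
    seqPrefix (A.act s w) n = A.actWord s (seqPrefix w n) := by
  rw [act_eq_prepend s w n]
  have := (seqPrefix_prepend (A.actWord s (seqPrefix w n))
    (A.act (A.stateAt s w n) (seqShift w n))).1
  rwa [length_actWord, length_seqPrefix] at this

theorem seqShift_act (s : S) (w : ℕ → X) (n : ℕ) :
    seqShift (A.act s w) n = A.act (A.stateAt s w n) (seqShift w n) := by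
  rw [act_eq_prepend s w n]
  have := (seqPrefix_prepend (A.actWord s (seqPrefix w n))
    (A.act (A.stateAt s w n) (seqShift w n))).2
  rwa [length_actWord, length_seqPrefix] at this

theorem act_power {m : ℕ} (hm : 0 < m) (s : S) (w : ℕ → X) :
    (A.power m).act s (blocks hm w) = blocks hm (A.act s w) := by
  funext n
  refine Subtype.ext ?_
  change A.actWord ((A.power m).stateAt s (blocks hm w) n) (seqPrefix (seqShift w (n * m)) m) =
    seqPrefix (seqShift (A.act s w) (n * m)) m
  rw [stateAt_power, seqShift_act, seqPrefix_act]

theorem isTrivial_power {m : ℕ} (hm : 0 < m) {s : S} :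
    (A.power m).IsTrivial s ↔ A.IsTrivial s := by
  constructor
  · intro h w
    have := h (blocks hm w)
    rw [act_power] at this
    exact (blocks hm).injective this
  · intro h w
    obtain ⟨w, rfl⟩ := (blocks hm).surjective w
    rw [act_power, h w]

theorem isFinitary_power {m : ℕ} (hm : 0 < m) {s : S} (h : A.IsFinitary s) :
    (A.power m).IsFinitary s := by
  obtain ⟨n, hn⟩ := h
  refine ⟨n, fun L hL => ?_⟩
  rw [isTrivial_power hm, run_power]
  refine isTrivial_run_of_prefix (List.take_prefix n _) (hn _ ?_)
  rw [List.length_take, length_flat, hL]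
  exact min_eq_left (Nat.le_mul_of_pos_right _ hm)

theorem exists_flat_eq {m : ℕ} (n : ℕ) (v : List X) (hv : v.length = n * m) :
    ∃ L : List (List.Vector X m), L.length = n ∧ flat L = v := by
  induction n generalizing v with
  | zero => exact ⟨[], rfl, by simpa [eq_comm] using hv⟩
  | succ n ih =>
    rw [add_mul, one_mul] at hv
    obtain ⟨L, hL, hLv⟩ := ih (v.drop m) (by simp; omega)
    exact ⟨toVec (v.take m) (by simp; omega) :: L, by simp [hL], by
      rw [flat_cons, hLv, toList_toVec, List.take_append_drop]⟩

theorem isFinitary_of_power {m : ℕ} (hm : 0 < m) {s : S} (h : (A.power m).IsFinitary s) :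
    A.IsFinitary s := by
  obtain ⟨n, hn⟩ := h
  refine ⟨n * m, fun v hv => ?_⟩
  obtain ⟨L, hL, rfl⟩ := exists_flat_eq n v hv
  rw [← run_power, ← isTrivial_power hm]
  exact hn L hL

theorem isCircuit_of_power {m : ℕ} (hm : 0 < m) {s : S} (h : (A.power m).IsCircuit s) :
    A.IsCircuit s := by
  obtain ⟨L, hL, hs⟩ := h
  refine ⟨flat L, fun h => hL ?_, by rw [← run_power, hs]⟩
  have := length_flat L
  rw [h, List.length_nil] at this
  rcases Nat.mul_eq_zero.1 this.symm with h | h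
  · exact List.length_eq_zero_iff.1 h
  · omega

/-- A bounded automaton is brought to basic form by passing to a power of the alphabet. -/
theorem IsBounded.exists_isBasic_power [Finite X] [Nonempty X] [Finite S] (hA : A.IsBounded) :
    ∃ m, 0 < m ∧ (A.power m).IsBasic := by
  classical
  have := Fintype.ofFinite S
  obtain ⟨N, hN⟩ := exists_finitary_bound A
  have hc : ∀ s, ∃ v : List X, v ≠ [] ∧ (A.IsCircuit s → A.run s v = s) := by
    intro s
    by_cases hs : A.IsCircuit s
    · obtain ⟨v, hv, hv'⟩ := hs
      exact ⟨v, hv, fun _ => hv'⟩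
    · exact ⟨[Classical.arbitrary X], by simp, fun h => absurd h hs⟩
  choose c hc0 hc using hc
  have hcl : ∀ s, 0 < (c s).length := fun s => List.length_pos_iff.2 (hc0 s)
  let P := ∏ s, (c s).length
  have hP : 0 < P := Finset.prod_pos fun s _ => hcl s
  -- Divisibility by `P` turns every chosen cycle into a one-letter loop. As `m ≥ N`, finitary
  -- states become trivial after one block; as `m ≥ |S|`, every restriction to a block is finitary
  -- or circuit.
  let m := P * (N + Nat.card S + 1)
  have hm : N + Nat.card S + 1 ≤ m := Nat.le_mul_of_pos_left _ hP
  have hm0 : 0 < m := by omega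
  have hloop : ∀ s, A.IsCircuit s → ∃ x : List.Vector X m, A.run s x.toList = s := by
    intro s hs
    obtain ⟨q, hq⟩ : (c s).length ∣ m :=
      (Finset.dvd_prod_of_mem (fun s => (c s).length) (Finset.mem_univ s)).mul_right _
    exact ⟨toVec (wordPow (c s) q) (by rw [length_wordPow, hq, mul_comm]), run_wordPow (hc s hs) q⟩
  refine ⟨m, hm0, fun s hs x => ?_, fun s hs => ?_, fun s x => ?_⟩
  · rw [isTrivial_power hm0]
    exact hN s (isFinitary_of_power hm0 hs) _ (by rw [x.toList_length]; omega)
  · obtain ⟨x, hx⟩ := hloop s (isCircuit_of_power hm0 hs)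
    refine ⟨x, hx, fun y hy => isFinitary_power hm0 ?_⟩
    exact hA.finitary_of_loop hx (by simp) fun h => hy (Subtype.ext h)
  · rcases hA.finitary_or_circuit s x.toList (by rw [x.toList_length]; omega) with h | h
    · exact .inl (isFinitary_power hm0 h)
    · obtain ⟨y, hy⟩ := hloop _ h
      exact .inr ⟨[y], by simp, hy⟩

/-! ### Tameness of powers and the comparison of Schreier graphs -/

/-- A word of `n` blocks is a word of `n * m` letters with the same edges, so connectedness of the
tile graphs is inherited. -/
theorem IsTame.power [Nonempty X] (hA : A.IsTame) {m : ℕ} (hm : 0 < m) : (A.power m).IsTame := by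
  have hinv : (A.power m).IsSymmetric := by
    intro s
    obtain ⟨t, ht⟩ := hA.symmetric s
    refine ⟨t, fun w => ?_⟩
    obtain ⟨w, rfl⟩ := (blocks hm).surjective w
    rw [act_power, act_power, (ht w).1, act_power, act_power, (ht w).2]
    exact ⟨rfl, rfl⟩
  have : Nonempty (List.Vector X m) := ⟨List.Vector.replicate m (Classical.arbitrary X)⟩
  refine ⟨fun s => ?_, fun s t h => hA.minimal s t ?_, fun n => ?_, fun s => ?_, hinv⟩
  · obtain ⟨t, ht⟩ := hinv s
    exact Function.bijective_iff_has_inverse.2 ⟨(A.power m).out t, ht.out, ht.symm.out⟩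
  · funext w
    apply (blocks hm).injective
    rw [← act_power, ← act_power, h]
  · have key : ∀ L L' : List (List.Vector X m), L.length = L'.length →
        (A.power m).wordGraph.Reachable L L' := by
      intro L L' hLL'
      have h := hA.wordGraph_reachable (v := flat L) (u := flat L') (by simp [hLL'])
      rw [SimpleGraph.reachable_iff_reflTransGen] at h
      generalize hv : flat L = v at h
      induction h using Relation.ReflTransGen.head_induction_on generalizing L with
      | refl => rw [flat_injective_of_length hLL' hv]
      | head h1 _ ih =>
        subst hv
        obtain ⟨hne, s, rfl, hs⟩ := (wordGraph_adj hA.symmetric).1 h1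
        refine SimpleGraph.Reachable.trans (SimpleGraph.Adj.reachable ?_)
          (ih ((A.power m).actWord s L) (by rw [length_actWord, hLL']) (flat_actWord_power s L))
        refine (wordGraph_adj hinv).2 ⟨fun h => hne ?_, s, rfl, ?_⟩
        · rw [← flat_actWord_power, ← h]
        · rwa [isTrivial_power hm, run_power]
    have hne : Nonempty (List.Vector (List.Vector X m) n) :=
      ⟨List.Vector.replicate n (Classical.arbitrary _)⟩
    refine ⟨fun a b => ?_⟩
    have h := key a.toList b.toList (by simp)
    rw [SimpleGraph.reachable_iff_reflTransGen] at h
    generalize hv : a.toList = v at h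
    induction h using Relation.ReflTransGen.head_induction_on generalizing a with
    | refl => rw [Subtype.ext hv]
    | @head v v' h1 _ ih =>
      subst hv
      have hl : v'.length = n := by rw [← length_eq_of_wordGraph_adj h1, a.toList_length]
      exact (SimpleGraph.Adj.reachable (v := toVec v' hl)
        (finiteTileGraph_adj.2 h1)).trans (ih (toVec v' hl) rfl)
  · obtain ⟨t, v, hv, h⟩ := exists_run_eq hA.incoming s m
    exact ⟨t, toVec v hv, h⟩

theorem seqGraph_power_adj {m : ℕ} (hm : 0 < m) {v u : ℕ → X} :
    (A.power m).seqGraph.Adj (blocks hm v) (blocks hm u) ↔ A.seqGraph.Adj v u := by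
  rw [seqGraph, seqGraph, SimpleGraph.fromRel_adj, SimpleGraph.fromRel_adj]
  simp only [act_power, (blocks hm).injective.eq_iff, ne_eq]

theorem seqGraph_power_reachable {m : ℕ} (hm : 0 < m) {v u : ℕ → X} :
    (A.power m).seqGraph.Reachable (blocks hm v) (blocks hm u) ↔ A.seqGraph.Reachable v u :=
  SimpleGraph.Iso.reachable_iff
    (φ := (⟨blocks hm, seqGraph_power_adj hm⟩ : A.seqGraph ≃g (A.power m).seqGraph))

theorem IsTame.mem_orbit_power [Nonempty X] (hA : A.IsTame) {m : ℕ} (hm : 0 < m) {w u : ℕ → X} :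
    blocks hm u ∈ MulAction.orbit (A.power m).group (blocks hm w) ↔
      u ∈ MulAction.orbit A.group w := by
  rw [mem_orbit_iff (hA.power hm).symmetric, mem_orbit_iff hA.symmetric,
    seqGraph_power_reachable]

/-- The Schreier graphs of an automaton and of its power are isomorphic. -/
noncomputable def IsTame.schreierIso [Nonempty X] (hA : A.IsTame) {m : ℕ} (hm : 0 < m) (w : ℕ → X) :
    A.schreierGraph w ≃g (A.power m).schreierGraph (blocks hm w) where
  toEquiv := (blocks hm).subtypeEquiv fun _ => (hA.mem_orbit_power hm).symm
  map_rel_iff' := by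
    intro a b
    rw [schreierGraph_adj, schreierGraph_adj]
    exact seqGraph_power_adj hm

theorem blocks_periodicSeq {m : ℕ} (hm : 0 < m) (v : List.Vector X m) :
    blocks hm (periodicSeq hm v) = fun _ => v := by
  apply (blocks hm).symm.injective
  rw [Equiv.symm_apply_apply]
  rfl

end Transducer

/-! ### Pairs of consecutive letters -/

/-- The letters `z` and `z'` form a pair `{e i, e (i + 1)}` with `i` satisfying `p`. -/
def PairRel {X : Type*} {n : ℕ} (e : Fin (n + 1) ≃ X) (p : ℕ → Prop) (z z' : X) : Prop :=
  ∃ i : Fin n, p i ∧ (z = e i.castSucc ∧ z' = e i.succ ∨ z = e i.succ ∧ z' = e i.castSucc)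

namespace PairRel

variable {X : Type*} {n : ℕ} {e : Fin (n + 1) ≃ X} {p : ℕ → Prop} {z z' : X}

theorem symm (h : PairRel e p z z') : PairRel e p z' z := by
  obtain ⟨i, hi, h⟩ := h
  exact ⟨i, hi, h.symm.imp And.symm And.symm⟩

theorem iff_index (a b : Fin (n + 1)) : PairRel e p (e a) (e b) ↔
    (p a ∧ (b : ℕ) = a + 1) ∨ (p b ∧ (a : ℕ) = b + 1) := by
  simp only [PairRel, e.injective.eq_iff, Fin.ext_iff, Fin.val_castSucc, Fin.val_succ]
  constructor
  · rintro ⟨i, hi, h | h⟩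
    · exact .inl ⟨h.1 ▸ hi, by omega⟩
    · exact .inr ⟨h.2 ▸ hi, by omega⟩
  · rintro (⟨h, h'⟩ | ⟨h, h'⟩)
    · exact ⟨⟨a, by omega⟩, h, .inl ⟨rfl, h'⟩⟩
    · exact ⟨⟨b, by omega⟩, h, .inr ⟨h', rfl⟩⟩

theorem ne (h : PairRel e p z z') : z ≠ z' := by
  obtain ⟨a, rfl⟩ := e.surjective z
  obtain ⟨b, rfl⟩ := e.surjective z'
  rw [iff_index] at h
  rw [e.injective.ne_iff, Ne, Fin.ext_iff]
  omega

/-- When no two consecutive indices are admitted, the pairs are disjoint and form a partial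
matching. -/
theorem eq (hp : ∀ i, p i → ¬ p (i + 1)) {z₁ z₂ : X} (h₁ : PairRel e p z z₁)
    (h₂ : PairRel e p z z₂) : z₁ = z₂ := by
  obtain ⟨a, rfl⟩ := e.surjective z
  obtain ⟨b, rfl⟩ := e.surjective z₁
  obtain ⟨c, rfl⟩ := e.surjective z₂
  rw [iff_index] at h₁ h₂
  rw [e.injective.eq_iff, Fin.ext_iff]
  rcases h₁ with ⟨h1, h2⟩ | ⟨h1, h2⟩ <;> rcases h₂ with ⟨h3, h4⟩ | ⟨h3, h4⟩
  · omega
  · exact absurd (h4 ▸ h1) (hp _ h3)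
  · exact absurd (h2 ▸ h3) (hp _ h1)
  · omega

theorem exists_iff (a : Fin (n + 1)) : (∃ z', PairRel e p (e a) z') ↔
    (p a ∧ (a : ℕ) < n) ∨ (0 < (a : ℕ) ∧ p (a - 1)) := by
  constructor
  · rintro ⟨z', h⟩
    obtain ⟨b, rfl⟩ := e.surjective z'
    rw [iff_index] at h
    rcases h with ⟨h1, h2⟩ | ⟨h1, h2⟩
    · exact .inl ⟨h1, by omega⟩
    · exact .inr ⟨by omega, by rw [h2]; exact h1⟩
  · rintro (⟨h1, h2⟩ | ⟨h1, h2⟩)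
    · exact ⟨e ⟨a + 1, by omega⟩, (iff_index _ _).2 (.inl ⟨h1, rfl⟩)⟩
    · exact ⟨e ⟨a - 1, by omega⟩, (iff_index _ _).2 (.inr ⟨h2, by simp; omega⟩)⟩

theorem ne_of_forall_not {a : Fin (n + 1)}
    (ha : ¬ ((p a ∧ (a : ℕ) < n) ∨ (0 < (a : ℕ) ∧ p (a - 1)))) (h : PairRel e p z z') :
    z ≠ e a := by
  rintro rfl
  exact ha ((exists_iff a).1 ⟨_, h⟩)

end PairRel

/-! ### Orbits of states on letters. -/

namespace Transducer

variable {S X : Type*} {A : Transducer S X}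

theorem mem_letterOrbit_self (s : S) (z : X) : z ∈ A.letterOrbit s z := ⟨0, rfl⟩

theorem out_mem_letterOrbit {s : S} {z z' : X} (h : z' ∈ A.letterOrbit s z) :
    A.out s z' ∈ A.letterOrbit s z := by
  obtain ⟨k, rfl⟩ := h
  exact ⟨k + 1, by rw [Function.iterate_succ_apply']⟩

theorem letterOrbit_subset {s : S} {z : X} {P : Set X} (hz : z ∈ P)
    (h : ∀ y ∈ P, A.out s y ∈ P) : A.letterOrbit s z ⊆ P := by
  rintro _ ⟨k, rfl⟩
  induction k with
  | zero => exact hz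
  | succ k ih => rw [Function.iterate_succ_apply']; exact h _ ih

theorem letterOrbit_eq_pair_iff (hA : A.IsInvertible) {s : S} {z z' : X} (hne : z ≠ z') :
    A.letterOrbit s z = {z, z'} ↔ A.out s z = z' ∧ A.out s z' = z := by
  constructor
  · intro h
    have h1 : A.out s z = z' := by
      have h2 : A.out s z ∈ ({z, z'} : Set X) := h ▸ out_mem_letterOrbit (mem_letterOrbit_self s z)
      rcases h2 with h2 | h2
      · have h3 : A.letterOrbit s z ⊆ {z} := letterOrbit_subset rfl (by rintro _ rfl; exact h2)
        have h4 : z' ∈ A.letterOrbit s z := by rw [h]; simp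
        exact absurd (h3 h4).symm hne
      · exact h2
    refine ⟨h1, ?_⟩
    have h2 : A.out s z' ∈ ({z, z'} : Set X) := h ▸ out_mem_letterOrbit (by rw [h]; simp)
    rcases h2 with h2 | h2
    · exact h2
    · exact absurd ((hA s).1 (h1.trans (show z' = A.out s z' from h2.symm))) hne
  · rintro ⟨h1, h2⟩
    refine Set.Subset.antisymm (letterOrbit_subset (by simp) ?_) ?_
    · rintro y (rfl | rfl)
      · rw [h1]; simp
      · rw [h2]; simp
    · rintro y (rfl | rfl)
      · exact mem_letterOrbit_self _ _
      · rw [← h1]; exact out_mem_letterOrbit (mem_letterOrbit_self _ _)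

/-- Because the pairs are disjoint, a state that can move letters only within pairs has to swap the
two letters of each pair it touches. The condition on orbits thus reduces to a condition on single
moves of letters, the form used from here on. -/
theorem orbitsArePairs_iff (hA : A.IsInvertible) {n : ℕ} {e : Fin (n + 1) ≃ X} {p : ℕ → Prop}
    (hp : ∀ i, p i → ¬ p (i + 1)) {T : S → Prop} :
    A.OrbitsArePairs e p T ↔
      ∀ z z', PairRel e p z z' ↔ z ≠ z' ∧ ∃ s, T s ∧ A.out s z = z' := by
  have hne : ∀ i : Fin n, e i.castSucc ≠ e i.succ := fun i =>
    e.injective.ne (Fin.castSucc_lt_succ).ne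
  constructor
  · rintro ⟨h1, h2⟩ z z'
    constructor
    · intro h
      refine ⟨h.ne, ?_⟩
      obtain ⟨i, hi, h⟩ := h
      obtain ⟨s, hs, horb⟩ := h1 i hi
      rw [letterOrbit_eq_pair_iff hA (hne i)] at horb
      rcases h with ⟨rfl, rfl⟩ | ⟨rfl, rfl⟩
      · exact ⟨s, hs, horb.1⟩
      · exact ⟨s, hs, horb.2⟩
    · rintro ⟨hzz, s, hs, rfl⟩
      obtain ⟨i, hi, horb⟩ := h2 s hs z hzz.symm
      have h3 : z ∈ ({e i.castSucc, e i.succ} : Set X) := horb ▸ mem_letterOrbit_self s z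
      have h4 : A.out s z ∈ ({e i.castSucc, e i.succ} : Set X) :=
        horb ▸ out_mem_letterOrbit (mem_letterOrbit_self s z)
      refine ⟨i, hi, ?_⟩
      rcases h3 with h3 | h3 <;> rcases h4 with h4 | h4
      · exact absurd (h3.trans (Eq.symm h4)) hzz
      · exact .inl ⟨h3, h4⟩
      · exact .inr ⟨h3, h4⟩
      · exact absurd (h3.trans (Eq.symm h4)) hzz
  · intro h
    have hinv : ∀ s, T s → ∀ z, A.out s z ≠ z → A.out s (A.out s z) = z := by
      intro s hs z hz
      have h1 := (h z (A.out s z)).2 ⟨hz.symm, s, hs, rfl⟩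
      have h2 := (h (A.out s z) (A.out s (A.out s z))).2
        ⟨fun h' => hz ((hA s).1 h').symm, s, hs, rfl⟩
      exact (h1.symm.eq hp h2).symm
    refine ⟨fun i hi => ?_, fun s hs z hz => ?_⟩
    · obtain ⟨-, s, hs, h1⟩ := (h _ _).1 ⟨i, hi, .inl ⟨rfl, rfl⟩⟩
      refine ⟨s, hs, (letterOrbit_eq_pair_iff hA (hne i)).2 ⟨h1, ?_⟩⟩
      rw [← h1]
      exact hinv s hs _ (by rw [h1]; exact (hne i).symm)
    · obtain ⟨i, hi, h1⟩ := (h z (A.out s z)).2 ⟨hz.symm, s, hs, rfl⟩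
      refine ⟨i, hi, ?_⟩
      rw [(letterOrbit_eq_pair_iff hA hz.symm).2 ⟨rfl, hinv s hs z hz⟩]
      rcases h1 with ⟨h1, h2⟩ | ⟨h1, h2⟩
      · rw [h1, ← h1, h2]
      · rw [h2, h1, ← h1]; exact Set.pair_comm _ _

/-! ### Recognizing Schreier graphs by the number of neighbours -/

/-- The sequence `v` has exactly two neighbours in its Schreier graph. -/
def HasTwoNeighbors (A : Transducer S X) (v : ℕ → X) : Prop :=
  ∃ a b, a ≠ b ∧ ∀ z, A.seqGraph.Adj v z ↔ z = a ∨ z = b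

/-- The sequence `v` has exactly one neighbour in its Schreier graph. -/
def HasOneNeighbor (A : Transducer S X) (v : ℕ → X) : Prop :=
  ∃ a, ∀ z, A.seqGraph.Adj v z ↔ z = a

theorem mem_orbit_of_adj (hA : A.IsSymmetric) {w v u : ℕ → X}
    (hv : v ∈ MulAction.orbit A.group w) (h : A.seqGraph.Adj v u) :
    u ∈ MulAction.orbit A.group w := by
  rw [mem_orbit_iff hA] at hv ⊢
  exact hv.trans h.reachable

theorem HasTwoNeighbors.subtype (hA : A.IsSymmetric) {w : ℕ → X} (v : MulAction.orbit A.group w)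
    (h : A.HasTwoNeighbors v) :
    ∃ a b, a ≠ b ∧ ∀ z, (A.schreierGraph w).Adj v z ↔ z = a ∨ z = b := by
  obtain ⟨a, b, hab, h⟩ := h
  refine ⟨⟨a, mem_orbit_of_adj hA v.2 ((h a).2 (.inl rfl))⟩,
    ⟨b, mem_orbit_of_adj hA v.2 ((h b).2 (.inr rfl))⟩, fun h => hab (Subtype.ext_iff.1 h), ?_⟩
  intro z
  rw [schreierGraph_adj, h, Subtype.ext_iff, Subtype.ext_iff]

theorem HasOneNeighbor.subtype (hA : A.IsSymmetric) {w : ℕ → X} (v : MulAction.orbit A.group w)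
    (h : A.HasOneNeighbor v) : ∃ a, ∀ z, (A.schreierGraph w).Adj v z ↔ z = a := by
  obtain ⟨a, h⟩ := h
  refine ⟨⟨a, mem_orbit_of_adj hA v.2 ((h a).2 rfl)⟩, fun z => ?_⟩
  rw [schreierGraph_adj, h, Subtype.ext_iff]

theorem IsTame.isLineGraph [Nontrivial X] (hA : A.IsTame) {w : ℕ → X}
    (h : ∀ v ∈ MulAction.orbit A.group w, A.HasTwoNeighbors v) :
    IsLineGraph (A.schreierGraph w) := by
  have : Infinite (MulAction.orbit A.group w) := (hA.infinite_orbit w).to_subtype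
  exact SimpleGraph.isLineGraph_of_degrees (schreierGraph_connected hA.symmetric w)
    fun v => (h v v.2).subtype hA.symmetric

theorem IsTame.isRayGraph (hA : A.IsTame) {w : ℕ → X} (hw : A.HasOneNeighbor w)
    (h : ∀ v ∈ MulAction.orbit A.group w, v ≠ w → A.HasTwoNeighbors v) :
    IsRayGraph (A.schreierGraph w) :=
  SimpleGraph.isRayGraph_of_degrees (schreierGraph_connected hA.symmetric w)
    ⟨w, MulAction.mem_orbit_self w⟩ (HasOneNeighbor.subtype hA.symmetric _ hw)
    fun v hv => (h v v.2 fun h' => hv (Subtype.ext h')).subtype hA.symmetric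

/-- A connected graph with at most two neighbours everywhere and two vertices with one neighbour is
a finite path, while orbits are infinite. -/
theorem IsTame.notMem_orbit [Nontrivial X] (hA : A.IsTame) {p q : ℕ → X} (hpq : p ≠ q)
    (hp : A.HasOneNeighbor p) (hq : A.HasOneNeighbor q)
    (h : ∀ v, v ≠ p → v ≠ q → A.HasTwoNeighbors v) : q ∉ MulAction.orbit A.group p := by
  intro hmem
  have hinf : Infinite (MulAction.orbit A.group p) := (hA.infinite_orbit p).to_subtype
  refine hinf.not_finite (SimpleGraph.finite_of_two_ends (schreierGraph_connected hA.symmetric p)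
    (x := ⟨p, MulAction.mem_orbit_self p⟩) (y := ⟨q, hmem⟩)
    (fun h => hpq (Subtype.ext_iff.1 h)) ?_ ?_ ?_)
  · intro v a b c ha hb hc
    by_cases h1 : v.1 = p
    · obtain ⟨u, hu⟩ := HasOneNeighbor.subtype hA.symmetric v (by rwa [h1])
      rw [hu] at ha hb
      exact .inl (ha.trans hb.symm)
    by_cases h2 : v.1 = q
    · obtain ⟨u, hu⟩ := HasOneNeighbor.subtype hA.symmetric v (by rwa [h2])
      rw [hu] at ha hb
      exact .inl (ha.trans hb.symm)
    obtain ⟨x, y, -, hxy⟩ := HasTwoNeighbors.subtype hA.symmetric v (h _ h1 h2)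
    rw [hxy] at ha hb hc
    rcases ha with rfl | rfl <;> rcases hb with rfl | rfl <;> rcases hc with rfl | rfl <;> simp
  · intro a b ha hb
    obtain ⟨u, hu⟩ := HasOneNeighbor.subtype hA.symmetric ⟨p, MulAction.mem_orbit_self p⟩ hp
    rw [hu] at ha hb
    exact ha.trans hb.symm
  · intro a b ha hb
    obtain ⟨u, hu⟩ := HasOneNeighbor.subtype hA.symmetric ⟨q, hmem⟩ hq
    rw [hu] at ha hb
    exact ha.trans hb.symm

theorem IsTame.not_closed_of_finite [Nontrivial X] (hA : A.IsTame) {F : Set (ℕ → X)}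
    (hF : F.Finite) {v : ℕ → X} (hv : v ∈ F) (h : ∀ x ∈ F, ∀ y, A.seqGraph.Adj x y → y ∈ F) :
    False := by
  refine hA.infinite_orbit v (hF.subset fun u hu => ?_)
  exact ((mem_orbit_iff hA.symmetric).1 hu).closed h hv

/-- All Schreier graphs of the adding machine are lines. -/
theorem IsTame.isLineGraph_of_isAddingMachine [Nontrivial X] (hA : A.IsTame)
    (h : A.IsAddingMachine) (w : ℕ → X) : IsLineGraph (A.schreierGraph w) := by
  obtain ⟨-, -, a, b, -, -, -, hab, hall⟩ := h
  have hstep : ∀ v u, A.seqGraph.Adj v u → u = A.act a v ∨ u = A.act b v := by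
    intro v u h
    obtain ⟨hne, s, rfl⟩ := (seqGraph_adj hA.symmetric).1 h
    rcases hall s with rfl | rfl | hs
    · exact .inl rfl
    · exact .inr rfl
    · exact absurd (hs v).symm hne
  refine hA.isLineGraph fun v _ => ?_
  -- A fixed point of `a`, or a coincidence of the images of `v` under `a` and its inverse, would
  -- give a nonempty finite set closed under edges.
  have h1 : A.act a v ≠ v := by
    intro h1
    refine hA.not_closed_of_finite (Set.finite_singleton v) rfl ?_
    rintro _ rfl y hy
    rcases hstep _ _ hy with rfl | rfl
    · exact h1
    · change A.act b _ = _
      conv_lhs => rw [← h1]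
      exact (hab _).2
  have h2 : A.act b v ≠ v := by
    intro h2
    apply h1
    conv_lhs => rw [← h2]
    exact (hab _).1
  refine ⟨A.act a v, A.act b v, fun h => ?_, fun z => ⟨hstep v z, ?_⟩⟩
  · refine hA.not_closed_of_finite (F := {v, A.act a v}) (Set.toFinite _)
      (v := v) (by simp) ?_
    rintro x (rfl | rfl) y hy
    · rcases hstep _ _ hy with rfl | rfl <;> simp [h]
    · rcases hstep _ _ hy with rfl | rfl
      · left; rw [h]; exact (hab _).1
      · left; exact (hab _).2
  · rintro (rfl | rfl)
    · exact (seqGraph_adj hA.symmetric).2 ⟨h1.symm, a, rfl⟩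
    · exact (seqGraph_adj hA.symmetric).2 ⟨h2.symm, b, rfl⟩

/-! ### Schreier graphs whose edges are two partial matchings -/

section Matching

variable {R₀ R₁ : (ℕ → X) → (ℕ → X) → Prop}

/-- If both matchings joined `v` to the same point, then `v` and that point would form a finite
component. -/
theorem IsTame.hasTwoNeighbors_of_matching [Nontrivial X] (hA : A.IsTame)
    (hadj : ∀ v u, A.seqGraph.Adj v u ↔ R₀ v u ∨ R₁ v u)
    (hs₀ : ∀ v u, R₀ v u → R₀ u v) (hs₁ : ∀ v u, R₁ v u → R₁ u v)
    (hf₀ : ∀ v u u', R₀ v u → R₀ v u' → u = u') (hf₁ : ∀ v u u', R₁ v u → R₁ v u' → u = u')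
    {v a b : ℕ → X} (ha : R₀ v a) (hb : R₁ v b) : A.HasTwoNeighbors v := by
  refine ⟨a, b, ?_, fun z => ?_⟩
  · rintro rfl
    refine hA.not_closed_of_finite (F := {v, a}) (Set.toFinite _) (v := v) (by simp) ?_
    rintro x (rfl | rfl) y hy
    · rcases (hadj _ _).1 hy with h | h
      · right; exact hf₀ _ _ _ h ha
      · right; exact hf₁ _ _ _ h hb
    · rcases (hadj _ _).1 hy with h | h
      · left; exact hf₀ _ _ _ h (hs₀ _ _ ha)
      · left; exact hf₁ _ _ _ h (hs₁ _ _ hb)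
  · rw [hadj]
    constructor
    · rintro (h | h)
      · exact .inl (hf₀ _ _ _ h ha)
      · exact .inr (hf₁ _ _ _ h hb)
    · rintro (rfl | rfl)
      · exact .inl ha
      · exact .inr hb

theorem hasOneNeighbor_of_matching (hadj : ∀ v u, A.seqGraph.Adj v u ↔ R₀ v u ∨ R₁ v u)
    (hf₀ : ∀ v u u', R₀ v u → R₀ v u' → u = u') {v a : ℕ → X} (ha : R₀ v a)
    (hb : ∀ u, ¬ R₁ v u) : A.HasOneNeighbor v := by
  refine ⟨a, fun z => ?_⟩
  rw [hadj]
  constructor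
  · rintro (h | h)
    · exact hf₀ _ _ _ h ha
    · exact absurd h (hb z)
  · rintro rfl
    exact .inl ha

end Matching

/-- The relation between sequences that change one letter after a given prefix. -/
def PrefixRel (Q : List X → X → X → Prop) (v u : ℕ → X) : Prop :=
  ∃ p z z' t, Q p z z' ∧ v = prepend (p ++ [z]) t ∧ u = prepend (p ++ [z']) t

theorem PrefixRel.symm {Q : List X → X → X → Prop} (hQ : ∀ p z z', Q p z z' → Q p z' z)
    {v u : ℕ → X} (h : PrefixRel Q v u) : PrefixRel Q u v := by
  obtain ⟨p, z, z', t, h, rfl, rfl⟩ := h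
  exact ⟨p, z', z, t, hQ _ _ _ h, rfl, rfl⟩

/-- The hypothesis `hfree` is a prefix code condition: no admissible position lies beyond another
one in the same sequence. So `v` determines the position of the change, and `hfun` determines the
new letter. -/
theorem PrefixRel.eq {Q : List X → X → X → Prop}
    (hfun : ∀ p z z₁ z₂, Q p z z₁ → Q p z z₂ → z₁ = z₂)
    (hfree : ∀ p z z₁ r z₂ z₃, Q p z z₁ → ¬ Q (p ++ z :: r) z₂ z₃)
    {v u u' : ℕ → X} (h : PrefixRel Q v u) (h' : PrefixRel Q v u') : u = u' := by
  have key : ∀ (p p' : List X) (z z₁ z' z₁' : X) (t t' : ℕ → X), p.length < p'.length →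
      Q p z z₁ → Q p' z' z₁' → prepend (p ++ [z]) t ≠ prepend (p' ++ [z']) t' := by
    intro p p' z z₁ z' z₁' t t' hlt hq hq' heq
    have h1 : p' = (p'.take (p.length + 1)) ++ p'.drop (p.length + 1) :=
      (List.take_append_drop _ _).symm
    rw [h1, List.append_assoc, prepend_append (p'.take _)] at heq
    have h2 := (prepend_inj_of_length_eq (by simp; omega) heq).1
    rw [← h2] at h1
    rw [h1, List.append_assoc] at hq'
    exact hfree _ _ _ _ _ _ hq hq'
  obtain ⟨p, z, z₁, t, hq, rfl, rfl⟩ := h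
  obtain ⟨p', z', z₁', t', hq', heq, rfl⟩ := h'
  rcases lt_trichotomy p.length p'.length with hl | hl | hl
  · exact absurd heq (key _ _ _ _ _ _ _ _ hl hq hq')
  · obtain ⟨h1, rfl⟩ := prepend_inj_of_length_eq (by simp [hl]) heq
    obtain ⟨rfl, h2⟩ := List.append_inj h1 hl
    obtain rfl : z = z' := by simpa using h2
    rw [hfun _ _ _ _ hq hq']
  · exact absurd heq.symm (key _ _ _ _ _ _ _ _ hl hq' hq)

theorem exists_eq_prepend_replicate (x : X) {v : ℕ → X} (hv : v ≠ fun _ => x) :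
    ∃ k z t, z ≠ x ∧ v = prepend (List.replicate k x ++ [z]) t := by
  classical
  have hex : ∃ n, v n ≠ x := by
    by_contra h
    push Not at h
    exact hv (funext h)
  refine ⟨Nat.find hex, v (Nat.find hex), seqShift v (Nat.find hex + 1), Nat.find_spec hex, ?_⟩
  conv_lhs => rw [← prepend_seqPrefix v (Nat.find hex + 1), seqPrefix_succ]
  congr 2
  refine List.eq_replicate_iff.2 ⟨by simp, fun b hb => ?_⟩
  simp only [seqPrefix, List.mem_map, List.mem_range] at hb
  obtain ⟨i, hi, rfl⟩ := hb
  have := Nat.find_min hex hi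
  push Not at this
  exact this

theorem prepend_replicate_ne (x : X) {k : ℕ} {z : X} (hz : z ≠ x) (t : ℕ → X) :
    prepend (List.replicate k x ++ [z]) t ≠ fun _ => x := by
  intro h
  have := congrFun h k
  rw [prepend_apply_lt _ _ _ (by simp)] at this
  simp at this
  exact hz this

theorem run_replicate {s : S} {x : X} (h : A.next s x = s) (k : ℕ) :
    A.run s (List.replicate k x) = s := by
  induction k with
  | zero => rfl
  | succ k ih => rw [List.replicate_succ, run_cons, h, ih]

theorem actWord_replicate {s : S} {x y : X} (h : A.next s x = s) (ho : A.out s x = y) (k : ℕ) :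
    A.actWord s (List.replicate k x) = List.replicate k y := by
  induction k with
  | zero => rfl
  | succ k ih => rw [List.replicate_succ, actWord_cons, h, ih, ho]; rfl

theorem act_prepend_replicate {s : S} {x : X} (h : A.next s x = s) (ho : A.out s x = x) (k : ℕ)
    (z : X) (t : ℕ → X) : A.act s (prepend (List.replicate k x ++ [z]) t) =
      prepend (List.replicate k x ++ [A.out s z]) (A.act (A.next s z) t) := by
  rw [act_prepend, actWord_append, run_append, run_replicate h, actWord_replicate h ho]
  rfl

theorem act_const {s : S} {x : X} (h : A.next s x = s) (ho : A.out s x = x) :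
    A.act s (fun _ => x) = fun _ => x := by
  have hst : ∀ n, A.stateAt s (fun _ => x) n = s := by
    intro n
    induction n with
    | zero => rfl
    | succ n ih => change A.next (A.stateAt s (fun _ => x) n) x = s; rw [ih, h]
  funext n
  change A.out (A.stateAt s (fun _ => x) n) x = x
  rw [hst, ho]

theorem append_cons_ne_replicate {x z : X} (hz : z ≠ x) (p r : List X) (k : ℕ) :
    p ++ z :: r ≠ List.replicate k x := by
  intro h
  have : z ∈ List.replicate k x := by rw [← h]; simp
  exact hz (List.eq_of_mem_replicate this)

end Transducer

namespace Transducer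

variable {S X : Type*} {A : Transducer S X}

/-! ### Shapes of the Schreier graphs of the paired automata -/

/-- A type II state waits in its loop while it reads `x`, acts on the first other letter and then
becomes trivial; the constant sequence of letters `x` is fixed. -/
theorem exists_typeII_act_iff {x : X} {π : X → X → Prop} {T : S → Prop}
    (hT : ∀ s, T s → A.IsTypeII x s) (hπ : ∀ z z', π z z' ↔ z ≠ z' ∧ ∃ s, T s ∧ A.out s z = z')
    {v u : ℕ → X} : (v ≠ u ∧ ∃ s, T s ∧ A.act s v = u) ↔
      PrefixRel (fun p z z' => (∃ k, p = List.replicate k x) ∧ π z z') v u := by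
  constructor
  · rintro ⟨hne, s, hs, rfl⟩
    obtain ⟨-, ho, hn, hz⟩ := hT s hs
    obtain ⟨k, z, t, hzx, rfl⟩ := exists_eq_prepend_replicate x (v := v) (by
      rintro rfl
      exact hne (act_const hn ho).symm)
    rw [act_prepend_replicate hn ho, hz z hzx] at hne ⊢
    refine ⟨_, z, A.out s z, t, ⟨⟨k, rfl⟩, (hπ _ _).2 ⟨fun h => ?_, s, hs, rfl⟩⟩, rfl, rfl⟩
    rw [← h] at hne
    exact hne rfl
  · rintro ⟨_, z, z', t, ⟨⟨k, rfl⟩, h⟩, rfl, rfl⟩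
    obtain ⟨hzz, s, hs, rfl⟩ := (hπ _ _).1 h
    obtain ⟨-, ho, hn, hz⟩ := hT s hs
    have hzx : z ≠ x := by
      rintro rfl
      exact hzz ho.symm
    refine ⟨fun h => hzz ?_, s, hs, by rw [act_prepend_replicate hn ho, hz z hzx]⟩
    simpa using (prepend_inj_of_length_eq (by simp) h).1

theorem IsPairedII.seqGraph_adj (hA : A.IsTame) {n : ℕ} {e : Fin (n + 1) ≃ X}
    (h : A.IsPairedII e) (v u : ℕ → X) : A.seqGraph.Adj v u ↔
      PrefixRel (fun p z z' => (∃ k, p = List.replicate k (e 0)) ∧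
        PairRel e (fun i => Odd i) z z') v u ∨
      PrefixRel (fun p z z' => (∃ k, p = List.replicate k (e (Fin.last n))) ∧
        PairRel e (fun i => Even i) z z') v u := by
  obtain ⟨-, hall, h0, h1⟩ := h
  rw [orbitsArePairs_iff hA.invertible (fun i hi => by grind)] at h0 h1
  rw [Transducer.seqGraph_adj hA.symmetric, ← exists_typeII_act_iff (fun _ h => h) h0,
    ← exists_typeII_act_iff (fun _ h => h) h1]
  constructor
  · rintro ⟨hne, s, hs⟩
    rcases hall s with ht | ht | ht
    · exact absurd ((ht v).symm.trans hs) hne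
    · exact .inl ⟨hne, s, ht, hs⟩
    · exact .inr ⟨hne, s, ht, hs⟩
  · rintro (⟨hne, s, -, hs⟩ | ⟨hne, s, -, hs⟩) <;> exact ⟨hne, s, hs⟩

theorem replicate_prefixRel_eq {x : X} {π : X → X → Prop}
    (hx : ∀ z z', π z z' → z ≠ x) (hf : ∀ z z₁ z₂, π z z₁ → π z z₂ → z₁ = z₂)
    {v u u' : ℕ → X} (h : PrefixRel (fun p z z' => (∃ k, p = List.replicate k x) ∧ π z z') v u)
    (h' : PrefixRel (fun p z z' => (∃ k, p = List.replicate k x) ∧ π z z') v u') : u = u' := by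
  refine PrefixRel.eq ?_ ?_ h h'
  · rintro p z z₁ z₂ ⟨-, h⟩ ⟨-, h'⟩
    exact hf _ _ _ h h'
  · rintro p z z₁ r z₂ z₃ ⟨-, h⟩ ⟨⟨k, hk⟩, -⟩
    exact append_cons_ne_replicate (hx _ _ h) _ _ _ hk

theorem exists_replicate_prefixRel {x : X} {π : X → X → Prop} (ht : ∀ z, z ≠ x → ∃ z', π z z')
    {v : ℕ → X} (hv : v ≠ fun _ => x) :
    ∃ u, PrefixRel (fun p z z' => (∃ k, p = List.replicate k x) ∧ π z z') v u := by
  obtain ⟨k, z, t, hz, rfl⟩ := exists_eq_prepend_replicate x hv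
  obtain ⟨z', hz'⟩ := ht z hz
  exact ⟨_, _, z, z', t, ⟨⟨k, rfl⟩, hz'⟩, rfl, rfl⟩

theorem not_replicate_prefixRel {x : X} {π : X → X → Prop} (hx : ∀ z z', π z z' → z ≠ x)
    (u : ℕ → X) :
    ¬ PrefixRel (fun p z z' => (∃ k, p = List.replicate k x) ∧ π z z') (fun _ => x) u := by
  rintro ⟨_, z, z', t, ⟨⟨k, rfl⟩, h⟩, h1, -⟩
  exact prepend_replicate_ne x (hx _ _ h) t h1.symm

/-- For an odd number of letters, one family of pairs covers all letters but the first and the other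
all letters but the last. So each of the two matchings of sequences misses exactly one constant
sequence. -/
theorem IsPairedII.shape [Nontrivial X] (hA : A.IsTame) {n : ℕ} {e : Fin (n + 1) ≃ X}
    (h : A.IsPairedII e) :
    (fun _ => e 0) ≠ (fun _ : ℕ => e (Fin.last n)) ∧
    A.HasOneNeighbor (fun _ => e 0) ∧ A.HasOneNeighbor (fun _ => e (Fin.last n)) ∧
    ∀ v, v ≠ (fun _ => e 0) → v ≠ (fun _ => e (Fin.last n)) → A.HasTwoNeighbors v := by
  have hadj := h.seqGraph_adj hA
  have hodd : Even n := by have := h.1; grind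
  have hn0 : n ≠ 0 := by
    rintro rfl
    obtain ⟨a, b, hab⟩ := exists_pair_ne X
    exact hab (e.symm.injective (Fin.ext (by omega)))
  have hne : (fun _ => e 0) ≠ (fun _ : ℕ => e (Fin.last n)) := by
    intro h
    have := e.injective (congrFun h 0)
    rw [Fin.ext_iff] at this
    simp at this
    omega
  have hx0 : ∀ z z', PairRel e (fun i => Odd i) z z' → z ≠ e 0 := fun z z' h =>
    h.ne_of_forall_not (by simp)
  have hx1 : ∀ z z', PairRel e (fun i => Even i) z z' → z ≠ e (Fin.last n) := fun z z' h =>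
    h.ne_of_forall_not (by simp; grind)
  have ht0 : ∀ z, z ≠ e 0 → ∃ z', PairRel e (fun i => Odd i) z z' := by
    intro z hz
    obtain ⟨a, rfl⟩ := e.surjective z
    have ha : (a : ℕ) ≠ 0 := fun h => hz (by rw [Fin.ext_iff.2 (show (a : ℕ) = (0 : Fin _) from h)])
    rw [PairRel.exists_iff]
    have := a.2
    grind
  have ht1 : ∀ z, z ≠ e (Fin.last n) → ∃ z', PairRel e (fun i => Even i) z z' := by
    intro z hz
    obtain ⟨a, rfl⟩ := e.surjective z
    have ha : (a : ℕ) ≠ n := fun h =>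
      hz (by rw [Fin.ext_iff.2 (show (a : ℕ) = (Fin.last n : Fin _) from h)])
    rw [PairRel.exists_iff]
    have := a.2
    grind
  have hf0 : ∀ z z₁ z₂, PairRel e (fun i => Odd i) z z₁ → PairRel e (fun i => Odd i) z z₂ →
      z₁ = z₂ := fun _ _ _ h h' => h.eq (fun i hi => by grind) h'
  have hf1 : ∀ z z₁ z₂, PairRel e (fun i => Even i) z z₁ → PairRel e (fun i => Even i) z z₂ →
      z₁ = z₂ := fun _ _ _ h h' => h.eq (fun i hi => by grind) h'
  refine ⟨hne, ?_, ?_, fun v hv0 hv1 => ?_⟩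
  · obtain ⟨u, hu⟩ := exists_replicate_prefixRel ht1 hne
    exact hasOneNeighbor_of_matching (fun v u => (hadj v u).trans or_comm)
      (fun _ _ _ => replicate_prefixRel_eq hx1 hf1) hu (not_replicate_prefixRel hx0)
  · obtain ⟨u, hu⟩ := exists_replicate_prefixRel ht0 hne.symm
    exact hasOneNeighbor_of_matching hadj
      (fun _ _ _ => replicate_prefixRel_eq hx0 hf0) hu (not_replicate_prefixRel hx1)
  · obtain ⟨u, hu⟩ := exists_replicate_prefixRel ht0 hv0
    obtain ⟨u', hu'⟩ := exists_replicate_prefixRel ht1 hv1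
    refine hA.hasTwoNeighbors_of_matching hadj ?_ ?_ (fun _ _ _ => replicate_prefixRel_eq hx0 hf0)
      (fun _ _ _ => replicate_prefixRel_eq hx1 hf1) hu hu'
    · exact fun _ _ h => h.symm fun _ _ _ h => ⟨h.1, h.2.symm⟩
    · exact fun _ _ h => h.symm fun _ _ _ h => ⟨h.1, h.2.symm⟩

/-- The state `f` has an incoming arrow. Arrows from the other types lead to the trivial state or
back to a state with a loop, so the arrow is the one labeled by `y` of a type III state. -/
theorem IsTypeIII'.exists_typeIII (hA : A.IsTame) {x y : X}
    (hall : ∀ s, A.IsTrivial s ∨ A.IsTypeII x s ∨ A.IsTypeIII x y s ∨ A.IsTypeIII' s) {f : S}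
    (hf : A.IsTypeIII' f) : ∃ s, A.IsTypeIII x y s ∧ A.next s y = f := by
  obtain ⟨t, a, rfl⟩ := hA.incoming f
  rcases hall t with ht | ht | ht | ht
  · exact absurd (ht.next a) hf.1
  · by_cases ha : a = x
    · rw [ha] at hf
      rw [ht.2.2.1] at hf
      have := hf.2 x
      rw [ht.2.2.1] at this
      exact absurd this hf.1
    · exact absurd (ht.2.2.2 a ha) hf.1
  · by_cases ha : a = x
    · rw [ha] at hf
      rw [ht.2.1] at hf
      have := hf.2 x
      rw [ht.2.1] at this
      exact absurd this hf.1
    · by_cases ha' : a = y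
      · subst ha'
        exact ⟨t, ht, rfl⟩
      · exact absurd (ht.2.2.2.2 a ha ha') hf.1
  · exact absurd (ht.2 a) hf.1

theorem IsTypeIII'.act_prepend {f : S} (hf : A.IsTypeIII' f) (z : X) (t : ℕ → X) :
    A.act f (prepend [z] t) = prepend [A.out f z] t := by
  rw [Transducer.act_prepend, run_cons, run_nil, hf.2 z]
  rfl

theorem eq_prepend_singleton (t : ℕ → X) : t = prepend [t 0] (seqShift t 1) :=
  (prepend_seqPrefix t 1).symm

/-- A type III state waits while it reads `x`; then it either acts on a letter other than `x` and
`y`, or passes `y` unchanged and lets a type III′ state act on the next letter. Conversely, every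
type III′ state is reached in this way, by `IsTypeIII'.exists_typeIII`. -/
theorem IsPairedIII.seqGraph_adj (hA : A.IsTame) {n : ℕ} {e : Fin (n + 1) ≃ X}
    (h : A.IsPairedIII e) (v u : ℕ → X) : A.seqGraph.Adj v u ↔
      PrefixRel (fun p z z' => (∃ k, p = List.replicate k (e 0)) ∧
          PairRel e (fun i => Odd i) z z' ∨
        (∃ k, p = List.replicate k (e 0) ++ [e (Fin.last n)]) ∧
          PairRel e (fun i => Even i) z z') v u ∨
      PrefixRel (fun p z z' => p = [] ∧ PairRel e (fun i => Even i) z z') v u := by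
  have htypeIII := fun f (hf : A.IsTypeIII' f) => hf.exists_typeIII hA h.2.1
  obtain ⟨-, hall, h0, h1⟩ := h
  rw [orbitsArePairs_iff hA.invertible (fun i hi => by grind)] at h0 h1
  rw [Transducer.seqGraph_adj hA.symmetric]
  constructor
  · rintro ⟨hne, s, rfl⟩
    have key : A.next s (e 0) = s → A.out s (e 0) = e 0 → ∃ k z t, z ≠ e 0 ∧
        v = prepend (List.replicate k (e 0) ++ [z]) t ∧ A.act s v =
          prepend (List.replicate k (e 0) ++ [A.out s z]) (A.act (A.next s z) t) := by
      intro hn ho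
      obtain ⟨k, z, t, hz, rfl⟩ := exists_eq_prepend_replicate (e 0) (v := v) (by
        rintro rfl
        exact hne (act_const hn ho).symm)
      exact ⟨k, z, t, hz, rfl, act_prepend_replicate hn ho _ _ _⟩
    have fin : ∀ k z t, (A.IsTypeII (e 0) s ∨ A.IsTypeIII (e 0) (e (Fin.last n)) s) →
        v = prepend (List.replicate k (e 0) ++ [z]) t →
        A.act s v = prepend (List.replicate k (e 0) ++ [A.out s z]) (A.act (A.next s z) t) →
        A.IsTrivial (A.next s z) →
        PrefixRel (fun p z z' => (∃ k, p = List.replicate k (e 0)) ∧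
          PairRel e (fun i => Odd i) z z' ∨
        (∃ k, p = List.replicate k (e 0) ++ [e (Fin.last n)]) ∧
          PairRel e (fun i => Even i) z z') v (A.act s v) := by
      intro k z t hs hv hav htr
      rw [htr] at hav
      refine ⟨_, z, A.out s z, t, .inl ⟨⟨k, rfl⟩, (h0 _ _).2 ⟨fun h => ?_, s, hs, rfl⟩⟩, hv, hav⟩
      rw [← h, ← hv] at hav
      exact hne hav.symm
    rcases hall s with ht | ht | ht | ht
    · exact absurd (ht v).symm hne
    · obtain ⟨k, z, t, hz, hv, hav⟩ := key ht.2.2.1 ht.2.1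
      exact .inl (fin k z t (.inl ht) hv hav (ht.2.2.2 z hz))
    · obtain ⟨k, z, t, hz, hv, hav⟩ := key ht.2.1 ht.1
      by_cases hzy : z = e (Fin.last n)
      · subst hzy
        rw [ht.2.2.1, eq_prepend_singleton t, ht.2.2.2.1.act_prepend, ← prepend_append] at hav
        rw [eq_prepend_singleton t, ← prepend_append] at hv
        refine .inl ⟨_, _, _, _, .inr ⟨⟨k, rfl⟩, (h1 _ _).2 ⟨fun h => ?_, _, ht.2.2.2.1, rfl⟩⟩,
          hv, hav⟩
        rw [← h, ← hv] at hav
        exact hne hav.symm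
      · exact .inl (fin k z t (.inr ht) hv hav (ht.2.2.2.2 z hz hzy))
    · right
      have hav := ht.act_prepend (v 0) (seqShift v 1)
      rw [← eq_prepend_singleton] at hav
      refine ⟨[], v 0, _, seqShift v 1, ⟨rfl, (h1 _ _).2 ⟨fun h => ?_, s, ht, rfl⟩⟩,
        eq_prepend_singleton v, hav⟩
      rw [← h, ← eq_prepend_singleton] at hav
      exact hne hav.symm
  · have hne : ∀ (p : List X) (z z' : X) (t : ℕ → X), z ≠ z' →
        prepend (p ++ [z]) t ≠ prepend (p ++ [z']) t := by
      intro p z z' t hzz h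
      exact hzz (by simpa using (prepend_inj_of_length_eq (by simp) h).1)
    rintro (⟨p, z, z', t, ⟨⟨k, rfl⟩, h⟩ | ⟨⟨k, rfl⟩, h⟩, rfl, rfl⟩ | ⟨p, z, z', t, ⟨rfl, h⟩, rfl, rfl⟩)
    · refine ⟨hne _ _ _ _ h.ne, ?_⟩
      obtain ⟨hzz, s, hs, rfl⟩ := (h0 _ _).1 h
      refine ⟨s, ?_⟩
      rcases hs with hs | hs
      · have hz : z ≠ e 0 := by rintro rfl; exact hzz hs.2.1.symm
        rw [act_prepend_replicate hs.2.2.1 hs.2.1, hs.2.2.2 z hz]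
      · have hz : z ≠ e 0 := by rintro rfl; exact hzz hs.1.symm
        have hz' : z ≠ e (Fin.last n) := by rintro rfl; exact hzz hs.2.2.1.symm
        rw [act_prepend_replicate hs.2.1 hs.1, hs.2.2.2.2 z hz hz']
    · refine ⟨hne _ _ _ _ h.ne, ?_⟩
      obtain ⟨hzz, f, hf, rfl⟩ := (h1 _ _).1 h
      obtain ⟨s, hs, rfl⟩ := htypeIII f hf
      refine ⟨s, ?_⟩
      rw [prepend_append, act_prepend_replicate hs.2.1 hs.1, hf.act_prepend, hs.2.2.1,
        prepend_append _ [A.out _ _]]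
    · refine ⟨hne _ _ _ _ h.ne, ?_⟩
      obtain ⟨hzz, f, hf, rfl⟩ := (h1 _ _).1 h
      exact ⟨f, hf.act_prepend _ _⟩

/-- The pairs of even index cover all letters, so changing the first letter matches all sequences.
In the other matching, the first letter different from `x` is changed, or its successor if that
letter is `y`; only the constant sequence `x` is missed. -/
theorem IsPairedIII.shape [Nontrivial X] (hA : A.IsTame) {n : ℕ} {e : Fin (n + 1) ≃ X}
    (h : A.IsPairedIII e) : A.HasOneNeighbor (fun _ => e 0) ∧
    ∀ v, v ≠ (fun _ => e 0) → A.HasTwoNeighbors v := by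
  have hodd : Odd n := by have := h.1; grind
  have hxy : e 0 ≠ e (Fin.last n) := by
    intro h
    have := e.injective h
    rw [Fin.ext_iff] at this
    simp at this
    subst this
    simp at hodd
  have hadj := h.seqGraph_adj hA
  have hx0 : ∀ z z', PairRel e (fun i => Odd i) z z' → z ≠ e 0 := fun z z' h =>
    h.ne_of_forall_not (by simp)
  have hy0 : ∀ z z', PairRel e (fun i => Odd i) z z' → z ≠ e (Fin.last n) := fun z z' h =>
    h.ne_of_forall_not (by simp; grind)
  have ht0 : ∀ z, z ≠ e 0 → z ≠ e (Fin.last n) → ∃ z', PairRel e (fun i => Odd i) z z' := by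
    intro z hz hz'
    obtain ⟨a, rfl⟩ := e.surjective z
    have ha : (a : ℕ) ≠ 0 := fun h => hz (by rw [Fin.ext_iff.2 (show (a : ℕ) = (0 : Fin _) from h)])
    have ha' : (a : ℕ) ≠ n := fun h =>
      hz' (by rw [Fin.ext_iff.2 (show (a : ℕ) = (Fin.last n : Fin _) from h)])
    rw [PairRel.exists_iff]
    have := a.2
    grind
  have ht1 : ∀ z, ∃ z', PairRel e (fun i => Even i) z z' := by
    intro z
    obtain ⟨a, rfl⟩ := e.surjective z
    rw [PairRel.exists_iff]
    have := a.2
    grind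
  have hf0 : ∀ z z₁ z₂, PairRel e (fun i => Odd i) z z₁ → PairRel e (fun i => Odd i) z z₂ →
      z₁ = z₂ := fun _ _ _ h h' => h.eq (fun i hi => by grind) h'
  have hf1 : ∀ z z₁ z₂, PairRel e (fun i => Even i) z z₁ → PairRel e (fun i => Even i) z z₂ →
      z₁ = z₂ := fun _ _ _ h h' => h.eq (fun i hi => by grind) h'
  have hnot : ∀ (j : ℕ) (p r : List X) (z : X), z ≠ e 0 → z ≠ e (Fin.last n) →
      p ++ z :: r ≠ List.replicate j (e 0) ++ [e (Fin.last n)] := by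
    intro j p r z hz hz' h
    have : z ∈ List.replicate j (e 0) ++ [e (Fin.last n)] := by rw [← h]; simp
    rcases List.mem_append.1 this with h | h
    · exact hz (List.eq_of_mem_replicate h)
    · exact hz' (by simpa using h)
  have hR0 : ∀ v u u' : ℕ → X,
      PrefixRel (fun p z z' => (∃ k, p = List.replicate k (e 0)) ∧
          PairRel e (fun i => Odd i) z z' ∨
        (∃ k, p = List.replicate k (e 0) ++ [e (Fin.last n)]) ∧
          PairRel e (fun i => Even i) z z') v u →
      PrefixRel (fun p z z' => (∃ k, p = List.replicate k (e 0)) ∧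
          PairRel e (fun i => Odd i) z z' ∨
        (∃ k, p = List.replicate k (e 0) ++ [e (Fin.last n)]) ∧
          PairRel e (fun i => Even i) z z') v u' → u = u' := by
    intro v u u' h h'
    refine PrefixRel.eq ?_ ?_ h h'
    · rintro p z z₁ z₂ (⟨⟨k, rfl⟩, h⟩ | ⟨⟨k, rfl⟩, h⟩) (⟨⟨j, hj⟩, h'⟩ | ⟨⟨j, hj⟩, h'⟩)
      · exact hf0 _ _ _ h h'
      · exact absurd hj.symm (append_cons_ne_replicate hxy.symm _ _ _)
      · exact absurd hj (append_cons_ne_replicate hxy.symm _ _ _)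
      · exact hf1 _ _ _ h h'
    · rintro p z z₁ r z₂ z₃ (⟨⟨k, rfl⟩, h⟩ | ⟨⟨k, rfl⟩, h⟩) (⟨⟨j, hj⟩, h'⟩ | ⟨⟨j, hj⟩, h'⟩)
      · exact append_cons_ne_replicate (hx0 _ _ h) _ _ _ hj
      · exact hnot j _ _ _ (hx0 _ _ h) (hy0 _ _ h) hj
      · rw [List.append_assoc] at hj
        exact append_cons_ne_replicate hxy.symm _ _ _ hj
      · have hj' := congrArg List.dropLast hj
        rw [List.dropLast_concat, List.dropLast_append_of_ne_nil (by simp), List.append_assoc] at hj'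
        exact append_cons_ne_replicate hxy.symm _ _ _ hj'
  have hR1 : ∀ v u u' : ℕ → X,
      PrefixRel (fun p z z' => p = [] ∧ PairRel e (fun i => Even i) z z') v u →
      PrefixRel (fun p z z' => p = [] ∧ PairRel e (fun i => Even i) z z') v u' → u = u' := by
    intro v u u' h h'
    refine PrefixRel.eq ?_ ?_ h h'
    · rintro p z z₁ z₂ ⟨-, h⟩ ⟨-, h'⟩
      exact hf1 _ _ _ h h'
    · rintro p z z₁ r z₂ z₃ - ⟨h, -⟩
      simp at h
  have hE1 : ∀ v : ℕ → X, ∃ u,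
      PrefixRel (fun p z z' => p = [] ∧ PairRel e (fun i => Even i) z z') v u := by
    intro v
    obtain ⟨z', hz'⟩ := ht1 (v 0)
    exact ⟨_, [], v 0, z', seqShift v 1, ⟨rfl, hz'⟩, eq_prepend_singleton v, rfl⟩
  refine ⟨?_, fun v hv => ?_⟩
  · obtain ⟨u, hu⟩ := hE1 fun _ => e 0
    refine hasOneNeighbor_of_matching (fun v u => (hadj v u).trans or_comm) hR1 hu ?_
    rintro u ⟨p, z, z', t, ⟨⟨k, rfl⟩, h⟩ | ⟨⟨k, rfl⟩, h⟩, h1, -⟩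
    · exact prepend_replicate_ne (e 0) (hx0 _ _ h) t h1.symm
    · rw [prepend_append] at h1
      exact prepend_replicate_ne (e 0) hxy.symm _ h1.symm
  · obtain ⟨u', hu'⟩ := hE1 v
    obtain ⟨k, z, t, hz, rfl⟩ := exists_eq_prepend_replicate (e 0) hv
    obtain ⟨u, hu⟩ : ∃ u, PrefixRel (fun p z z' => (∃ k, p = List.replicate k (e 0)) ∧
          PairRel e (fun i => Odd i) z z' ∨
        (∃ k, p = List.replicate k (e 0) ++ [e (Fin.last n)]) ∧
          PairRel e (fun i => Even i) z z') (prepend (List.replicate k (e 0) ++ [z]) t) u := by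
      by_cases hzy : z = e (Fin.last n)
      · subst hzy
        obtain ⟨z', hz'⟩ := ht1 (t 0)
        refine ⟨_, _, t 0, z', seqShift t 1, .inr ⟨⟨k, rfl⟩, hz'⟩, ?_, rfl⟩
        rw [prepend_append _ [t 0], ← eq_prepend_singleton]
      · obtain ⟨z', hz'⟩ := ht0 z hz hzy
        exact ⟨_, _, z, z', t, .inl ⟨⟨k, rfl⟩, hz'⟩, rfl, rfl⟩
    refine hA.hasTwoNeighbors_of_matching hadj ?_ ?_ hR0 hR1 hu hu'
    · exact fun _ _ h => h.symm fun _ _ _ h => h.imp (fun h => ⟨h.1, h.2.symm⟩)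
        (fun h => ⟨h.1, h.2.symm⟩)
    · exact fun _ _ h => h.symm fun _ _ _ h => ⟨h.1, h.2.symm⟩

end Transducer

namespace Transducer

variable {S X : Type*} {A : Transducer S X}

/-! ### Copies of tile graphs inside larger tile graphs -/

/-- All states restrict to the trivial one along `u`. -/
def IsNoncritical (A : Transducer S X) (u : List X) : Prop := ∀ s, A.IsTrivial (A.run s u)

/-- The tile graph containing the word `c` stays connected when `c` is removed. -/
def IsNonCutWord (A : Transducer S X) (c : List X) : Prop :=
  ∀ a b : List X, a.length = c.length → b.length = c.length → a ≠ c → b ≠ c →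
    A.wordGraph.AvoidReach {c} a b

theorem isNonCutWord_of_isNonCut {n : ℕ} {c : List.Vector X n}
    (h : (A.finiteTileGraph n).IsNonCut c) : A.IsNonCutWord c.toList := by
  intro a b ha hb hac hbc
  rw [c.toList_length] at ha hb
  have := h (toVec a ha) (toVec b hb) (fun h => hac (h ▸ rfl)) (fun h => hbc (h ▸ rfl))
  exact this.map List.Vector.toList (fun _ _ h => finiteTileGraph_adj.1 h)
    (fun a ha h => ha (Subtype.ext h))

/-- The state realizing the edge is itself a restriction of some state along a word of length `n`;
thus every edge between suffixes lifts to an edge between the corresponding copies of level `n`. -/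
theorem IsTame.exists_adj_append [Nonempty X] (hA : A.IsTame) (n : ℕ) {q q' : List X}
    (h : A.wordGraph.Adj q q') :
    ∃ p p' : List X, p.length = n ∧ p'.length = n ∧ A.wordGraph.Adj (p ++ q) (p' ++ q') := by
  obtain ⟨hne, s, rfl, hs⟩ := (wordGraph_adj hA.symmetric).1 h
  obtain ⟨t, p, hp, rfl⟩ := exists_run_eq hA.incoming s n
  refine ⟨p, A.actWord t p, hp, by rw [length_actWord, hp], (wordGraph_adj hA.symmetric).2
    ⟨fun h => hne ?_, t, by rw [actWord_append], by rwa [run_append]⟩⟩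
  exact (List.append_inj h (length_actWord _ _ _).symm).2

theorem IsTame.avoidReach_copy [Nonempty X] (hA : A.IsTame) {p p' q : List X}
    (hp : p.length = p'.length) {F : Set (List X)}
    (hF : ∀ a : List X, a.length = p.length → a ++ q ∉ F) :
    A.wordGraph.AvoidReach F (p ++ q) (p' ++ q) := by
  have h := (hA.wordGraph_reachable hp).avoidReach_empty
  unfold SimpleGraph.AvoidReach at h
  have hlen : ∀ b, Relation.ReflTransGen (A.wordGraph.AvoidStep ∅) p b → b.length = p.length := by
    intro b h
    induction h with
    | refl => rfl
    | tail _ h ih => rw [← length_eq_of_wordGraph_adj h.1, ih]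
  clear hp
  induction h with
  | refl => exact .refl _
  | tail h1 h2 ih =>
    exact ih.trans (.of_adj (wordGraph_adj_append q h2.1) (hF _ (hlen _ h1))
      (hF _ (hlen _ (h1.tail h2))))

/-- A walk of suffixes is lifted by moving inside the connected copy to the start of a lifted edge,
crossing it, and repeating. -/
theorem IsTame.avoidReach_append [Nonempty X] (hA : A.IsTame) {n : ℕ} {u q q' : List X}
    {F : Set (List X)}
    (hF : ∀ p q : List X, p.length = n → q.length = u.length → q ≠ u → p ++ q ∉ F)
    (h : A.wordGraph.AvoidReach {u} q q') (hq : q.length = u.length) (hqu : q ≠ u)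
    {p p' : List X} (hp : p.length = n) (hp' : p'.length = n) :
    A.wordGraph.AvoidReach F (p ++ q) (p' ++ q') := by
  unfold SimpleGraph.AvoidReach at h
  induction h using Relation.ReflTransGen.head_induction_on generalizing p with
  | refl => exact hA.avoidReach_copy (hp.trans hp'.symm) fun a ha => hF _ _ (ha.trans hp) hq hqu
  | head h1 _ ih =>
    obtain ⟨p₁, p₂, h2, h3, h4⟩ := hA.exists_adj_append n h1.1
    have hl := (length_eq_of_wordGraph_adj h1.1).symm.trans hq
    refine (hA.avoidReach_copy (hp.trans h2.symm) fun a ha => hF _ _ (ha.trans hp) hq hqu).trans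
      ((SimpleGraph.AvoidReach.of_adj h4 (hF _ _ h2 hq hqu) (hF _ _ h3 hl h1.2.2)).trans
        (ih hl h1.2.2 h3))

/-! ### One-ended Schreier graphs -/

theorem stateAt_isTrivial_of_noncritical {u : List X} (hu : A.IsNoncritical u) (s : S)
    {v : ℕ → X} {n : ℕ} (h : seqPrefix (seqShift v n) u.length = u) :
    A.IsTrivial (A.stateAt s v (n + u.length)) := by
  rw [stateAt_add, stateAt_eq_run, h]
  exact hu _

theorem seqShift_act_of_isTrivial {s : S} {v : ℕ → X} {n : ℕ}
    (h : A.IsTrivial (A.stateAt s v n)) : seqShift (A.act s v) n = seqShift v n := by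
  rw [seqShift_act, h]

theorem seqShift_add (w : ℕ → X) (n k : ℕ) : seqShift w (n + k) = seqShift (seqShift w n) k := by
  funext i; simp only [seqShift, add_assoc]

theorem seqShift_eq_of_le {v w : ℕ → X} {n m : ℕ} (h : seqShift v n = seqShift w n) (hnm : n ≤ m) :
    seqShift v m = seqShift w m := by
  obtain ⟨k, rfl⟩ := Nat.exists_eq_add_of_le hnm
  rw [seqShift_add, seqShift_add, h]

/-- If `w` contains infinitely often a word along which all states become trivial, and which does
not cut its tile graph, then the Schreier graph of `w` has at most one end. -/
theorem IsTame.equivalent_of_frequent [Finite X] [Nonempty X] (hA : A.IsTame) {u : List X}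
    (hu : A.IsNoncritical u) (hcut : A.IsNonCutWord u) {w : ℕ → X}
    (hw : ∀ N, ∃ n ≥ N, seqPrefix (seqShift w n) u.length = u)
    (r r' : GraphRay (A.schreierGraph w)) : r.Equivalent r' := by
  classical
  rw [GraphRay.equivalent_iff]
  intro F
  -- Every state becomes trivial along the next occurrence of `u`, so all points of the orbit
  -- eventually agree with `w`.
  have hcof : ∀ v ∈ MulAction.orbit A.group w, ∃ N, seqShift v N = seqShift w N := by
    intro v hv
    refine ((mem_orbit_iff hA.symmetric).1 hv).closed (s := {v | ∃ N, seqShift v N = seqShift w N})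
      ?_ ⟨0, rfl⟩
    rintro v ⟨N, hN⟩ y hy
    obtain ⟨-, s, rfl⟩ := (seqGraph_adj hA.symmetric).1 hy
    obtain ⟨n, hn, hnu⟩ := hw N
    have h1 := seqShift_eq_of_le hN hn
    refine ⟨n + u.length, ?_⟩
    rw [seqShift_act_of_isTrivial (stateAt_isTrivial_of_noncritical hu s (by rw [h1, hnu])),
      seqShift_eq_of_le hN (by omega)]
  choose! M hM using hcof
  -- The occurrence of `u` is taken so far out that the finite set `K` of sequences agreeing with
  -- `w` from position `n` on contains `F`.
  obtain ⟨n, hn, hnu⟩ := hw (F.sup fun v => M v.1)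
  set k := u.length with hk
  let K : Set (ℕ → X) := {v | seqShift v n = seqShift w n}
  have hFK : ∀ v ∈ F, v.1 ∈ K := fun v hv =>
    seqShift_eq_of_le (hM v.1 v.2) ((Finset.le_sup (f := fun v => M v.1) hv).trans hn)
  have hKu : ∀ v ∈ K, seqPrefix (seqShift v n) u.length = u := fun v hv => by
    rw [show seqShift v n = seqShift w n from hv]; exact hnu
  have hKfin : K.Finite := by
    have : Finite (List.Vector X n) := by have := Fintype.ofFinite X; infer_instance
    refine (Set.finite_range fun p : List.Vector X n => prepend p.toList (seqShift w n)).subset ?_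
    intro v hv
    refine ⟨toVec (seqPrefix v n) (by simp), ?_⟩
    have hv : seqShift v n = seqShift w n := hv
    simp only [toList_toVec]
    rw [← hv, prepend_seqPrefix]
  -- These sequences have another block in place of `u`. They are joined to each other outside `K`
  -- because `u` is not a cut vertex, and every edge leaving `K` ends in `D` because all states are
  -- trivial after `u`.
  let D : Set (ℕ → X) := {v | seqShift v (n + k) = seqShift w (n + k) ∧ v ∉ K}
  have hwu : seqShift w n = prepend u (seqShift w (n + k)) := by
    conv_lhs => rw [← prepend_seqPrefix (seqShift w n) k, hnu]
    rw [seqShift_add]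
  have hDD : ∀ d ∈ D, ∀ d' ∈ D, A.seqGraph.AvoidReach K d d' := by
    have hform : ∀ d ∈ D, ∃ p q : List X, p.length = n ∧ q.length = u.length ∧ q ≠ u ∧
        d = prepend (p ++ q) (seqShift w (n + k)) := by
      intro d hd
      refine ⟨seqPrefix d n, seqPrefix (seqShift d n) k, by simp, by simp [hk],
        fun h => hd.2 ?_, ?_⟩
      · change seqShift d n = seqShift w n
        rw [hwu, ← h, ← hd.1, seqShift_add, prepend_seqPrefix]
      · rw [← hd.1, ← seqPrefix_add, prepend_seqPrefix]
    intro d hd d' hd'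
    obtain ⟨p, q, hp, hq, hqu, rfl⟩ := hform d hd
    obtain ⟨p', q', hp', hq', hqu', rfl⟩ := hform d' hd'
    have h1 := hA.avoidReach_append (n := n) (u := u) (p := p) (p' := p')
      (F := {a | ∃ p q : List X, p.length = n ∧ q.length = u.length ∧ q ≠ u ∧ a = p ++ q}ᶜ)
      (fun p q hp hq hqu h => h ⟨p, q, hp, hq, hqu, rfl⟩) (hcut q q' hq hq' hqu hqu') hq hqu hp hp'
    refine h1.map (fun a => prepend a (seqShift w (n + k))) ?_ ?_
    · intro a b hab
      obtain ⟨hne, s, rfl, hs⟩ := (wordGraph_adj hA.symmetric).1 hab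
      refine (seqGraph_adj hA.symmetric).2 ⟨fun h => hne ?_, s, by rw [act_prepend, hs]⟩
      exact (prepend_inj_of_length_eq (length_actWord _ _ _).symm h).1
    · intro a ha
      rw [Set.mem_compl_iff, not_not] at ha
      obtain ⟨p, q, rfl, hq, hqu, rfl⟩ := ha
      intro h
      have h : seqShift (prepend (p ++ q) (seqShift w (p.length + k))) p.length =
        seqShift w p.length := h
      rw [hwu, prepend_append, (seqPrefix_prepend p _).2] at h
      exact hqu (prepend_inj_of_length_eq hq h).1
  have hout : ∀ z, A.seqGraph.Reachable z w → z ∉ K → ∃ d ∈ D, A.seqGraph.AvoidReach K z d := by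
    intro z hz
    rw [SimpleGraph.reachable_iff_reflTransGen] at hz
    induction hz using Relation.ReflTransGen.head_induction_on with
    | refl => exact fun h => absurd rfl h
    | @head z z₂ h1 _ ih =>
      intro hzK
      by_cases hz2 : z₂ ∈ K
      · refine ⟨z, ⟨?_, hzK⟩, .refl _⟩
        obtain ⟨-, s, rfl⟩ := (seqGraph_adj hA.symmetric).1 h1.symm
        rw [seqShift_act_of_isTrivial (stateAt_isTrivial_of_noncritical hu s (hKu z₂ hz2))]
        exact seqShift_eq_of_le hz2 (by omega)
      · obtain ⟨d, hd, hzd⟩ := ih hz2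
        exact ⟨d, hd, (SimpleGraph.AvoidReach.of_adj h1 hzK hz2).trans hzd⟩
  have htrans : ∀ a b : MulAction.orbit A.group w, A.seqGraph.AvoidReach K a b →
      (A.schreierGraph w).AvoidReach F a b := by
    rintro ⟨a, ha⟩ ⟨b, hb⟩ h
    change A.seqGraph.AvoidReach K a b at h
    unfold SimpleGraph.AvoidReach at h
    induction h with
    | refl => exact .refl _
    | @tail b c h1 h2 ih =>
      have hb' : b ∈ MulAction.orbit A.group w := mem_orbit_of_adj hA.symmetric hb h2.1.symm
      refine (ih hb').trans (.of_adj (schreierGraph_adj.2 h2.1) (fun h => h2.2.1 (hFK _ h))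
        (fun h => h2.2.2 (hFK _ h)))
  have htail : ∀ r : GraphRay (A.schreierGraph w), ∃ N, ∀ i, N ≤ i → (r.toFun i).1 ∉ K := by
    intro r
    have hfin : {i | (r.toFun i).1 ∈ K}.Finite :=
      hKfin.preimage (f := fun i => (r.toFun i).1)
        (fun i _ j _ h => r.injective (Subtype.ext h))
    obtain ⟨N, hN⟩ := hfin.bddAbove
    exact ⟨N + 1, fun i hi h => by have := hN h; omega⟩
  obtain ⟨N, hN⟩ := htail r
  obtain ⟨N', hN'⟩ := htail r'
  refine ⟨max N N', fun i hi j hj => htrans _ _ ?_⟩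
  have hreach : ∀ v : MulAction.orbit A.group w, A.seqGraph.Reachable v w := fun v =>
    ((mem_orbit_iff hA.symmetric).1 v.2).symm
  obtain ⟨d, hd, h1⟩ := hout _ (hreach (r.toFun i)) (hN i (by omega))
  obtain ⟨d', hd', h2⟩ := hout _ (hreach (r'.toFun j)) (hN' j (by omega))
  exact h1.trans ((hDD d hd d' hd').trans h2.symm)

/-! ### States of automata in basic form -/

/-- A state with an incoming arrow is a restriction, hence finitary or circuit; finitary states are
excluded by `hs`. -/
theorem IsBasic.exists_loop (hA : A.IsTame) (hb : A.IsBasic) {s : S}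
    (hs : ¬ ∀ x, A.IsTrivial (A.next s x)) :
    ∃ a, A.next s a = s ∧ ∀ y, y ≠ a → ∀ z, A.IsTrivial (A.next (A.next s y) z) := by
  obtain ⟨t, x, rfl⟩ := hA.incoming s
  rcases hb.2.2 t x with h | h
  · exact absurd (hb.1 _ h) hs
  · obtain ⟨a, ha, h⟩ := hb.2.1 _ h
    exact ⟨a, ha, fun y hy => hb.1 _ (h y hy)⟩

/-- Once the loop is left, the state is finitary, so at most one further letter can be read before
it becomes trivial. -/
theorem IsBasic.exists_critical_form (hA : A.IsTame) (hb : A.IsBasic) (s : S) :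
    ∃ a, ∀ u y, ¬ A.IsTrivial (A.run s (u ++ [y])) → u = List.replicate u.length a := by
  by_cases hs : ∀ x, A.IsTrivial (A.next s x)
  · have hnt : ∀ u y, A.IsTrivial (A.run s (u ++ [y])) := by
      intro u y
      cases u with
      | nil => exact hs y
      | cons x u => exact (hs x).run (u ++ [y])
    -- The condition is empty here; the incoming arrow only supplies some letter.
    obtain ⟨t, a, -⟩ := hA.incoming s
    exact ⟨a, fun u y h => absurd (hnt u y) h⟩
  · obtain ⟨a, ha, hf⟩ := hb.exists_loop hA hs
    refine ⟨a, fun u y h => ?_⟩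
    induction u with
    | nil => rfl
    | cons x u ih =>
      by_cases hx : x = a
      · subst hx
        rw [List.cons_append, run_cons, ha] at h
        rw [List.length_cons, List.replicate_succ, ← ih h]
      · exfalso
        apply h
        rw [List.cons_append, run_cons]
        cases u with
        | nil => exact hf x hx y
        | cons z u => exact (hf x hx z).run (u ++ [y])

/-- A critical word is determined by the state that survives along it and by its last letter, so the
bound does not depend on the length. -/
theorem IsBasic.ncard_critical_le [Finite X] [Finite S] (hA : A.IsTame) (hb : A.IsBasic) (k : ℕ) :
    {u : List.Vector X (k + 1) | ¬ A.IsNoncritical u.toList}.ncard ≤ Nat.card (S × X) := by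
  choose a ha using hb.exists_critical_form hA
  refine le_trans (Set.ncard_le_ncard (t := Set.range fun p : S × X =>
    toVec (List.replicate k (a p.1) ++ [p.2]) (by simp)) ?_ (Set.finite_range _)) ?_
  · intro u hu
    simp only [Set.mem_ofPred_eq, IsNoncritical, not_forall] at hu
    obtain ⟨s, hs⟩ := hu
    have hne : u.toList ≠ [] := fun h => by have := u.toList_length; rw [h] at this; simp at this
    rw [← List.dropLast_append_getLast hne] at hs
    have h1 := ha s _ _ hs
    refine ⟨(s, u.toList.getLast hne), Subtype.ext ?_⟩
    change List.replicate k (a s) ++ [u.toList.getLast hne] = u.toList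
    conv_rhs => rw [← List.dropLast_append_getLast hne, h1]
    simp
  · rw [← Set.image_univ, ← Set.ncard_univ]
    exact Set.ncard_image_le (Set.toFinite _)

/-! ### Non-cut vertices of tile graphs -/

section NonCut

variable [Nonempty X] (hA : A.IsTame) (H : ∀ u, A.IsNoncritical u → ¬ A.IsNonCutWord u)
include hA

/-- The copy of the tile graph with the ending `q` is cut from the copy with the ending `u` by the
vertex `v u` of the latter. -/
def IsCutCopy (A : Transducer S X) (u v q : List X) : Prop :=
  q.length = u.length ∧ q ≠ u ∧ ∀ p p' : List X, p.length = v.length → p'.length = v.length →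
    p' ≠ v → ¬ A.wordGraph.AvoidReach {v ++ u} (p ++ q) (p' ++ u)

/-- The edge from `q` to `u` lifts to an edge between the two copies. It must end at the cutting
vertex, which is thereby determined by `q`. -/
theorem IsCutCopy.eq {u v v' q : List X} (hv : v.length = v'.length) (h : A.IsCutCopy u v q)
    (h' : A.IsCutCopy u v' q) (hadj : A.wordGraph.Adj q u) : v = v' := by
  obtain ⟨p, p', hp, hp', hpp⟩ := hA.exists_adj_append v.length hadj
  have key : ∀ v, v.length = p'.length → A.IsCutCopy u v q → p' = v := by
    intro v hv h
    by_contra hne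
    refine h.2.2 p p' (by omega) hv.symm hne (.of_adj hpp (fun h1 => ?_) (fun h1 => ?_))
    · exact h.2.1 (List.append_inj h1 (by omega)).2
    · exact hne (List.append_cancel_right h1)
  rw [← key v (by omega) h, ← key v' (by omega) h']

/-- A lifted edge joins the copies ending in `q` and `q'` away from the copy ending in `u`, so the
two are cut off together. -/
theorem IsCutCopy.of_adj {u v q q' : List X} (h : A.IsCutCopy u v q) (hadj : A.wordGraph.Adj q q')
    (hq' : q' ≠ u) : A.IsCutCopy u v q' := by
  have hl := length_eq_of_wordGraph_adj hadj
  have hF : ∀ q, q.length = u.length → q ≠ u → ∀ a : List X, a.length = v.length →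
      a ++ q ∉ ({v ++ u} : Set (List X)) := fun q _ hq a ha h1 => hq (List.append_inj h1 ha).2
  refine ⟨hl.symm.trans h.1, hq', fun p p' hp hp' hne hr => ?_⟩
  obtain ⟨p₁, p₂, h1, h2, h3⟩ := hA.exists_adj_append v.length hadj
  refine h.2.2 p₁ p' h1 hp' hne ?_
  refine (SimpleGraph.AvoidReach.of_adj h3 (hF q h.1 h.2.1 _ h1)
    (hF q' (hl.symm.trans h.1) hq' _ h2)).trans (.trans ?_ hr)
  exact hA.avoidReach_copy (h2.trans hp.symm) fun a ha =>
    hF q' (hl.symm.trans h.1) hq' a (ha.trans h2)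

include H in
-- Otherwise every copy reaches the copy ending in `u` without using `vu`, and that copy is
-- connected without `vu` since `v` is not a cut vertex. Then `vu` would be a noncritical non-cut
-- word, contrary to `H`.
theorem exists_isCutCopy {u v : List X} (hu : A.IsNoncritical u) (hv : A.IsNonCutWord v) :
    ∃ q, A.IsCutCopy u v q := by
  by_contra hno
  push Not at hno
  have hno' : ∀ q : List X, q.length = u.length → q ≠ u → ∃ p p' : List X, p.length = v.length ∧
      p'.length = v.length ∧ p' ≠ v ∧ A.wordGraph.AvoidReach {v ++ u} (p ++ q) (p' ++ u) := by
    intro q hq hqu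
    have := hno q
    unfold IsCutCopy at this
    push Not at this
    exact this hq hqu
  refine H (v ++ u) (fun s => by rw [run_append]; exact hu _) ?_
  have hreach : ∀ a : List X, a.length = (v ++ u).length → a ≠ v ++ u → ∃ p' : List X,
      p'.length = v.length ∧ p' ≠ v ∧ A.wordGraph.AvoidReach {v ++ u} a (p' ++ u) := by
    intro a ha hne
    rw [List.length_append] at ha
    have hl : (a.take v.length).length = v.length := by simp; omega
    have hl' : (a.drop v.length).length = u.length := by simp; omega
    rw [← List.take_append_drop v.length a] at hne ⊢
    by_cases hd : a.drop v.length = u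
    · rw [hd] at hne ⊢
      exact ⟨_, hl, fun h => hne (by rw [h]), .refl _⟩
    · obtain ⟨p, p', hp, hp', hne', hr⟩ := hno' _ hl' hd
      refine ⟨p', hp', hne', .trans ?_ hr⟩
      exact hA.avoidReach_copy (hl.trans hp.symm) fun b hb h1 =>
        hd (List.append_inj h1 (hb.trans hl)).2
  intro a b ha hb hav hbv
  obtain ⟨p, hp, hpv, h1⟩ := hreach a ha hav
  obtain ⟨p', hp', hpv', h2⟩ := hreach b hb hbv
  refine h1.trans (.trans ?_ h2.symm)
  exact (hv p p' hp hp' hpv hpv').map (fun a => a ++ u) (fun a b h => wordGraph_adj_append u h)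
    (fun a ha h => ha (List.append_cancel_right h))

include H in
-- Each non-cut vertex of level `n` cuts off some copy. Moving along `T` towards `u`, the last copy
-- before `u` is still cut off by `IsCutCopy.of_adj`, and by `IsCutCopy.eq` this assigns different
-- neighbours of `u` to different vertices.
theorem ncard_isNonCut_le_degree [Finite X] {k n : ℕ} {u : List.Vector X k}
    (hu : A.IsNoncritical u.toList) {T : SimpleGraph (List.Vector X k)}
    (hT : T ≤ A.finiteTileGraph k) (hTc : T.Connected) [Fintype (T.neighborSet u)] :
    {c | (A.finiteTileGraph n).IsNonCut c}.ncard ≤ T.degree u := by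
  classical
  have hex : ∀ c ∈ {c | (A.finiteTileGraph n).IsNonCut c}, ∃ q : List.Vector X k,
      T.Adj u q ∧ A.IsCutCopy u.toList c.toList q.toList := by
    intro c hc
    obtain ⟨q, hq⟩ := exists_isCutCopy hA H hu (isNonCutWord_of_isNonCut hc)
    have hql : q.length = k := by rw [hq.1, u.toList_length]
    have hr := hTc.preconnected (toVec q hql) u
    rw [← toList_toVec q hql] at hq
    rw [SimpleGraph.reachable_iff_reflTransGen] at hr
    generalize toVec q hql = q' at hq hr
    clear hql q
    induction hr using Relation.ReflTransGen.head_induction_on with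
    | refl => exact absurd rfl hq.2.1
    | @head q q₂ h1 _ ih =>
      by_cases h2 : q₂ = u
      · subst h2; exact ⟨q, h1.symm, hq⟩
      · exact ih (hq.of_adj hA (finiteTileGraph_adj.1 (hT h1)) fun h => h2 (Subtype.ext h))
  have : Nonempty (List.Vector X k) := ⟨u⟩
  choose! g hg using hex
  rw [← SimpleGraph.card_neighborFinset_eq_degree, ← Set.ncard_coe_finset]
  refine Set.ncard_le_ncard_of_injOn g (fun c hc => by simpa using (hg c hc).1) ?_ (Set.toFinite _)
  intro c hc c' hc' hcc
  have h1 := (hg c hc).2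
  have h2 := (hg c' hc').2
  rw [← hcc] at h2
  exact Subtype.ext (h1.eq hA (by simp) h2 (finiteTileGraph_adj.1 (hT (hg c hc).1).symm))

include H in
-- With three non-cut vertices on one level, all but a bounded number of vertices of arbitrarily
-- large trees would have degree at least 3, against average degree below 2.
theorem ncard_isNonCut_le_two [Finite X] [Nontrivial X] [Finite S] (hb : A.IsBasic) (n : ℕ) :
    {c | (A.finiteTileGraph n).IsNonCut c}.ncard ≤ 2 := by
  classical
  by_contra hcon
  push Not at hcon
  have := Fintype.ofFinite X
  set C := Nat.card (S × X) with hC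
  -- Counting degrees on level `k + 1` gives `3 V ≤ 2 V - 2 + 3 C`, which is impossible since the
  -- number `V` of words exceeds `k + 1`.
  let k := 3 * C
  obtain ⟨T, hT, hTree⟩ := (hA.connected (k + 1)).exists_isTree_le
  have hsum : ∑ v, T.degree v = 2 * Fintype.card (List.Vector X (k + 1)) - 2 := by
    rw [SimpleGraph.sum_degrees_eq_twice_card_edges]
    have := hTree.card_edgeFinset
    omega
  have hdeg : ∀ u : List.Vector X (k + 1), A.IsNoncritical u.toList → 3 ≤ T.degree u := fun u hu =>
    hcon.trans_le (ncard_isNonCut_le_degree hA H hu hT hTree.connected)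
  have hle : ∀ u ∈ Finset.univ, 3 ≤ T.degree u + if A.IsNoncritical u.toList then 0 else 3 := by
    intro u _
    split_ifs with h
    · exact hdeg u h
    · omega
  have h1 := Finset.sum_le_sum hle
  have h2 : ∑ u : List.Vector X (k + 1), (if A.IsNoncritical u.toList then 0 else 3) ≤ 3 * C := by
    have := hb.ncard_critical_le hA k
    rw [Finset.sum_ite, Finset.sum_const_zero, zero_add, Finset.sum_const, smul_eq_mul, mul_comm]
    refine Nat.mul_le_mul_left 3 (le_trans (le_of_eq ?_) this)
    rw [← Set.ncard_coe_finset]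
    congr 1
    ext u
    simp
  rw [Finset.sum_add_distrib, hsum, Finset.sum_const, Finset.card_univ, smul_eq_mul] at h1
  have h3 : k + 1 < Fintype.card (List.Vector X (k + 1)) := by
    rw [card_vector]
    exact (Nat.lt_two_pow_self).trans_le (Nat.pow_le_pow_left Fintype.one_lt_card _)
  omega

end NonCut

end Transducer

namespace Transducer

variable {S X : Type*} {A : Transducer S X}

/-! ### Automata whose tile graphs are paths -/

theorem nontrivial_vector [Nontrivial X] {m : ℕ} (hm : 0 < m) : Nontrivial (List.Vector X m) := by
  obtain ⟨x, y, hxy⟩ := exists_pair_ne X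
  refine ⟨toVec (List.replicate m x) (by simp), toVec (List.replicate m y) (by simp),
    fun h => hxy ?_⟩
  have : List.replicate m x = List.replicate m y := congrArg List.Vector.toList h
  exact List.replicate_right_injective hm.ne' this

/-- The word `v` has at most one neighbour in its tile graph. -/
def IsEndWord (A : Transducer S X) (v : List X) : Prop :=
  ∀ a b, A.wordGraph.Adj v a → A.wordGraph.Adj v b → a = b

/-- The tile graphs have at most two neighbours at every vertex, and exactly two ends. -/
structure TilesArePaths (A : Transducer S X) : Prop where
  adj : ∀ v : List X, v ≠ [] → ∃ a, A.wordGraph.Adj v a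
  degree : ∀ v a b c : List X, A.wordGraph.Adj v a → A.wordGraph.Adj v b →
    A.wordGraph.Adj v c → a = b ∨ a = c ∨ b = c
  ends : ∀ n, 0 < n → ∃ p q : List X, p.length = n ∧ q.length = n ∧ p ≠ q ∧
    ∀ v : List X, v.length = n → (A.IsEndWord v ↔ v = p ∨ v = q)

theorem IsTame.tilesArePaths [Finite X] [Nontrivial X] (hA : A.IsTame)
    (h : ∀ n, {c | (A.finiteTileGraph n).IsNonCut c}.ncard ≤ 2) : A.TilesArePaths := by
  have hnt : ∀ n, 0 < n → Nontrivial (List.Vector X n) := fun n hn => nontrivial_vector hn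
  have hfin : ∀ n, Finite (List.Vector X n) := fun n => by
    have := Fintype.ofFinite X; infer_instance
  have htv : ∀ (n : ℕ) (v : List.Vector X n) (a : List X), A.wordGraph.Adj v.toList a →
      ∃ a' : List.Vector X n, a'.toList = a ∧ (A.finiteTileGraph n).Adj v a' := by
    intro n v a h
    have := length_eq_of_wordGraph_adj h
    rw [v.toList_length] at this
    exact ⟨toVec a this.symm, rfl, finiteTileGraph_adj.2 h⟩
  have hnb : ∀ n, 0 < n → ∀ v : List.Vector X n, ∃ a, (A.finiteTileGraph n).Adj v a := by
    intro n hn v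
    have := hnt n hn
    exact (hA.connected n).preconnected.exists_adj_of_nontrivial v
  have key := fun n (hn : 0 < n) =>
    have := hnt n hn
    have := hfin n
    (hA.connected n).degrees_of_ncard_isNonCut_le_two (h n)
  have hpos : ∀ v : List X, v ≠ [] → 0 < v.length := fun v hv => List.length_pos_iff.2 hv
  refine ⟨fun v hv => ?_, fun v a b c ha hb hc => ?_, fun n hn => ?_⟩
  · obtain ⟨a, ha⟩ := hnb _ (hpos v hv) (toVec v rfl)
    exact ⟨a.toList, finiteTileGraph_adj.1 ha⟩
  · by_cases hv : v = []
    · subst hv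
      have h1 := length_eq_of_wordGraph_adj ha
      exact absurd (List.length_eq_zero_iff.1 h1.symm).symm ha.ne
    obtain ⟨a, rfl, ha'⟩ := htv _ (toVec v rfl) a ha
    obtain ⟨b, rfl, hb'⟩ := htv _ (toVec v rfl) b hb
    obtain ⟨c, rfl, hc'⟩ := htv _ (toVec v rfl) c hc
    rcases (key _ (hpos v hv)).1 _ _ _ _ ha' hb' hc' with rfl | rfl | rfl <;> simp
  · obtain ⟨p, q, hpq, hv⟩ := (key n hn).2
    refine ⟨p.toList, q.toList, p.toList_length, q.toList_length, fun h => hpq (Subtype.ext h),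
      fun v hvn => ?_⟩
    have h1 := hv (toVec v hvn)
    have h2 : ∀ p : List.Vector X n, toVec v hvn = p ↔ v = p.toList := fun p =>
      ⟨fun h => h ▸ rfl, fun h => Subtype.ext h⟩
    rw [h2, h2] at h1
    refine Iff.trans ⟨fun h a b ha hb => ?_, fun h a b ha hb => ?_⟩ h1
    · exact Subtype.ext (h _ _ (finiteTileGraph_adj.1 ha) (finiteTileGraph_adj.1 hb))
    · obtain ⟨a, rfl, ha'⟩ := htv _ (toVec v hvn) a ha
      obtain ⟨b, rfl, hb'⟩ := htv _ (toVec v hvn) b hb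
      rw [h a b ha' hb']

namespace TilesArePaths

theorem eq_or_eq (hP : A.TilesArePaths) {v v' u : List X} (hv : A.IsEndWord v)
    (hv' : A.IsEndWord v')
    (hu : A.IsEndWord u) (hne : v ≠ v') (hpos : v ≠ []) (h' : v'.length = v.length)
    (h : u.length = v.length) : u = v ∨ u = v' := by
  obtain ⟨p, q, -, -, -, hpq⟩ := hP.ends v.length (List.length_pos_iff.2 hpos)
  rw [hpq _ rfl] at hv
  rw [hpq _ h'] at hv'
  rw [hpq _ h] at hu
  rcases hv with rfl | rfl <;> rcases hv' with rfl | rfl <;> rcases hu with rfl | rfl <;> simp_all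

/-- Neighbours of `v` persist as neighbours of `v z` inside its copy. An edge to another copy uses
up one of the two places, so `v` has at most one neighbour. -/
theorem isEndWord_of_adj [Nonempty X] (hP : A.TilesArePaths) {v v' : List X} {z z' : X}
    (hz : z ≠ z') (h : A.wordGraph.Adj (v ++ [z]) (v' ++ [z'])) : A.IsEndWord v := by
  intro a b ha hb
  have hne : ∀ a, a ++ [z] ≠ v' ++ [z'] := fun a h => hz (by
    have := (List.append_inj' h rfl).2; simpa using this)
  rcases hP.degree _ _ _ _ (wordGraph_adj_append [z] ha) (wordGraph_adj_append [z] hb) h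
    with h1 | h1 | h1
  · exact List.append_cancel_right h1
  · exact absurd h1 (hne _)
  · exact absurd h1 (hne _)

/-- A nonempty `v` has a neighbour, so one of the at most two neighbours of `v z` is in its own copy
and at most one edge leads to other copies. -/
theorem eq_of_adj [Nonempty X] (hP : A.TilesArePaths) {v v' v'' : List X}
    {z z' z'' : X} (hv : v ≠ []) (hz : z ≠ z') (hz' : z ≠ z'')
    (h : A.wordGraph.Adj (v ++ [z]) (v' ++ [z'])) (h' : A.wordGraph.Adj (v ++ [z]) (v'' ++ [z''])) :
    v' = v'' ∧ z' = z'' := by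
  have hne : ∀ a v' z', z ≠ z' → a ++ [z] ≠ v' ++ [z'] := fun a v' z' hz h => hz (by
    have := (List.append_inj' h rfl).2; simpa using this)
  obtain ⟨a, ha⟩ := hP.adj v hv
  rcases hP.degree _ _ _ _ (wordGraph_adj_append [z] ha) h h' with h1 | h1 | h1
  · exact absurd h1 (hne _ _ _ hz)
  · exact absurd h1 (hne _ _ _ hz')
  · have := List.append_inj' h1 rfl
    exact ⟨this.1, by simpa using this.2⟩

theorem isEndWord_of_append [Nonempty X] {v u : List X} (h : A.IsEndWord (v ++ u)) :
    A.IsEndWord v :=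
  fun _ _ ha hb =>
    List.append_cancel_right (h _ _ (wordGraph_adj_append u ha) (wordGraph_adj_append u hb))

theorem not_adj_of_isEndWord [Nonempty X] (hP : A.TilesArePaths) {v v' : List X} {z z' : X}
    (hv : v ≠ []) (h : A.IsEndWord (v ++ [z]))
    (hz : z ≠ z') : ¬ A.wordGraph.Adj (v ++ [z]) (v' ++ [z']) := by
  intro h'
  obtain ⟨a, ha⟩ := hP.adj v hv
  have h1 := h _ _ (wordGraph_adj_append [z] ha) h'
  have := (List.append_inj' h1 rfl).2
  exact hz (by simpa using this)

end TilesArePaths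

end Transducer

namespace Transducer

variable {S X : Type*} {A : Transducer S X}

/-! ### Loops of automata whose tile graphs are paths -/

/-- An edge of a larger tile graph whose ends have different last letters. -/
theorem wordGraph_adj_concat (hA : A.IsSymmetric) {s : S} {v : List X} {z : X}
    (hz : A.out (A.run s v) z ≠ z) (ht : A.IsTrivial (A.next (A.run s v) z)) :
    A.wordGraph.Adj (v ++ [z]) (A.actWord s v ++ [A.out (A.run s v) z]) := by
  have : Nonempty X := ⟨z⟩
  refine (wordGraph_adj hA).2 ⟨fun h => hz ?_, s, by rw [actWord_append]; rfl,
    by rw [run_append]; exact ht⟩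
  have := (List.append_inj' h rfl).2
  simpa [eq_comm] using this

theorem exists_state_of_adj_concat (hA : A.IsSymmetric) {v v' : List X} {z z' : X}
    (h : A.wordGraph.Adj (v ++ [z]) (v' ++ [z'])) : ∃ s, A.actWord s v = v' ∧
      A.out (A.run s v) z = z' ∧ A.IsTrivial (A.next (A.run s v) z) := by
  have : Nonempty X := ⟨z⟩
  obtain ⟨-, s, h1, h2⟩ := (wordGraph_adj hA).1 h
  rw [actWord_append] at h1
  rw [run_append] at h2
  have h3 := List.append_inj' h1 rfl
  exact ⟨s, h3.1, by simpa using h3.2, h2⟩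

theorem exists_out_ne {s : S} (hs : ¬ A.IsTrivial s) (hn : ∀ x, A.IsTrivial (A.next s x)) :
    ∃ y, A.out s y ≠ y := by
  by_contra h
  push Not at h
  exact hs (isTrivial_of_next fun x => ⟨h x, hn x⟩)

theorem next_eq_self_or_isTrivial (hA : A.IsTame) (hb : A.IsBasic) (s : S) :
    (∀ x, A.IsTrivial (A.next s x)) ∨ ∃ a, A.next s a = s ∧ ¬ A.IsTrivial s ∧
      ∀ y, y ≠ a → ∀ z, A.IsTrivial (A.next (A.next s y) z) := by
  by_cases h : ∀ x, A.IsTrivial (A.next s x)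
  · exact .inl h
  · obtain ⟨a, ha, h'⟩ := hb.exists_loop hA h
    exact .inr ⟨a, ha, fun hs => h fun x => hs.next x, h'⟩

theorem loop_unique {s : S} {a a' : X} (hs : ¬ A.IsTrivial s) (ha : A.next s a = s)
    (h : ∀ y, y ≠ a → ∀ z, A.IsTrivial (A.next (A.next s y) z)) (ha' : A.next s a' = s) :
    a' = a := by
  by_contra hne
  have := h a' hne a
  rw [ha', ha] at this
  exact hs this

section Loops

variable [Nontrivial X] (hA : A.IsTame) (hb : A.IsBasic) (hP : A.TilesArePaths)
  {s : S} {a : X} (ha : A.next s a = s)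
include hA hP ha

theorem isEndWord_of_move {z : X} (hz : A.IsTrivial (A.next s z)) (hm : A.out s z ≠ z) (n : ℕ) :
    A.wordGraph.Adj (List.replicate n a ++ [z]) (List.replicate n (A.out s a) ++ [A.out s z]) ∧
    A.IsEndWord (List.replicate n a) ∧ A.IsEndWord (List.replicate n (A.out s a)) := by
  have h := wordGraph_adj_concat hA.symmetric (s := s) (v := List.replicate n a) (z := z)
    (by rwa [run_replicate ha]) (by rwa [run_replicate ha])
  rw [actWord_replicate ha rfl, run_replicate ha] at h
  exact ⟨h, hP.isEndWord_of_adj hm.symm h, hP.isEndWord_of_adj hm h.symm⟩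

include hb in
-- The restriction at `z` is nontrivial with trivial restrictions, so it moves some letter `y`. The
-- resulting edge at `a^n z y` changes the last letter, and `isEndWord_of_adj` applies.
theorem isEndWord_of_section {z : X} (hza : z ≠ a) (hz : ¬ A.IsTrivial (A.next s z)) (n : ℕ) :
    A.IsEndWord (List.replicate n a ++ [z]) ∧
    A.IsEndWord (List.replicate n (A.out s a) ++ [A.out s z]) := by
  have hnt : ¬ A.IsTrivial s := fun h => hz (h.next z)
  have hf : ∀ y, A.IsTrivial (A.next (A.next s z) y) := by
    rcases next_eq_self_or_isTrivial hA hb s with h | ⟨a', ha', -, h⟩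
    · exact absurd (h z) hz
    · refine h z ?_
      rwa [← loop_unique hnt ha' h ha]
  obtain ⟨y, hy⟩ := exists_out_ne hz hf
  have hrun : A.run s (List.replicate n a ++ [z]) = A.next s z := by
    rw [run_append, run_replicate ha]; rfl
  have h := wordGraph_adj_concat hA.symmetric (s := s) (v := List.replicate n a ++ [z]) (z := y)
    (by rwa [hrun]) (by rw [hrun]; exact hf y)
  rw [hrun, actWord_append, actWord_replicate ha rfl, run_replicate ha] at h
  exact ⟨hP.isEndWord_of_adj hy.symm h, hP.isEndWord_of_adj hy h.symm⟩

omit [Nontrivial X] hA hP in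
-- Otherwise `s` fixes all letters other than `a`, hence also `a` by injectivity, and a state with
-- only this loop and trivial restrictions elsewhere is trivial.
theorem exists_move_or_section (hs : ¬ A.IsTrivial s) (hinv : A.IsInvertible) :
    (∃ z, z ≠ a ∧ A.IsTrivial (A.next s z) ∧ A.out s z ≠ z) ∨
      ∃ z, z ≠ a ∧ ¬ A.IsTrivial (A.next s z) := by
  by_contra h
  push Not at h
  refine hs (isTrivial_of_loop fun x => ?_)
  have h1 : ∀ x, x ≠ a → A.out s x = x := fun x hx => h.1 x hx (h.2 x hx)
  by_cases hx : x = a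
  · subst hx
    refine ⟨?_, .inl ha⟩
    by_contra hne
    exact hne ((hinv s).1 (h1 _ hne))
  · exact ⟨h1 x hx, .inr (h.2 x hx)⟩

/-! ### The adding machine -/

include hb in
-- A nontrivial restriction would make `a z`, its image and `a a` three different ends of the second
-- level.
theorem isTrivial_next_of_loop_out_ne (hne : A.out s a ≠ a) {z : X} (hz : z ≠ a) :
    A.IsTrivial (A.next s z) := by
  by_contra hnt
  have h1 := isEndWord_of_section hA hb hP ha hz hnt 1
  have h2 := isEndWord_of_section hA hb hP ha hz hnt 2
  have h3 : A.IsEndWord [a, a] :=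
    TilesArePaths.isEndWord_of_append (v := [a, a]) (u := [z]) h2.1
  rcases hP.eq_or_eq h1.1 h1.2 h3 (by simp [hne.symm]) (by simp) (by simp) (by simp) with h | h
  · exact hz (by simpa using h.symm)
  · simp only [List.replicate, List.cons_append, List.nil_append, List.cons.injEq] at h
    exact hne h.1.symm

include hb in
theorem isEndWord_of_loop_out_ne (hne : A.out s a ≠ a) (n : ℕ) :
    A.IsEndWord (List.replicate n a) ∧ A.IsEndWord (List.replicate n (A.out s a)) := by
  have hs : ¬ A.IsTrivial s := fun h => hne (h.out a)
  rcases exists_move_or_section ha hs hA.invertible with ⟨z, -, hz, hm⟩ | ⟨z, hz, hnt⟩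
  · exact (isEndWord_of_move hA hP ha hz hm n).2
  · exact absurd (isTrivial_next_of_loop_out_ne hA hb hP ha hne hz) hnt

end Loops

theorem AreInverse.loop (hA : A.IsMinimal) {s t : S} (h : A.AreInverse s t) {a : X}
    (ha : A.next s a = s) : A.next t (A.out s a) = t := by
  have := h.next a
  rw [ha] at this
  exact this.eq hA h

section AddingMachine

variable [Nontrivial X] (hA : A.IsTame) (hb : A.IsBasic) (hP : A.TilesArePaths)
  {s : S} {a : X} (ha : A.next s a = s) (hne : A.out s a ≠ a)
include hA hb hP ha hne

/-- When some loop changes its letter, every nontrivial state has a loop at one of the two end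
letters, with trivial other restrictions. -/
theorem exists_loop_of_loop_out_ne {t : S} (ht : ¬ A.IsTrivial t) :
    ∃ c, A.next t c = t ∧ (c = a ∨ c = A.out s a) ∧ ∃ z, z ≠ c ∧ A.out t z ≠ z ∧
      A.IsTrivial (A.next t z) := by
  have hends := isEndWord_of_loop_out_ne hA hb hP ha hne
  -- The ends of the second level repeat a letter, whereas a nontrivial restriction would make `c z`
  -- with `z ≠ c` an end.
  have hnosec : ∀ t c z, A.next t c = t → z ≠ c → A.IsTrivial (A.next t z) := by
    intro t c z hc hz
    by_contra hnt
    have h1 := (isEndWord_of_section hA hb hP hc hz hnt 1).1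
    rcases hP.eq_or_eq (hends 2).1 (hends 2).2 h1 (by simp [List.replicate, hne.symm]) (by simp)
      (by simp) (by simp) with h | h
    · simp [List.replicate] at h
      exact hz (h.2.trans h.1.symm)
    · simp [List.replicate] at h
      exact hz (h.2.trans h.1.symm)
  have hloop : ∃ c, A.next t c = t := by
    obtain ⟨r, x, rfl⟩ := hA.incoming t
    rcases next_eq_self_or_isTrivial hA hb r with h | ⟨c, hc, -, -⟩
    · exact absurd (h x) ht
    · by_cases hx : x = c
      · exact ⟨c, by rw [hx, hc, hc]⟩
      · exact absurd (hnosec r c x hc hx) ht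
  obtain ⟨c, hc⟩ := hloop
  rcases exists_move_or_section hc ht hA.invertible with ⟨z, hzc, hz, hm⟩ | ⟨z, hz, hnt⟩
  · refine ⟨c, hc, ?_, z, hzc, hm, hz⟩
    have h1 := (isEndWord_of_move hA hP hc hz hm 1).2.1
    rcases hP.eq_or_eq (hends 1).1 (hends 1).2 h1 (by simp [hne.symm]) (by simp)
      (by simp) (by simp) with h | h
    · left; simpa using h
    · right; simpa using h
  · exact absurd (hnosec t c z hc hz) hnt

theorem adj_of_loop_out_ne {z : X} (hz : z ≠ a) (hm : A.out s z ≠ z) :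
    A.wordGraph.Adj [a, z] [A.out s a, A.out s z] :=
  (isEndWord_of_move hA hP ha (isTrivial_next_of_loop_out_ne hA hb hP ha hne hz) hm 1).1

/-- Every state moving a letter loops at `a` or at its image under `s`. Only one edge leaves the
copy at a given word, so such a state moves a letter of the orbit of `a` as `s` or its inverse does.
This orbit is therefore closed under edges of the connected first tile graph. -/
theorem letterOrbit_of_loop_out_ne [Finite X] (z : X) : A.letterOrbit s z = Set.univ := by
  have hinj : Function.Injective (A.out s) := (hA.invertible s).1
  obtain ⟨t, hst⟩ := hA.symmetric s
  obtain ⟨p, hp, hpa⟩ : ∃ p, 0 < p ∧ (A.out s)^[p] a = a := hinj.mem_periodicPts a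
  have hback : ∀ y, A.out s y ∈ A.letterOrbit s a → y ∈ A.letterOrbit s a := by
    rintro y ⟨k, hk⟩
    rcases k with _ | k
    · refine ⟨p - 1, hinj ?_⟩
      rw [← Function.iterate_succ_apply' (A.out s), Nat.succ_eq_add_one, Nat.sub_add_cancel hp, hpa]
      exact hk
    · exact ⟨k, hinj (by rw [← hk, Function.iterate_succ_apply'])⟩
  have hmove : ∀ y ∈ A.letterOrbit s a, A.out s y ≠ y := by
    rintro _ ⟨k, rfl⟩ h
    rw [← Function.iterate_succ_apply' (A.out s), Function.iterate_succ_apply] at h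
    exact hne (hinj.iterate k h)
  have hts : ∀ y, A.out s (A.out t y) = y := hst.symm.out
  have hclosed : ∀ y ∈ A.letterOrbit s a, ∀ y', A.wordGraph.Adj [y] [y'] →
      y' ∈ A.letterOrbit s a := by
    intro y hy y' hadj
    obtain ⟨r, -, hr, hrt⟩ := exists_state_of_adj_concat hA.symmetric (v := []) (v' := []) hadj
    change A.out r y = y' at hr
    change A.IsTrivial (A.next r y) at hrt
    have hyy : y ≠ y' := fun h => hadj.ne (by rw [h])
    have hrnt : ¬ A.IsTrivial r := fun h => hyy ((h.out y).symm.trans hr)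
    obtain ⟨c, hc, hca, -⟩ := exists_loop_of_loop_out_ne hA hb hP ha hne hrnt
    have hyc : y ≠ c := by
      rintro rfl
      rw [hc] at hrt
      exact hrnt hrt
    have hr1 := (isEndWord_of_move hA hP hc hrt (by rw [hr]; exact hyy.symm) 1).1
    rw [hr] at hr1
    rcases hca with rfl | rfl
    · have h1 := adj_of_loop_out_ne hA hb hP ha hne hyc (hmove y hy)
      have h2 := (hP.eq_of_adj (v := [c]) (v' := [A.out r c]) (v'' := [A.out s c]) (by simp) hyy
        (hmove y hy).symm hr1 h1).2
      rw [h2]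
      exact out_mem_letterOrbit hy
    · have hty : A.out t y ∈ A.letterOrbit s a := hback _ (by rwa [hts])
      have hta : A.out t y ≠ a := by
        intro h
        apply hyc
        rw [← h, hts]
      have hyt : y ≠ A.out t y := fun h => by
        apply hmove _ hty
        rw [hts]; exact h
      have h1 := (adj_of_loop_out_ne hA hb hP ha hne hta (hmove _ hty)).symm
      rw [hts] at h1
      have h2 := (hP.eq_of_adj (v := [A.out s a]) (v' := [A.out r (A.out s a)]) (v'' := [a])
        (by simp) hyy hyt hr1 h1).2
      rwa [h2]
  have huniv : ∀ y, y ∈ A.letterOrbit s a := by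
    intro y
    have h := hA.wordGraph_reachable (v := [a]) (u := [y]) rfl
    have := h.closed (s := {v | ∃ z ∈ A.letterOrbit s a, v = [z]}) ?_
      ⟨a, mem_letterOrbit_self s a, rfl⟩
    · obtain ⟨z, hz, h⟩ := this
      obtain rfl : y = z := by simpa using h
      exact hz
    · rintro _ ⟨z, hz, rfl⟩ v hv
      obtain ⟨z', rfl⟩ := List.length_eq_one_iff.1 (length_eq_of_wordGraph_adj hv).symm
      exact ⟨z', hclosed z hz z' hv, rfl⟩
  obtain ⟨k, hk⟩ := huniv z
  have hza : a ∈ A.letterOrbit s z := by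
    have h1 : ∀ j, (A.out s)^[j * p] a = a := by
      intro j
      induction j with
      | zero => simp
      | succ j ih => rw [add_mul, one_mul, Function.iterate_add_apply, hpa, ih]
    refine ⟨k * p - k, ?_⟩
    rw [← hk, ← Function.iterate_add_apply, Nat.sub_add_cancel (Nat.le_mul_of_pos_right k hp), h1]
  refine Set.eq_univ_of_forall fun y => ?_
  have := letterOrbit_subset hza (fun y hy => out_mem_letterOrbit hy)
  exact this (huniv y)

theorem out_ne_of_loop_out_ne [Finite X] (z : X) : A.out s z ≠ z := by
  intro h
  have h1 := letterOrbit_of_loop_out_ne hA hb hP ha hne z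
  have h2 : A.letterOrbit s z ⊆ {z} := letterOrbit_subset rfl (by rintro _ rfl; exact h)
  obtain ⟨y, hy⟩ := exists_ne z
  exact hy (h2 (h1 ▸ Set.mem_univ y))

/-- A nontrivial state with a loop at the same letter is the same state. -/
theorem eq_of_loop_out_ne [Finite X] {t : S} (hta : A.next t a = t)
    (hz : ∃ z, z ≠ a ∧ A.out t z ≠ z ∧ A.IsTrivial (A.next t z)) : t = s := by
  have hmove := out_ne_of_loop_out_ne hA hb hP ha hne
  -- Both states give an edge leaving the copy at the word `a z`, and there is only one such edge.
  have hout : A.out t a = A.out s a := by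
    obtain ⟨z, hza, hz, hzt⟩ := hz
    have h1 := (isEndWord_of_move hA hP hta hzt hz 1).1
    have h2 := adj_of_loop_out_ne hA hb hP ha hne hza (hmove z)
    simpa using (hP.eq_of_adj (v := [a]) (v' := [A.out t a]) (v'' := [A.out s a]) (by simp)
      hz.symm (hmove z).symm h1 h2).1
  have hne' : A.out t a ≠ a := by rwa [hout]
  have hmove' := out_ne_of_loop_out_ne hA hb hP hta hne'
  have houts : ∀ z, A.out t z = A.out s z := by
    intro z
    by_cases hza : z = a
    · rw [hza, hout]
    · exact (hP.eq_of_adj (v := [a]) (v' := [A.out t a]) (v'' := [A.out s a]) (by simp)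
        (hmove' z).symm (hmove z).symm (adj_of_loop_out_ne hA hb hP hta hne' hza (hmove' z))
        (adj_of_loop_out_ne hA hb hP ha hne hza (hmove z))).2
  refine hA.minimal _ _ (funext fun w => funext fun n => ?_)
  have hst : ∀ n, (A.stateAt t w n = t ∧ A.stateAt s w n = s) ∨
      (A.IsTrivial (A.stateAt t w n) ∧ A.IsTrivial (A.stateAt s w n)) := by
    intro n
    induction n with
    | zero => exact .inl ⟨rfl, rfl⟩
    | succ n ih =>
      change (A.next (A.stateAt t w n) (w n) = t ∧ A.next (A.stateAt s w n) (w n) = s) ∨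
        (A.IsTrivial (A.next (A.stateAt t w n) (w n)) ∧
          A.IsTrivial (A.next (A.stateAt s w n) (w n)))
      rcases ih with ⟨h1, h2⟩ | ⟨h1, h2⟩
      · rw [h1, h2]
        by_cases hza : w n = a
        · rw [hza]; exact .inl ⟨hta, ha⟩
        · exact .inr ⟨isTrivial_next_of_loop_out_ne hA hb hP hta hne' hza,
            isTrivial_next_of_loop_out_ne hA hb hP ha hne hza⟩
      · exact .inr ⟨h1.next _, h2.next _⟩
  change A.out (A.stateAt t w n) (w n) = A.out (A.stateAt s w n) (w n)
  rcases hst n with ⟨h1, h2⟩ | ⟨h1, h2⟩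
  · rw [h1, h2, houts]
  · rw [h1.out, h2.out]

theorem isAddingMachine_of_loop_out_ne [Finite X] : A.IsAddingMachine := by
  obtain ⟨t, hst⟩ := hA.symmetric s
  have ht : A.next t (A.out s a) = t := hst.loop hA.minimal ha
  have hto : A.out t (A.out s a) = a := hst.out a
  refine ⟨a, A.out s a, s, t, hne.symm, ⟨rfl, ha, fun z hz =>
    isTrivial_next_of_loop_out_ne hA hb hP ha hne hz⟩, letterOrbit_of_loop_out_ne hA hb hP ha hne,
    hst, fun r => ?_⟩
  by_cases hr : A.IsTrivial r
  · exact .inr (.inr hr)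
  obtain ⟨c, hc, hca, z, hz1, hz2, hz3⟩ := exists_loop_of_loop_out_ne hA hb hP ha hne hr
  rcases hca with rfl | rfl
  · exact .inl (eq_of_loop_out_ne hA hb hP ha hne hc ⟨z, hz1, hz2, hz3⟩)
  · exact .inr (.inl (eq_of_loop_out_ne hA hb hP ht (by rw [hto]; exact hne.symm) hc
      ⟨z, hz1, hz2, hz3⟩))

end AddingMachine

end Transducer

/-- Two symmetric matchings whose union is a path alternate along the path. -/
theorem pairRel_of_path {X : Type*} {n : ℕ} {e : Fin (n + 1) ≃ X} {R Q : X → X → Prop}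
    (hRs : ∀ z z', R z z' → R z' z) (hQs : ∀ z z', Q z z' → Q z' z)
    (hRf : ∀ z a b, R z a → R z b → a = b) (hQf : ∀ z a b, Q z a → Q z b → a = b)
    (hRQ : ∀ i j, (R (e i) (e j) ∨ Q (e i) (e j)) ↔ (j : ℕ) = i + 1 ∨ (i : ℕ) = j + 1)
    (h0 : ∀ z, ¬ R (e 0) z) :
    (∀ z z', PairRel e Odd z z' ↔ R z z') ∧ ∀ z z', PairRel e Even z z' ↔ Q z z' := by
  -- The first edge belongs to `Q`, since `R` misses the first vertex; afterwards two consecutive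
  -- edges cannot belong to the same matching.
  have key : ∀ i : ℕ, ∀ hi : i + 1 < n + 1,
      (Even i → Q (e ⟨i, by omega⟩) (e ⟨i + 1, hi⟩) ∧ ¬ R (e ⟨i, by omega⟩) (e ⟨i + 1, hi⟩)) ∧
      (Odd i → R (e ⟨i, by omega⟩) (e ⟨i + 1, hi⟩) ∧ ¬ Q (e ⟨i, by omega⟩) (e ⟨i + 1, hi⟩)) := by
    intro i
    induction i with
    | zero =>
      intro hi
      refine ⟨fun _ => ?_, fun h => by simp at h⟩
      have h1 := h0 (e ⟨0 + 1, hi⟩)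
      exact ⟨((hRQ 0 ⟨0 + 1, hi⟩).2 (.inl rfl)).resolve_left h1, h1⟩
    | succ i ih =>
      intro hi
      have h1 := (hRQ ⟨i + 1, by omega⟩ ⟨i + 1 + 1, hi⟩).2 (.inl rfl)
      have hne : e ⟨i, by omega⟩ ≠ e ⟨i + 1 + 1, hi⟩ :=
        e.injective.ne (by rw [Ne, Fin.mk.injEq]; omega)
      obtain ⟨he, ho⟩ := ih (by omega)
      constructor
      · intro h
        have h2 := (ho (by grind)).1
        have h3 : ¬ R (e ⟨i + 1, by omega⟩) (e ⟨i + 1 + 1, hi⟩) :=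
          fun h => hne (hRf _ _ _ (hRs _ _ h2) h)
        exact ⟨h1.resolve_left h3, h3⟩
      · intro h
        have h2 := (he (by grind)).1
        have h3 : ¬ Q (e ⟨i + 1, by omega⟩) (e ⟨i + 1 + 1, hi⟩) :=
          fun h => hne (hQf _ _ _ (hQs _ _ h2) h)
        exact ⟨h1.resolve_right h3, h3⟩
  have hR : ∀ i j : Fin (n + 1), (j : ℕ) = i + 1 → (R (e i) (e j) ↔ Odd (i : ℕ)) := by
    rintro ⟨i, hi⟩ ⟨j, hj⟩ rfl
    rcases Nat.even_or_odd i with h | h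
    · exact iff_of_false ((key i hj).1 h).2 (by simpa using h)
    · exact iff_of_true ((key i hj).2 h).1 h
  have hQ : ∀ i j : Fin (n + 1), (j : ℕ) = i + 1 → (Q (e i) (e j) ↔ Even (i : ℕ)) := by
    rintro ⟨i, hi⟩ ⟨j, hj⟩ rfl
    rcases Nat.even_or_odd i with h | h
    · exact iff_of_true ((key i hj).1 h).1 h
    · exact iff_of_false ((key i hj).2 h).2 (by simpa using h)
  constructor
  · intro z z'
    obtain ⟨i, rfl⟩ := e.surjective z
    obtain ⟨j, rfl⟩ := e.surjective z'
    rw [PairRel.iff_index]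
    constructor
    · rintro (⟨h, h'⟩ | ⟨h, h'⟩)
      · exact (hR i j h').2 h
      · exact hRs _ _ ((hR j i h').2 h)
    · intro h
      rcases (hRQ i j).1 (.inl h) with h' | h'
      · exact .inl ⟨(hR i j h').1 h, h'⟩
      · exact .inr ⟨(hR j i h').1 (hRs _ _ h), h'⟩
  · intro z z'
    obtain ⟨i, rfl⟩ := e.surjective z
    obtain ⟨j, rfl⟩ := e.surjective z'
    rw [PairRel.iff_index]
    constructor
    · rintro (⟨h, h'⟩ | ⟨h, h'⟩)
      · exact (hQ i j h').2 h
      · exact hQs _ _ ((hQ j i h').2 h)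
    · intro h
      rcases (hRQ i j).1 (.inr h) with h' | h'
      · exact .inl ⟨(hQ i j h').1 h, h'⟩
      · exact .inr ⟨(hQ j i h').1 (hQs _ _ h), h'⟩

theorem PairRel.not_of_last {X : Type*} {n : ℕ} {e : Fin (n + 1) ≃ X} {p : ℕ → Prop} (hn : 0 < n)
    (h : ∀ z, ¬ PairRel e p (e (Fin.last n)) z) : ¬ p (n - 1) := fun hp => by
  obtain ⟨z, hz⟩ := (PairRel.exists_iff (e := e) (p := p) (Fin.last n)).2 (.inr ⟨hn, hp⟩)
  exact h z hz

namespace Transducer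

variable {S X : Type*} {A : Transducer S X}

/-! ### The two kinds of paired automata -/

/-- The words `a z` and `a z'` are different and joined by an edge of the tile graph. -/
def EdgeAt (A : Transducer S X) (a z z' : X) : Prop := z ≠ z' ∧ A.wordGraph.Adj [a, z] [a, z']

theorem EdgeAt.symm {a z z' : X} (h : A.EdgeAt a z z') : A.EdgeAt a z' z :=
  ⟨h.1.symm, h.2.symm⟩

theorem EdgeAt.eq [Nonempty X] (hP : A.TilesArePaths) {a z z₁ z₂ : X} (h₁ : A.EdgeAt a z z₁)
    (h₂ : A.EdgeAt a z z₂) : z₁ = z₂ :=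
  (hP.eq_of_adj (v := [a]) (v' := [a]) (v'' := [a]) (by simp) h₁.1 h₂.1 h₁.2 h₂.2).2

theorem edgeAt_iff (hA : A.IsTame) {a z z' : X} : A.EdgeAt a z z' ↔
    z ≠ z' ∧ ∃ s, A.out s a = a ∧ A.out (A.next s a) z = z' ∧
      A.IsTrivial (A.next (A.next s a) z) := by
  constructor
  · rintro ⟨hne, h⟩
    obtain ⟨s, h1, h2, h3⟩ := exists_state_of_adj_concat hA.symmetric (v := [a]) (v' := [a]) h
    exact ⟨hne, s, by simpa [actWord] using h1, h2, h3⟩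
  · rintro ⟨hne, s, h1, rfl, h3⟩
    have := wordGraph_adj_concat hA.symmetric (s := s) (v := [a]) (z := z) hne.symm h3
    refine ⟨hne, ?_⟩
    simpa [actWord, h1, run] using this

theorem wordGraph_adj_singleton (hA : A.IsTame) {z z' : X} : A.wordGraph.Adj [z] [z'] ↔
    z ≠ z' ∧ ∃ s, A.out s z = z' ∧ A.IsTrivial (A.next s z) := by
  constructor
  · intro h
    obtain ⟨s, -, h2, h3⟩ := exists_state_of_adj_concat hA.symmetric (v := []) (v' := []) h
    exact ⟨fun h' => h.ne (by rw [h']), s, h2, h3⟩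
  · rintro ⟨hne, s, rfl, h3⟩
    exact wordGraph_adj_concat hA.symmetric (s := s) (v := []) (z := z) hne.symm h3

theorem exists_letter_enumeration [Finite X] (hA : A.IsTame) (hP : A.TilesArePaths) {x y : X}
    (hxy : x ≠ y) (hx : A.IsEndWord [x]) (hy : A.IsEndWord [y]) :
    ∃ (n : ℕ) (e : Fin (n + 1) ≃ X), 0 < n ∧ e 0 = x ∧ e (Fin.last n) = y ∧
      ∀ i j, A.wordGraph.Adj [e i] [e j] ↔ (j : ℕ) = i + 1 ∨ (i : ℕ) = j + 1 := by
  have : Nonempty X := ⟨x⟩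
  let G : SimpleGraph X := A.wordGraph.comap fun z => [z]
  have hG : G.Connected := by
    refine ⟨fun a b => ?_⟩
    have h := hA.wordGraph_reachable (v := [a]) (u := [b]) rfl
    have := h.closed (s := {v | ∃ z, G.Reachable a z ∧ v = [z]}) ?_ ⟨a, .rfl, rfl⟩
    · obtain ⟨z, hz, h⟩ := this
      obtain rfl : b = z := by simpa using h
      exact hz
    · rintro _ ⟨z, hz, rfl⟩ v hv
      obtain ⟨z', rfl⟩ := List.length_eq_one_iff.1 (length_eq_of_wordGraph_adj hv).symm
      exact ⟨z', hz.trans (SimpleGraph.Adj.reachable hv), rfl⟩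
  obtain ⟨n, e, h1, h2, h3⟩ := SimpleGraph.exists_path_enumeration hG hxy
    (fun v a b c ha hb hc => by simpa using hP.degree _ _ _ _ ha hb hc)
    (fun a b ha hb => by simpa using hx _ _ ha hb) (fun a b ha hb => by simpa using hy _ _ ha hb)
  refine ⟨n, e, Nat.pos_of_ne_zero ?_, h1, h2, h3⟩
  rintro rfl
  exact hxy (h1.symm.trans h2)

section Paired

variable [Finite X] [Nontrivial X] (hA : A.IsTame) (hb : A.IsBasic) (hP : A.TilesArePaths)
  (hfix : ∀ s a, A.next s a = s → A.out s a = a)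
include hA hb hP hfix

/-- Every nontrivial state has a loop, hence is of type II with respect to an end letter. The edges
of the first level split into those of the states looping at `x` and at `y`, two matchings visible
on the second level as `EdgeAt`. States looping at a letter fix it, which starts the alternation at
`x` and gives the parity at `y`. -/
theorem exists_isPairedII
    (hsec : ∀ s a, A.next s a = s → ∀ z, z ≠ a → A.IsTrivial (A.next s z)) :
    ∃ (n : ℕ) (e : Fin (n + 1) ≃ X), A.IsPairedII e := by
  have hII : ∀ s, ¬ A.IsTrivial s → ∃ a, A.IsTypeII a s ∧ A.IsEndWord [a] := by
    intro t ht
    obtain ⟨c, hc⟩ : ∃ c, A.next t c = t := by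
      obtain ⟨r, x, rfl⟩ := hA.incoming t
      rcases next_eq_self_or_isTrivial hA hb r with h | ⟨c, hc, -, -⟩
      · exact absurd (h x) ht
      · by_cases hx : x = c
        · exact ⟨c, by rw [hx, hc, hc]⟩
        · exact absurd (hsec r c hc x hx) ht
    refine ⟨c, ⟨ht, hfix t c hc, hc, hsec t c hc⟩, ?_⟩
    rcases exists_move_or_section hc ht hA.invertible with ⟨z, -, hz, hm⟩ | ⟨z, hz, hnt⟩
    · exact (isEndWord_of_move hA hP hc hz hm 1).2.1
    · exact absurd (hsec t c hc z hz) hnt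
  obtain ⟨p, q, hp, hq, hpq, hends⟩ := hP.ends 1 one_pos
  obtain ⟨x, rfl⟩ := List.length_eq_one_iff.1 hp
  obtain ⟨y, rfl⟩ := List.length_eq_one_iff.1 hq
  have hxy : x ≠ y := fun h => hpq (by rw [h])
  have hx : A.IsEndWord [x] := (hends _ rfl).2 (.inl rfl)
  have hy : A.IsEndWord [y] := (hends _ rfl).2 (.inr rfl)
  have hall : ∀ s, A.IsTrivial s ∨ A.IsTypeII x s ∨ A.IsTypeII y s := by
    intro s
    by_cases hs : A.IsTrivial s
    · exact .inl hs
    · obtain ⟨a, h, ha⟩ := hII s hs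
      rcases (hends _ rfl).1 ha with h' | h' <;> simp only [List.cons.injEq, and_true] at h' <;>
        subst h'
      · exact .inr (.inl h)
      · exact .inr (.inr h)
  have hedge : ∀ a z z', A.EdgeAt a z z' ↔ z ≠ z' ∧ ∃ s, A.IsTypeII a s ∧ A.out s z = z' := by
    intro a z z'
    rw [edgeAt_iff hA]
    refine and_congr_right fun hne => ⟨?_, ?_⟩
    · rintro ⟨s, h1, h2, h3⟩
      have hnt : ¬ A.IsTrivial (A.next s a) := fun h => hne ((h.out z).symm.trans h2)
      obtain ⟨c, hc, -⟩ := hII s fun h => hnt (h.next a)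
      obtain rfl : a = c := by
        by_contra hac
        exact hnt (hc.2.2.2 a hac)
      rw [hc.2.2.1] at h2
      exact ⟨s, hc, h2⟩
    · rintro ⟨s, hs, h2⟩
      have hza : z ≠ a := by
        rintro rfl
        exact hne (hs.2.1.symm.trans h2)
      exact ⟨s, hs.2.1, by rw [hs.2.2.1, h2], by rw [hs.2.2.1]; exact hs.2.2.2 z hza⟩
  have hfixed : ∀ a z, ¬ A.EdgeAt a a z := by
    intro a z h
    obtain ⟨hne, s, hs, h⟩ := (hedge _ _ _).1 h
    exact hne (hs.2.1.symm.trans h)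
  obtain ⟨n, e, hn, rfl, rfl, hadj⟩ := exists_letter_enumeration hA hP hxy hx hy
  have hpair := pairRel_of_path (e := e) (R := A.EdgeAt (e 0)) (Q := A.EdgeAt (e (Fin.last n)))
    (fun _ _ => EdgeAt.symm) (fun _ _ => EdgeAt.symm) (fun _ _ _ => EdgeAt.eq hP)
    (fun _ _ _ => EdgeAt.eq hP) (fun i j => ?_) (hfixed _)
  · refine ⟨n, e, ?_, hall, (orbitsArePairs_iff hA.invertible (by grind)).2 fun z z' => ?_,
      (orbitsArePairs_iff hA.invertible (by grind)).2 fun z z' => ?_⟩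
    · have := PairRel.not_of_last (e := e) (p := Even) hn
        fun z hz => hfixed _ z ((hpair.2 _ _).1 hz)
      grind
    · rw [hpair.1, hedge]
    · rw [hpair.2, hedge]
  · rw [← hadj, wordGraph_adj_singleton hA, hedge, hedge, ← and_or_left]
    refine and_congr_right fun hne => ⟨?_, ?_⟩
    · rintro (⟨s, hs, h⟩ | ⟨s, hs, h⟩) <;>
      · refine ⟨s, h, hs.2.2.2 _ ?_⟩
        intro h'
        apply hne
        rw [← h, h', hs.2.1]
    · rintro ⟨s, h, h'⟩
      rcases hall s with hs | hs | hs
      · exact absurd ((hs.out _).symm.trans h) hne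
      · exact .inl ⟨s, hs, h⟩
      · exact .inr ⟨s, hs, h⟩

/-- The nontrivial restriction makes `a a` and `a y` the two ends of the second level. Hence all
loops of nontrivial states are at `a`, and only at `y` can a looping state have another nontrivial
restriction. The two matchings come from the words beginning with `a` and with `y`. -/
theorem exists_isPairedIII {s : S} {a y : X} (ha : A.next s a = s) (hya : y ≠ a)
    (hf : ¬ A.IsTrivial (A.next s y)) : ∃ (n : ℕ) (e : Fin (n + 1) ≃ X), A.IsPairedIII e := by
  have hsa : A.out s a = a := hfix s a ha
  have h0 := isEndWord_of_section hA hb hP ha hya hf 0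
  have h1 := isEndWord_of_section hA hb hP ha hya hf 1
  have h2 := isEndWord_of_section hA hb hP ha hya hf 2
  simp only [hsa, List.replicate, List.cons_append, List.nil_append] at h0 h1 h2
  have haa : A.IsEndWord [a, a] := TilesArePaths.isEndWord_of_append (v := [a, a]) (u := [y]) h2.1
  have hea : A.IsEndWord [a] := TilesArePaths.isEndWord_of_append (v := [a]) (u := [a]) haa
  have hends : ∀ c z, A.IsEndWord [c, z] → c = a ∧ (z = a ∨ z = y) := by
    intro c z h
    rcases hP.eq_or_eq haa h1.1 h (by simpa using hya.symm) (by simp) (by simp) (by simp)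
      with h | h <;> simp_all
  have hloop : ∀ t c, ¬ A.IsTrivial t → A.next t c = t → c = a := by
    intro t c ht hc
    rcases exists_move_or_section hc ht hA.invertible with ⟨z, -, hz, hm⟩ | ⟨z, hz, hnt⟩
    · exact (hends c c (isEndWord_of_move hA hP hc hz hm 2).2.1).1
    · exact (hends c z (isEndWord_of_section hA hb hP hc hz hnt 1).1).1
  have hsec : ∀ t z, A.next t a = t → z ≠ a → ¬ A.IsTrivial (A.next t z) →
      z = y ∧ A.out t z = z := by
    intro t z ht hz hnt
    have h := isEndWord_of_section hA hb hP ht hz hnt 1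
    rw [hfix t a ht] at h
    obtain rfl := (hends _ _ h.1).2.resolve_left hz
    refine ⟨rfl, (hends _ _ h.2).2.resolve_left fun h' => hz ?_⟩
    exact (hA.invertible t).1 (h'.trans (hfix t a ht).symm)
  have hall : ∀ t, A.IsTrivial t ∨ A.IsTypeII a t ∨ A.IsTypeIII a y t ∨ A.IsTypeIII' t := by
    intro t
    by_cases ht : A.IsTrivial t
    · exact .inl ht
    rcases next_eq_self_or_isTrivial hA hb t with h | ⟨c, hc, -, h⟩
    · exact .inr (.inr (.inr ⟨ht, h⟩))
    obtain rfl := hloop t c ht hc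
    by_cases hty : A.IsTrivial (A.next t y)
    · refine .inr (.inl ⟨ht, hfix t c hc, hc, fun z hz => ?_⟩)
      by_contra hnt
      obtain ⟨rfl, -⟩ := hsec t z hc hz hnt
      exact hnt hty
    · refine .inr (.inr (.inl ⟨hfix t c hc, hc, (hsec t y hc hya hty).2, ⟨hty, h y hya⟩,
        fun z hz hzy => ?_⟩))
      by_contra hnt
      exact hzy (hsec t z hc hz hnt).1
  have hedge : ∀ z z', A.EdgeAt a z z' ↔
      z ≠ z' ∧ ∃ s, (A.IsTypeII a s ∨ A.IsTypeIII a y s) ∧ A.out s z = z' := by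
    intro z z'
    rw [edgeAt_iff hA]
    refine and_congr_right fun hne => ⟨?_, ?_⟩
    · rintro ⟨s, h1, h2, h3⟩
      have hnt : ¬ A.IsTrivial (A.next s a) := fun h => hne ((h.out z).symm.trans h2)
      rcases hall s with hs | hs | hs | hs
      · exact absurd (hs.next a) hnt
      · rw [hs.2.2.1] at h2
        exact ⟨s, .inl hs, h2⟩
      · rw [hs.2.1] at h2
        exact ⟨s, .inr hs, h2⟩
      · exact absurd (hs.2 a) hnt
    · rintro ⟨s, hs | hs, hsz⟩
      · have hza : z ≠ a := by
          rintro rfl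
          exact hne (hs.2.1.symm.trans hsz)
        exact ⟨s, hs.2.1, by rw [hs.2.2.1, hsz], by rw [hs.2.2.1]; exact hs.2.2.2 z hza⟩
      · have hza : z ≠ a := by
          rintro rfl
          exact hne (hs.1.symm.trans hsz)
        have hzy : z ≠ y := by
          rintro rfl
          exact hne (hs.2.2.1.symm.trans hsz)
        exact ⟨s, hs.1, by rw [hs.2.1, hsz], by rw [hs.2.1]; exact hs.2.2.2.2 z hza hzy⟩
  have hedge' : ∀ z z', A.EdgeAt y z z' ↔ z ≠ z' ∧ ∃ s, A.IsTypeIII' s ∧ A.out s z = z' := by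
    intro z z'
    rw [edgeAt_iff hA]
    refine and_congr_right fun hne => ⟨?_, ?_⟩
    · rintro ⟨s, h1, h2, h3⟩
      have hnt : ¬ A.IsTrivial (A.next s y) := fun h => hne ((h.out z).symm.trans h2)
      rcases hall s with hs | hs | hs | hs
      · exact absurd (hs.next y) hnt
      · exact absurd (hs.2.2.2 y hya) hnt
      · exact ⟨_, hs.2.2.2.1, h2⟩
      · exact absurd (hs.2 y) hnt
    · rintro ⟨f, hf, h2⟩
      obtain ⟨s, hs, rfl⟩ := hf.exists_typeIII hA hall
      exact ⟨s, hs.2.2.1, h2, hf.2 z⟩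
  have hfixed : ∀ z, ¬ A.EdgeAt a a z := by
    intro z h
    obtain ⟨hne, s, hs | hs, h⟩ := (hedge _ _).1 h
    · exact hne (hs.2.1.symm.trans h)
    · exact hne (hs.1.symm.trans h)
  obtain ⟨n, e, hn, rfl, rfl, hadj⟩ := exists_letter_enumeration hA hP hya.symm hea h0.1
  have hpair := pairRel_of_path (e := e) (R := A.EdgeAt (e 0)) (Q := A.EdgeAt (e (Fin.last n)))
    (fun _ _ => EdgeAt.symm) (fun _ _ => EdgeAt.symm) (fun _ _ _ => EdgeAt.eq hP)
    (fun _ _ _ => EdgeAt.eq hP) (fun i j => ?_) hfixed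
  · refine ⟨n, e, ?_, hall, (orbitsArePairs_iff hA.invertible (by grind)).2 fun z z' => ?_,
      (orbitsArePairs_iff hA.invertible (by grind)).2 fun z z' => ?_⟩
    -- The word `a y` is an end that already has a neighbour in its own copy, so the matching at `a`
    -- misses `y`. This gives the parity.
    · have := PairRel.not_of_last (e := e) (p := Odd) hn fun z hz => by
        have h := (hpair.1 _ _).1 hz
        exact hP.not_adj_of_isEndWord (v := [e 0]) (v' := [e 0]) (by simp) h1.1 h.1 h.2
      grind
    · rw [hpair.1, hedge]
    · rw [hpair.2, hedge']
  · rw [← hadj, wordGraph_adj_singleton hA, hedge, hedge', ← and_or_left]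
    refine and_congr_right fun hne => ⟨?_, ?_⟩
    · rintro (⟨s, hs | hs, h⟩ | ⟨s, hs, h⟩)
      · refine ⟨s, h, hs.2.2.2 _ fun h' => hne ?_⟩
        rw [← h, h', hs.2.1]
      · refine ⟨s, h, hs.2.2.2.2 _ (fun h' => hne ?_) fun h' => hne ?_⟩
        · rw [← h, h', hs.1]
        · rw [← h, h', hs.2.2.1]
      · exact ⟨s, h, hs.2 _⟩
    · rintro ⟨s, h, h'⟩
      rcases hall s with hs | hs | hs | hs
      · exact absurd ((hs.out _).symm.trans h) hne
      · exact .inl ⟨s, .inl hs, h⟩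
      · exact .inl ⟨s, .inr hs, h⟩
      · exact .inr ⟨s, hs, h⟩

end Paired

theorem TilesArePaths.classification [Finite X] [Nontrivial X] (hA : A.IsTame) (hb : A.IsBasic)
    (hP : A.TilesArePaths) : A.IsAddingMachine ∨
      (∃ (n : ℕ) (e : Fin (n + 1) ≃ X), A.IsPairedII e) ∨
      (∃ (n : ℕ) (e : Fin (n + 1) ≃ X), A.IsPairedIII e) := by
  by_cases hfix : ∀ s a, A.next s a = s → A.out s a = a
  · refine .inr ?_
    by_cases hsec : ∀ s a, A.next s a = s → ∀ z, z ≠ a → A.IsTrivial (A.next s z)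
    · exact .inl (exists_isPairedII hA hb hP hfix hsec)
    · push Not at hsec
      obtain ⟨s, a, ha, z, hz, hf⟩ := hsec
      exact .inr (exists_isPairedIII hA hb hP hfix ha hz hf)
  · push Not at hfix
    obtain ⟨s, a, ha, hne⟩ := hfix
    exact .inl (isAddingMachine_of_loop_out_ne hA hb hP ha hne)

end Transducer

/-! ### Cylinder sets in the space of sequences -/

section Bernoulli

/-- Cylinders are written as boxes so that the product measure can be evaluated. The default letter
of `getD` is never read, as the indices run over an interval of length `|v|`. -/
theorem setOf_seqPrefix_seqShift {X : Type*} [Nonempty X] (n : ℕ) (v : List X) :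
    {w : ℕ → X | seqPrefix (seqShift w n) v.length = v} =
      Set.pi (Finset.Ico n (n + v.length) : Finset ℕ)
        fun j => {v.getD (j - n) (Classical.arbitrary X)} := by
  ext w
  simp only [Set.mem_ofPred_eq, Set.mem_pi, Finset.coe_Ico, Set.mem_Ico, Set.mem_singleton_iff]
  constructor
  · rintro h j ⟨h1, h2⟩
    rw [← h]
    have : j - n < v.length := by omega
    simp [seqPrefix, List.getD_eq_getElem?_getD, this, seqShift, h1]
  · intro h
    refine List.ext_getElem (by simp) fun i h1 h2 => ?_
    have := h (n + i) ⟨by omega, by omega⟩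
    simp [seqPrefix, seqShift, this, List.getD_eq_getElem?_getD, h2]

theorem measurableSet_seqPrefix_seqShift {X : Type*} [Nonempty X] [MeasurableSpace X]
    [DiscreteMeasurableSpace X] (n : ℕ) (v : List X) :
    MeasurableSet {w : ℕ → X | seqPrefix (seqShift w n) v.length = v} := by
  rw [setOf_seqPrefix_seqShift]
  exact MeasurableSet.pi (Finset.countable_toSet _) fun _ _ => .of_discrete

variable {X : Type*} [Fintype X] [Nonempty X] [MeasurableSpace X] [DiscreteMeasurableSpace X]

instance : IsProbabilityMeasure (bernoulliMeasure X) := by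
  unfold bernoulliMeasure; infer_instance

theorem bernoulliMeasure_seqPrefix_seqShift (n : ℕ) (v : List X) :
    bernoulliMeasure X {w : ℕ → X | seqPrefix (seqShift w n) v.length = v} =
      (Fintype.card X : ENNReal)⁻¹ ^ v.length := by
  rw [setOf_seqPrefix_seqShift, bernoulliMeasure, Measure.infinitePi_pi _ fun _ _ => .of_discrete]
  have h : ∀ x : X, (PMF.uniformOfFintype X).toMeasure {x} = (Fintype.card X : ENNReal)⁻¹ :=
    fun x => by rw [PMF.toMeasure_apply_singleton _ _ (.singleton x), PMF.uniformOfFintype_apply]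
  rw [Finset.prod_congr rfl fun j _ => h _, Finset.prod_const, Nat.card_Ico,
    Nat.add_sub_cancel_left]

/-- The set of sequences that contain a given word infinitely often at positions divisible by `m`
is not negligible. -/
theorem not_ae_not_frequent (m : ℕ) (v : List X) : ¬ ∀ᵐ w ∂bernoulliMeasure X,
    ¬ ∀ N, ∃ n ≥ N, seqPrefix (seqShift w (n * m)) v.length = v := by
  intro h
  rw [ae_iff] at h
  simp only [not_not] at h
  have hset : {w : ℕ → X | ∀ N, ∃ n ≥ N, seqPrefix (seqShift w (n * m)) v.length = v} =
      ⋂ N, ⋃ n ≥ N, {w : ℕ → X | seqPrefix (seqShift w (n * m)) v.length = v} := by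
    ext w; simp
  -- An upper limit of events whose probabilities are bounded below has positive probability, by
  -- continuity from above; independence is not needed.
  rw [hset, Antitone.measure_iInter] at h
  · have hc : (Fintype.card X : ENNReal)⁻¹ ^ v.length ≤
        ⨅ N : ℕ, bernoulliMeasure X
          (⋃ n ≥ N, {w : ℕ → X | seqPrefix (seqShift w (n * m)) v.length = v}) := by
      refine le_iInf fun N => ?_
      rw [← bernoulliMeasure_seqPrefix_seqShift (N * m) v]
      exact measure_mono (Set.subset_biUnion_of_mem
        (u := fun n => {w : ℕ → X | seqPrefix (seqShift w (n * m)) v.length = v}) (le_refl N))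
    rw [h, nonpos_iff_eq_zero] at hc
    exact (pow_ne_zero _ (by simp)) hc
  · intro N N' hN
    exact Set.biUnion_subset_biUnion_left fun n hn => le_trans hN hn
  · exact fun N => (MeasurableSet.iUnion fun n => MeasurableSet.iUnion fun _ =>
      measurableSet_seqPrefix_seqShift _ _).nullMeasurableSet
  · exact ⟨0, measure_ne_top _ _⟩

instance {X : Type*} [Fintype X] [Nontrivial X] [MeasurableSpace X] [DiscreteMeasurableSpace X] :
    NullSingletonClass (bernoulliMeasure X) where
  measure_singleton w := by
    have hle : ∀ n, bernoulliMeasure X {w} ≤ (Fintype.card X : ENNReal)⁻¹ ^ n := by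
      intro n
      have h := bernoulliMeasure_seqPrefix_seqShift 0 (seqPrefix w n)
      rw [length_seqPrefix] at h
      rw [← h]
      refine measure_mono ?_
      intro v hv
      rw [Set.mem_singleton_iff.1 hv]
      change seqPrefix (fun i => w (0 + i)) n = seqPrefix w n
      simp
    have h1 : (Fintype.card X : ENNReal)⁻¹ < 1 := by
      rw [ENNReal.inv_lt_one]
      exact_mod_cast Fintype.one_lt_card
    exact le_antisymm (ge_of_tendsto' (ENNReal.tendsto_pow_atTop_nhds_zero_of_lt_one h1) hle) bot_le

end Bernoulli

namespace Transducer

variable {S X : Type*} {A : Transducer S X}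

theorem countable_orbit [Finite S] (hA : A.IsSymmetric) (w : ℕ → X) :
    (MulAction.orbit A.group w).Countable := by
  refine (Set.countable_range fun L : List S => L.foldr A.act w).mono fun u hu => ?_
  rw [mem_orbit_iff hA, SimpleGraph.reachable_iff_reflTransGen] at hu
  induction hu with
  | refl => exact ⟨[], rfl⟩
  | tail _ h ih =>
    obtain ⟨L, rfl⟩ := ih
    obtain ⟨-, s, rfl⟩ := (seqGraph_adj hA).1 h
    exact ⟨s :: L, rfl⟩

/-! ### Schreier graphs and tile graphs -/

/-- The sequences along which some state has no trivial restriction. -/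
def criticalSeqs (A : Transducer S X) : Set (ℕ → X) :=
  {w | ∃ s, ∀ n, ¬ A.IsTrivial (A.stateAt s w n)}

theorem seqPrefix_injective {v w : ℕ → X} (h : ∀ n, seqPrefix v n = seqPrefix w n) : v = w := by
  funext n
  have := h (n + 1)
  rw [seqPrefix_succ, seqPrefix_succ] at this
  simpa using (List.append_inj' this rfl).2

/-- The prefixes of `C + 1` critical sequences, long enough to be distinct, would give `C + 1`
nontrivial paths of equal length. -/
theorem IsBounded.finite_criticalSeqs [Finite X] [Finite S] (hA : A.IsBounded) :
    A.criticalSeqs.Finite := by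
  classical
  by_contra hinf
  replace hinf : A.criticalSeqs.Infinite := hinf
  obtain ⟨C, hC⟩ := hA
  obtain ⟨t, ht, hcard⟩ := Set.Infinite.exists_subset_card_eq hinf (C + 1)
  have hsep : ∀ p : (ℕ → X) × (ℕ → X), ∃ n, p.1 ≠ p.2 → seqPrefix p.1 n ≠ seqPrefix p.2 n := by
    intro p
    by_cases hp : p.1 = p.2
    · exact ⟨0, fun h => absurd hp h⟩
    · by_contra h
      push Not at h
      exact hp (seqPrefix_injective fun n => (h n).2)
  choose N hN using hsep
  let n := (t ×ˢ t).sup N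
  have hinj : ∀ v ∈ t, ∀ w ∈ t, seqPrefix v n = seqPrefix w n → v = w := by
    intro v hv w hw h
    by_contra hne
    apply hN (v, w) hne
    have hle : N (v, w) ≤ n := Finset.le_sup (f := N) (Finset.mem_product.2 ⟨hv, hw⟩)
    obtain ⟨k, hk⟩ := Nat.exists_eq_add_of_le hle
    rw [hk, seqPrefix_add, seqPrefix_add] at h
    exact (List.append_inj h (by simp)).1
  have hex : ∀ w, ∃ s, w ∈ t → ∀ n, ¬ A.IsTrivial (A.stateAt s w n) := by
    intro w
    by_cases hw : w ∈ t
    · obtain ⟨s, hs⟩ := ht hw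
      exact ⟨s, fun _ => hs⟩
    · obtain ⟨v, hv⟩ := hinf.nonempty
      exact ⟨hv.choose, fun h => absurd h hw⟩
  choose s hs using hex
  have hfin : Finite (List.Vector X n) := by
    have := Fintype.ofFinite X; infer_instance
  have hle := Set.ncard_le_ncard_of_injOn
    (fun w => ((s w, toVec (seqPrefix w n) (by simp)) : S × List.Vector X n))
    (s := (t : Set (ℕ → X))) (t := A.nontrivialPaths n) ?_ ?_ (Set.toFinite _)
  · rw [Set.ncard_coe_finset, hcard] at hle
    have := hC n
    omega
  · intro w hw
    rw [mem_nontrivialPaths]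
    change ¬ A.IsTrivial (A.run (s w) (seqPrefix w n))
    rw [← stateAt_eq_run]
    exact hs w hw n
  · intro v hv w hw h
    exact hinj v hv w hw (congrArg (fun p => p.2.toList) h)

/-- Outside of the orbits of critical sequences, tile graphs are Schreier graphs. -/
theorem nonempty_tileGraph_iso (hA : A.IsSymmetric) {w : ℕ → X}
    (hw : ∀ v ∈ MulAction.orbit A.group w, v ∉ A.criticalSeqs) :
    Nonempty (A.tileGraph w ≃g A.schreierGraph w) := by
  -- Along a sequence that is not critical every state has a trivial restriction, so every edge of
  -- the Schreier graph there is an edge of the tile graph.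
  have hadj : ∀ v ∈ MulAction.orbit A.group w, ∀ u,
      A.tileEdges.Adj v u ↔ A.seqGraph.Adj v u := by
    intro v hv u
    rw [seqGraph_adj hA, tileEdges, SimpleGraph.fromRel_adj]
    refine and_congr_right fun hne => ⟨?_, ?_⟩
    · rintro (⟨s, h, -⟩ | ⟨s, h, -⟩)
      · exact ⟨s, h⟩
      · obtain ⟨t, ht⟩ := hA s
        exact ⟨t, by rw [← h, (ht u).2]⟩
    · rintro ⟨s, h⟩
      refine .inl ⟨s, h, ?_⟩
      by_contra hs
      push Not at hs
      exact hw v hv ⟨s, hs⟩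
  have hmem : ∀ u, u ∈ A.tileEdges.connectedComponentMk w ↔ u ∈ MulAction.orbit A.group w := by
    intro u
    change u ∈ (A.tileEdges.connectedComponentMk w).supp ↔ _
    rw [SimpleGraph.ConnectedComponent.mem_supp_iff, SimpleGraph.ConnectedComponent.eq]
    constructor
    · intro h
      refine h.symm.closed (s := MulAction.orbit A.group w) ?_ (MulAction.mem_orbit_self w)
      intro v hv y h
      rw [mem_orbit_iff hA] at hv ⊢
      exact hv.trans (SimpleGraph.Adj.reachable ((hadj v ((mem_orbit_iff hA).2 hv) y).1 h))
    · intro h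
      rw [mem_orbit_iff hA] at h
      refine SimpleGraph.Reachable.symm ?_
      refine (h.closed (s := {v | A.tileEdges.Reachable w v ∧ v ∈ MulAction.orbit A.group w}) ?_
        ⟨.rfl, MulAction.mem_orbit_self w⟩).1
      rintro v ⟨hv, hvo⟩ y h
      refine ⟨hv.trans (SimpleGraph.Adj.reachable ((hadj v hvo y).2 h)), ?_⟩
      rw [mem_orbit_iff hA] at hvo ⊢
      exact hvo.trans (SimpleGraph.Adj.reachable h)
  refine ⟨⟨Equiv.subtypeEquivRight hmem, ?_⟩⟩
  intro a b
  rw [schreierGraph_adj]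
  exact (hadj a.1 ((hmem _).1 a.2) b.1).symm

theorem seqShift_blocks {m : ℕ} (hm : 0 < m) (w : ℕ → X) (n : ℕ) :
    seqShift (blocks hm w) n = blocks hm (seqShift w (n * m)) := by
  funext k
  refine Subtype.ext ?_
  change seqPrefix (seqShift w ((n + k) * m)) m =
    seqPrefix (seqShift (seqShift w (n * m)) (k * m)) m
  rw [add_mul, seqShift_add]

section AlmostAll

variable [Fintype X] [Nontrivial X] [MeasurableSpace X] [DiscreteMeasurableSpace X] [Finite S]

theorem ae_notMem_orbit (hA : A.IsSymmetric) (v : ℕ → X) :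
    ∀ᵐ w ∂bernoulliMeasure X, w ∉ MulAction.orbit A.group v :=
  (countable_orbit hA v).ae_notMem _

/-- The finitely many critical sequences have countable orbits, which are null; on all other orbits
the two graphs are isomorphic. -/
theorem ae_hasTwoEnds_schreierGraph_iff (hA : A.IsSymmetric) (hb : A.IsBounded) :
    (∀ᵐ w ∂bernoulliMeasure X, HasTwoEnds (A.schreierGraph w)) ↔
      ∀ᵐ w ∂bernoulliMeasure X, HasTwoEnds (A.tileGraph w) := by
  have h : ∀ᵐ w ∂bernoulliMeasure X, ∀ v ∈ A.criticalSeqs, w ∉ MulAction.orbit A.group v :=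
    (ae_ball_iff hb.finite_criticalSeqs.countable).2 fun v _ => ae_notMem_orbit hA v
  refine Filter.eventually_congr (h.mono fun w hw => ?_)
  obtain ⟨φ⟩ := nonempty_tileGraph_iso hA (w := w) fun v hv hv' =>
    hw v hv' ((MulAction.orbit_eq_iff.2 hv) ▸ MulAction.mem_orbit_self w)
  exact (hasTwoEnds_congr φ).symm

theorem IsTame.classification_of_ae_hasTwoEnds (hA : A.IsTame) {m : ℕ} (hm : 0 < m)
    (hb : (A.power m).IsBasic) (h : ∀ᵐ w ∂bernoulliMeasure X, HasTwoEnds (A.schreierGraph w)) :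
    (A.power m).IsAddingMachine ∨
      (∃ (n : ℕ) (e : Fin (n + 1) ≃ List.Vector X m), (A.power m).IsPairedII e) ∨
      (∃ (n : ℕ) (e : Fin (n + 1) ≃ List.Vector X m), (A.power m).IsPairedIII e) := by
  have : Nontrivial (List.Vector X m) := nontrivial_vector hm
  have hB := hA.power hm
  have H : ∀ u, (A.power m).IsNoncritical u → ¬ (A.power m).IsNonCutWord u := by
    intro u hu hcut
    -- Occurrences of `u` in the sequence of blocks are occurrences of `flat u` at positions
    -- divisible by `m`; a non-null set of sequences has infinitely many of them, and their graphs
    -- have at most one end.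
    refine not_ae_not_frequent m (flat u) (h.mono fun w hw hfreq => ?_)
    obtain ⟨r, r', hr⟩ := ((hasTwoEnds_congr (hA.schreierIso hm w)).1 hw).exists_not_equivalent
    refine hr (hB.equivalent_of_frequent hu hcut (fun N => ?_) r r')
    obtain ⟨n, hn, h⟩ := hfreq N
    refine ⟨n, hn, flat_injective_of_length (by simp) ?_⟩
    rwa [seqShift_blocks, flat_seqPrefix_blocks, ← length_flat]
  exact (hB.tilesArePaths (ncard_isNonCut_le_two hB H hb)).classification hB hb

end AlmostAll

end Transducer

namespace Transducer

/-! ### The shape of the Schreier graphs -/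

variable {S X : Type*} {A : Transducer S X}

theorem IsTame.isLineGraph_of_power [Nonempty X] (hA : A.IsTame) {m : ℕ} (hm : 0 < m) {w : ℕ → X}
    (h : IsLineGraph ((A.power m).schreierGraph (blocks hm w))) : IsLineGraph (A.schreierGraph w) :=
  h.map (hA.schreierIso hm w).trans

theorem IsTame.isRayGraph_periodicSeq [Nonempty X] (hA : A.IsTame) {m : ℕ} (hm : 0 < m)
    {v : List.Vector X m} (h : IsRayGraph ((A.power m).schreierGraph fun _ => v)) :
    IsRayGraph (A.schreierGraph (periodicSeq hm v)) := by
  rw [← blocks_periodicSeq hm v] at h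
  exact h.map (hA.schreierIso hm _).trans

theorem IsTame.periodicSeq_mem_orbit_iff [Nonempty X] (hA : A.IsTame) {m : ℕ} (hm : 0 < m)
    {v : List.Vector X m} {w : ℕ → X} :
    w ∈ MulAction.orbit A.group (periodicSeq hm v) ↔
      blocks hm w ∈ MulAction.orbit (A.power m).group fun _ => v := by
  rw [← hA.mem_orbit_power hm, blocks_periodicSeq]

theorem IsPairedII.schreierGraph [Nontrivial X] (hA : A.IsTame) {n : ℕ} {e : Fin (n + 1) ≃ X}
    (h : A.IsPairedII e) :
    (fun _ => e (Fin.last n)) ∉ MulAction.orbit A.group (fun _ : ℕ => e 0) ∧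
    IsRayGraph (A.schreierGraph fun _ => e 0) ∧
    IsRayGraph (A.schreierGraph fun _ => e (Fin.last n)) ∧
    ∀ w, w ∉ MulAction.orbit A.group (fun _ : ℕ => e 0) →
      w ∉ MulAction.orbit A.group (fun _ : ℕ => e (Fin.last n)) →
      IsLineGraph (A.schreierGraph w) := by
  obtain ⟨hne, h0, h1, h2⟩ := h.shape hA
  have hmem : (fun _ => e (Fin.last n)) ∉ MulAction.orbit A.group (fun _ : ℕ => e 0) :=
    hA.notMem_orbit hne h0 h1 h2
  refine ⟨hmem, hA.isRayGraph h0 fun v hv hv0 => h2 v hv0 ?_,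
    hA.isRayGraph h1 fun v hv hv1 => h2 v ?_ hv1, fun w hw0 hw1 => hA.isLineGraph fun v hv =>
      h2 v ?_ ?_⟩
  · rintro rfl; exact hmem hv
  · rintro rfl; exact hmem (MulAction.mem_orbit_symm.1 hv)
  · rintro rfl; exact hw0 (MulAction.mem_orbit_symm.1 hv)
  · rintro rfl; exact hw1 (MulAction.mem_orbit_symm.1 hv)

theorem IsPairedIII.schreierGraph [Nontrivial X] (hA : A.IsTame) {n : ℕ} {e : Fin (n + 1) ≃ X}
    (h : A.IsPairedIII e) :
    IsRayGraph (A.schreierGraph fun _ => e 0) ∧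
    ∀ w, w ∉ MulAction.orbit A.group (fun _ : ℕ => e 0) → IsLineGraph (A.schreierGraph w) := by
  obtain ⟨h0, h2⟩ := h.shape hA
  refine ⟨hA.isRayGraph h0 fun v _ hv0 => h2 v hv0, fun w hw0 => hA.isLineGraph fun v hv =>
      h2 v ?_⟩
  rintro rfl
  exact hw0 (MulAction.mem_orbit_symm.1 hv)

end Transducer

theorem mainTheorem1 {X S : Type*} [Fintype X] [Nontrivial X] [MeasurableSpace X]
    [DiscreteMeasurableSpace X] [Finite S] (A : Transducer S X)
    (h_invertible : A.IsInvertible) (h_minimal : A.IsMinimal) (h_bounded : A.IsBounded)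
    (h_connected : ∀ n, (A.finiteTileGraph n).Connected)
    (h_incoming : A.HasIncomingArrows) (h_symmetric : A.IsSymmetric) :
    -- the automaton can be brought to basic form by passing to a power of the alphabet
    (∃ m, 0 < m ∧ (A.power m).IsBasic) ∧
    -- "Schreier graphs" and "tile graphs" are equivalent in the condition
    ((∀ᵐ w ∂bernoulliMeasure X, HasTwoEnds (A.schreierGraph w)) ↔
      (∀ᵐ w ∂bernoulliMeasure X, HasTwoEnds (A.tileGraph w))) ∧
    -- for every basic form of the automaton
    ∀ (m : ℕ) (hm : 0 < m), (A.power m).IsBasic →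
      -- the classification
      ((∀ᵐ w ∂bernoulliMeasure X, HasTwoEnds (A.schreierGraph w)) ↔
        ((A.power m).IsAddingMachine ∨
          (∃ (n : ℕ) (e : Fin (n + 1) ≃ List.Vector X m), (A.power m).IsPairedII e) ∨
          (∃ (n : ℕ) (e : Fin (n + 1) ≃ List.Vector X m), (A.power m).IsPairedIII e))) ∧
      -- the shape of all Schreier graphs in each case
      ((A.power m).IsAddingMachine → ∀ w, IsLineGraph (A.schreierGraph w)) ∧
      (∀ (n : ℕ) (e : Fin (n + 1) ≃ List.Vector X m), (A.power m).IsPairedII e →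
        periodicSeq hm (e (Fin.last n)) ∉ MulAction.orbit A.group (periodicSeq hm (e 0)) ∧
        IsRayGraph (A.schreierGraph (periodicSeq hm (e 0))) ∧
        IsRayGraph (A.schreierGraph (periodicSeq hm (e (Fin.last n)))) ∧
        ∀ w, w ∉ MulAction.orbit A.group (periodicSeq hm (e 0)) →
          w ∉ MulAction.orbit A.group (periodicSeq hm (e (Fin.last n))) →
          IsLineGraph (A.schreierGraph w)) ∧
      (∀ (n : ℕ) (e : Fin (n + 1) ≃ List.Vector X m), (A.power m).IsPairedIII e →
        IsRayGraph (A.schreierGraph (periodicSeq hm (e 0))) ∧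
        ∀ w, w ∉ MulAction.orbit A.group (periodicSeq hm (e 0)) →
          IsLineGraph (A.schreierGraph w)) := by
  have hA : A.IsTame := ⟨h_invertible, h_minimal, h_connected, h_incoming, h_symmetric⟩
  refine ⟨h_bounded.exists_isBasic_power,
    Transducer.ae_hasTwoEnds_schreierGraph_iff h_symmetric h_bounded, fun m hm hb => ?_⟩
  have := Transducer.nontrivial_vector (X := X) hm
  have hB := hA.power hm
  have h1 : (A.power m).IsAddingMachine → ∀ w, IsLineGraph (A.schreierGraph w) := fun h w =>
    hA.isLineGraph_of_power hm (hB.isLineGraph_of_isAddingMachine h _)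
  have h2 : ∀ (n : ℕ) (e : Fin (n + 1) ≃ List.Vector X m), (A.power m).IsPairedII e →
        periodicSeq hm (e (Fin.last n)) ∉ MulAction.orbit A.group (periodicSeq hm (e 0)) ∧
        IsRayGraph (A.schreierGraph (periodicSeq hm (e 0))) ∧
        IsRayGraph (A.schreierGraph (periodicSeq hm (e (Fin.last n)))) ∧
        ∀ w, w ∉ MulAction.orbit A.group (periodicSeq hm (e 0)) →
          w ∉ MulAction.orbit A.group (periodicSeq hm (e (Fin.last n))) →
          IsLineGraph (A.schreierGraph w) := by
    intro n e h
    obtain ⟨ho, hr, hr', hl⟩ := h.schreierGraph hB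
    simp only [hA.periodicSeq_mem_orbit_iff hm, Transducer.blocks_periodicSeq]
    exact ⟨ho, hA.isRayGraph_periodicSeq hm hr, hA.isRayGraph_periodicSeq hm hr',
      fun w hw hw' => hA.isLineGraph_of_power hm (hl _ hw hw')⟩
  have h3 : ∀ (n : ℕ) (e : Fin (n + 1) ≃ List.Vector X m), (A.power m).IsPairedIII e →
        IsRayGraph (A.schreierGraph (periodicSeq hm (e 0))) ∧
        ∀ w, w ∉ MulAction.orbit A.group (periodicSeq hm (e 0)) →
          IsLineGraph (A.schreierGraph w) := by
    intro n e h
    obtain ⟨hr, hl⟩ := h.schreierGraph hB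
    simp only [hA.periodicSeq_mem_orbit_iff hm]
    exact ⟨hA.isRayGraph_periodicSeq hm hr, fun w hw => hA.isLineGraph_of_power hm (hl _ hw)⟩
  refine ⟨⟨hA.classification_of_ae_hasTwoEnds hm hb, ?_⟩, h1, h2, h3⟩
  -- In each case all graphs outside at most two orbits are lines, and orbits are null.
  rintro (h | ⟨n, e, h⟩ | ⟨n, e, h⟩)
  · exact .of_forall fun w => (h1 h w).hasTwoEnds
  · filter_upwards [Transducer.ae_notMem_orbit h_symmetric (periodicSeq hm (e 0)),
      Transducer.ae_notMem_orbit h_symmetric (periodicSeq hm (e (Fin.last n)))] with w hw hw'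
    exact ((h2 n e h).2.2.2 w hw hw').hasTwoEnds
  · filter_upwards [Transducer.ae_notMem_orbit h_symmetric (periodicSeq hm (e 0))] with w hw
    exact ((h3 n e h).2 w hw).hasTwoEnds
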